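/- **Language.** Types are built by $\to$ from base types $\iota$ (individuals), $\mathsf h$ (positive formulae), $\mathsf a$ (atoms), $\mathsf r$ (rigid atoms), $\mathsf p$ (programs), $\mathsf g$ (goals) and arbitrary user base types. A type is *non-logical* if it is built from $\iota$ and user types only. There are (bound and logic) variables exactly at the non-logical types and at the types $\alpha_1\to\dots\to\alpha_n\to b$ with $b\in\{\mathsf a,\mathsf h\}$, $n\ge 0$ and each $\alpha_k$ equal to $\mathsf h$ or non-logical; non-logical constants exist at these types and at such types with $b=\mathsf r$. Every logic variable and non-logical constant has a label in $\mathbb N$; for each admissible type and label there are countably many logic variables and infinitely many constants. The logical constants are $\top_{\mathsf g},\top_{\mathsf h}$, a constant $\top_{\mathsf p}$ (the empty program), $\wedge$ on $\mathsf p,\mathsf g,\mathsf h$, $\vee$ on $\mathsf g,\mathsf h$, $\supset:\mathsf p\to\mathsf g\to\mathsf g$, $\supset:\mathsf g\to\mathsf r\to\mathsf p$, and for each type $\alpha$ with variables $\Sigma_\alpha$ ($\exists$) for $\mathsf g,\mathsf h$ and $\Pi_\alpha$ ($\forall$) for $\mathsf g,\mathsf p,\mathsf h$. There are inclusions $\mathsf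 r\subseteq\mathsf a\subseteq\mathsf h\subseteq\mathsf g$, $\mathsf a\subseteq\mathsf g$, $\mathsf r\subseteq\mathsf p$. Terms are the simply typed $\lambda$-terms, identified up to $\beta\eta$-conversion (equivalently, taken in principal normal form), and a positive formula is identified with the corresponding goal. The level of a term is the maximal label occurring in its normal form; $\mathsf D_{i,\alpha}$ is the set of terms of type $\alpha$ and level $\le i$ without loose bound variables. A (legal) substitution $\theta$ maps each logic variable of type $\alpha$ and label $j$ to an element of $\mathsf D_{j,\alpha}$ and is the identity off a finite set, its domain; it is *safe* if no variable of its domain occurs in its range. Write $\theta\gamma$ for first $\theta$, then $\gamma$. **Resolution.** The elaboration of a program formula is given by $\mathsf{elab}(\top_{\mathsf p})=\emptyset$, $\mathsf{elab}(A)=\{A\}$, $\mathsf{elab}(G\supset A)=\{G\supset A\}$, $\mathsf{elab}(D_1\wedge D_2)=\mathsf{elab}(D_1)\cup\mathsf{elab}(D_2)$, $\mathsf{elab}(\forall x D)=\{\forall x D':D'\in\mathsf{elab}(D)\}$ ($A$ a rigid atom). For $D\in\mathsf D_{i,\mathsf p}$, let $[i;D]$ be the set of all instances $M[\vec t/\vec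 x]$ with $\forall\vec x\,M\in\mathsf{elab}(D)$, $M$ of the form $A$ or $G\supset A$, and $\vec t$ terms of level $\le i$. A state $i:P\vdash G$ is a level $i$, a set $P\subseteq\mathsf D_{i,\mathsf p}$ and a goal $G\in\mathsf D_{i,\mathsf g}$; a state vector is a finite list of states, $\Box$ the empty one. A resolution step selects one state, replaces it as follows, and applies the step's substitution (the identity unless shown) to the whole resulting vector: - *null*: $i:P\vdash\top$ is deleted; - *true*: $i:P\vdash G$ becomes $i:P\theta\vdash\top$, if $G$ is atomic (its head is not a logical constant), $G\theta=\top$ and $\theta\ne\mathrm{id}$; - *backchain*: $i:P\vdash A'$ becomes $i:P\theta\vdash G\delta\theta$, if $A'$ is a rigid atom, $\forall\vec x(G\supset A)\in\mathsf{elab}(D)$ for some $D\in P$, $\delta$ renames $\vec x$ to distinct fresh logic variables of label $\le i$, and $A'\theta=A\delta\theta$; - *axiom*: likewise for a clause $\forall\vec x\,A$, the state being deleted; - *or*: $i:P\vdash G_1\vee G_2$ becomes $i:P\vdash G_j$, $j\in\{1,2\}$; *and*: $i:P\vdash G_1\wedge G_2$ becomes $i:P\vdash G_1,\ i:P\vdash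 G_2$; - *instance*: $i:P\vdash\exists xG$ becomes $i:P\vdash G[t/x]$ with $t$ of level $\le i$; - *augment*: $i:P\vdash D\supset G$ becomes $i:P\cup\{D\}\vdash G$; - *generic*: $i:P\vdash\forall xG$ becomes $i+1:P\vdash G[c/x]$ with $c$ a fresh constant of label $i+1$. Fresh means not having occurred earlier in the derivation. A state resolves to $\Box$ with identity answer if there is a finite sequence of steps from it to $\Box$ whose composed substitution fixes all logic variables free in the initial state. **Uniform algebras.** A uniform applicative structure has sets $D_{i,\alpha}$, application maps $\mathsf{App}:D_{i,\alpha\to\beta}\times D_{i,\alpha}\to D_{i,\beta}$ that are extensional, interpretations of the constants (non-logical ones of label $i$ at level $i$, logical ones at level $0$), injective maps for the inclusions of types, injective level inclusions $D_{i,\alpha}\to D_{j,\alpha}$ ($i\le j$), functorial and commuting with $\mathsf{App}$, and preorders $\sqsubseteq$ on the $D_{i,\mathsf p}$ such that $p\sqsubseteq p\wedge q$, $\wedge$ is commutative and has unit $\top_{\mathsf p}$ up to the equivalence induced by $\sqsubseteq$, and $\mathsf{App}(f,d)\sqsubseteq\Pi f$. An assignment $\varphi$ sends each logic variable of type $\alpha$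 and label $j$ to an element of $D_{j,\alpha}$. A uniform algebra consists of such a structure, a distributive lattice $\Omega$ with top, a map $\mathfrak U_\varphi$ for each assignment $\varphi$ from terms of type $\alpha$ and level $\le i$ to $D_{i,\alpha}$, compatible with level inclusions, constants, variables ($\mathfrak U_\varphi(x)=\varphi(x)$), type inclusions and application, such that $\mathfrak U_\varphi(\lambda x.t)$ is the unique element with $\mathsf{App}(\mathfrak U_\varphi(\lambda x.t),d)=\mathfrak U_{\varphi[d/y]}(t[y/x])$ for all $d$ ($y$ a fresh logic variable), and maps $I_i:D_{i,\mathsf p}\times D_{i,\mathsf g}\to\Omega$ such that, for all levels and all elements ($r$ rigid atoms): $I_i(r,r)=\top$; $I_i(p,g)\le I_{i+1}(p,g)$; $I_i(p,\top)=\top$; $I_i(p,g\wedge g')=I_i(p,g)\wedge I_i(p,g')$; $I_i(p,g\vee g')=I_i(p,g)\vee I_i(p,g')$; $I_i(p,q\supset g)=I_i(p\wedge q,g)$; $I_i(p,\Sigma_\alpha f)$ is the supremum and $I_i(p,\Pi_\alpha f)$ the infimum of $\{I_i(p,\mathsf{App}(f,d)):d\in D_{i,\alpha}\}$; $p\sqsubseteq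 p'$ implies $I_i(p,g)\le I_i(p',g)$; and $(g\supset r)\sqsubseteq p$ implies $I_i(p,g)\le I_i(p,r)$. **Lemma (substitution algebra).** For safe substitutions put $\theta\le_{\mathsf s}\varphi$ iff $\varphi=\theta\gamma$ for some substitution $\gamma$, and let $\Omega_{\mathsf s}$ be the complete Heyting algebra of $\le_{\mathsf s}$-upward closed sets of safe substitutions, ordered by inclusion. Its top element is join-irreducible. For $P\in\mathsf D_{i,\mathsf p}$, $G\in\mathsf D_{i,\mathsf g}$ let $$(I_{\mathsf s})_i(P,G)=\{\theta\ \text{safe}:\ \theta \text{ maps variables of label}\le i\text{ to terms of level}\le i,\text{ and } i:P\theta\vdash G\theta\text{ resolves to }\Box\text{ with identity answer}\}$$ (the domain of $\theta$ is not restricted to the free variables of $P,G$). Each $(I_{\mathsf s})_i(P,G)$ is upward closed, and $I_{\mathsf s}$ makes the term structure (carriers $\mathsf D_{i,\alpha}$, syntactic application, constants and inclusions, $P\sqsubseteq P'$ iff $[i;P]\subseteq[i;P']$ on $\mathsf D_{i,\mathsf p}$, and $\mathfrak U_\varphi(t)=t\varphi$), with truth values $\Omega_{\mathsf s}$, into a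 uniform algebra. -/

import Mathlib

namespace UCTT

universe u v w

/-! ### Types -/

/-- Types over a type `B` of user-defined base types: individuals `ι`, positive formulae `h`,
atoms `a`, rigid atoms `r`, programs `p`, goals `g`, and functional types. -/
inductive Ty (B : Type u) : Type u
  | ι : Ty B
  | user : B → Ty B
  | h : Ty B
  | a : Ty B
  | r : Ty B
  | p : Ty B
  | g : Ty B
  | arr : Ty B → Ty B → Ty B

/-- `α ⇾ β` is the functional type written `βα` in Church's notation. -/
infixr:60 " ⇾ " => Ty.arr

/-- Non-logical types. -/
inductive NonLog {B : Type u} : Ty B → Prop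
  | ι : NonLog Ty.ι
  | user (b : B) : NonLog (Ty.user b)
  | arr {α β : Ty B} : NonLog α → NonLog β → NonLog (α ⇾ β)

/-- `PredTy b τ`: `τ` is `α₁ ⇾ ⋯ ⇾ αₙ ⇾ b` with `n ≥ 0` and each `αᵢ` either `h` or non-logical. -/
inductive PredTy {B : Type u} (b : Ty B) : Ty B → Prop
  | nil : PredTy b b
  | cons {α β : Ty B} : (α = Ty.h ∨ NonLog α) → PredTy b β → PredTy b (α ⇾ β)

/-- The types at which there are variables (free and bound). -/
def VarTy {B : Type u} (τ : Ty B) : Prop :=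
  NonLog τ ∨ PredTy Ty.a τ ∨ PredTy Ty.h τ

/-- The types at which there are non-logical constants: rigid predicates may also be constants. -/
def ConTy {B : Type u} (τ : Ty B) : Prop :=
  VarTy τ ∨ PredTy Ty.r τ

/-! ### Terms -/

/-- Logic (free) variables: countably many for each admissible type and each label. -/
structure FVar (B : Type u) : Type u where
  ty : Ty B
  ok : VarTy ty
  label : ℕ
  idx : ℕ

/-- Typed de Bruijn indices, representing bound variables. -/
inductive Ix {B : Type u} : List (Ty B) → Ty B → Type u
  | zero {Γ : List (Ty B)} {α : Ty B} : Ix (α :: Γ) α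
  | succ {Γ : List (Ty B)} {α β : Ty B} : Ix Γ α → Ix (β :: Γ) α

/-- Logical constants. Quantifiers exist at the types that have variables; `topP` denotes the
empty program. -/
inductive LC {B : Type u} : Ty B → Type u
  | topG : LC Ty.g
  | topH : LC Ty.h
  | topP : LC Ty.p
  | andP : LC (Ty.p ⇾ Ty.p ⇾ Ty.p)
  | andG : LC (Ty.g ⇾ Ty.g ⇾ Ty.g)
  | andH : LC (Ty.h ⇾ Ty.h ⇾ Ty.h)
  | orG : LC (Ty.g ⇾ Ty.g ⇾ Ty.g)
  | orH : LC (Ty.h ⇾ Ty.h ⇾ Ty.h)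
  | impG : LC (Ty.p ⇾ Ty.g ⇾ Ty.g)
  | impP : LC (Ty.g ⇾ Ty.r ⇾ Ty.p)
  | sigmaG (α : Ty B) (hα : VarTy α) : LC ((α ⇾ Ty.g) ⇾ Ty.g)
  | sigmaH (α : Ty B) (hα : VarTy α) : LC ((α ⇾ Ty.h) ⇾ Ty.h)
  | piG (α : Ty B) (hα : VarTy α) : LC ((α ⇾ Ty.g) ⇾ Ty.g)
  | piP (α : Ty B) (hα : VarTy α) : LC ((α ⇾ Ty.p) ⇾ Ty.p)
  | piH (α : Ty B) (hα : VarTy α) : LC ((α ⇾ Ty.h) ⇾ Ty.h)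

/-- The inclusions between base types. -/
inductive Incl {B : Type u} : Ty B → Ty B → Type u
  | ra : Incl Ty.r Ty.a
  | ah : Incl Ty.a Ty.h
  | ag : Incl Ty.a Ty.g
  | hg : Incl Ty.h Ty.g
  | rp : Incl Ty.r Ty.p

/-- Typed terms with bound variables from the context `Γ`. `K τ i` is the set of non-logical
constants of type `τ` and label `i`. -/
inductive Tm {B : Type u} (K : Ty B → ℕ → Type v) : List (Ty B) → Ty B → Type (max u v)
  | bvar {Γ : List (Ty B)} {α : Ty B} : Ix Γ α → Tm K Γ α
  | fvar {Γ : List (Ty B)} (x : FVar B) : Tm K Γ x.ty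
  | con {Γ : List (Ty B)} {τ : Ty B} (hτ : ConTy τ) (i : ℕ) (c : K τ i) : Tm K Γ τ
  | log {Γ : List (Ty B)} {τ : Ty B} (c : LC τ) : Tm K Γ τ
  | inc {Γ : List (Ty B)} {α β : Ty B} (e : Incl α β) (t : Tm K Γ α) : Tm K Γ β
  | app {Γ : List (Ty B)} {α β : Ty B} (t : Tm K Γ (α ⇾ β)) (s : Tm K Γ α) : Tm K Γ β
  | lam {Γ : List (Ty B)} {α β : Ty B} (hα : VarTy α) (t : Tm K (α :: Γ) β) : Tm K Γ (α ⇾ β)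

section Terms

variable {B : Type u} {K : Ty B → ℕ → Type v}

namespace Tm

/-- Lifting of a renaming of bound variables under a binder. -/
def liftRen {Γ Δ : List (Ty B)} (ρ : ∀ {α : Ty B}, Ix Γ α → Ix Δ α) (γ : Ty B) :
    ∀ {α : Ty B}, Ix (γ :: Γ) α → Ix (γ :: Δ) α
  | _, .zero => .zero
  | _, .succ x => .succ (ρ x)

/-- Renaming of bound variables. -/
def rename : ∀ {Γ Δ : List (Ty B)} {β : Ty B}, (∀ {α : Ty B}, Ix Γ α → Ix Δ α) →
    Tm K Γ β → Tm K Δ β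
  | _, _, _, ρ, .bvar x => .bvar (ρ x)
  | _, _, _, _, .fvar x => .fvar x
  | _, _, _, _, .con hτ i c => .con hτ i c
  | _, _, _, _, .log c => .log c
  | _, _, _, ρ, .inc e t => .inc e (rename ρ t)
  | _, _, _, ρ, .app t s => .app (rename ρ t) (rename ρ s)
  | _, _, _, ρ, .lam hα t => .lam hα (rename (liftRen ρ _) t)

/-- Weakening by one bound variable. -/
def wk {Γ : List (Ty B)} {β : Ty B} (γ : Ty B) (t : Tm K Γ β) : Tm K (γ :: Γ) β :=
  rename (fun x => .succ x) t

/-- The renaming of the empty list of bound variables. -/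
def nilRen {Γ : List (Ty B)} : ∀ {α : Ty B}, Ix [] α → Ix Γ α
  | _, x => nomatch x

/-- A term without loose bound variables, seen in any context. -/
def wkNil {Γ : List (Ty B)} {β : Ty B} (t : Tm K [] β) : Tm K Γ β :=
  rename nilRen t

/-- Lifting of a substitution of bound variables under a binder. -/
def liftSub {Γ Δ : List (Ty B)} (σ : ∀ {α : Ty B}, Ix Γ α → Tm K Δ α) (γ : Ty B) :
    ∀ {α : Ty B}, Ix (γ :: Γ) α → Tm K (γ :: Δ) α
  | _, .zero => .bvar .zero
  | _, .succ x => wk γ (σ x)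

/-- Simultaneous capture-avoiding substitution for bound variables. -/
def bsubst : ∀ {Γ Δ : List (Ty B)} {β : Ty B}, (∀ {α : Ty B}, Ix Γ α → Tm K Δ α) →
    Tm K Γ β → Tm K Δ β
  | _, _, _, σ, .bvar x => σ x
  | _, _, _, _, .fvar x => .fvar x
  | _, _, _, _, .con hτ i c => .con hτ i c
  | _, _, _, _, .log c => .log c
  | _, _, _, σ, .inc e t => .inc e (bsubst σ t)
  | _, _, _, σ, .app t s => .app (bsubst σ t) (bsubst σ s)
  | _, _, _, σ, .lam hα t => .lam hα (bsubst (liftSub σ _) t)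

/-- The substitution sending the last bound variable to `s`. -/
def instSub {Γ : List (Ty B)} {γ : Ty B} (s : Tm K Γ γ) : ∀ {α : Ty B}, Ix (γ :: Γ) α → Tm K Γ α
  | _, .zero => s
  | _, .succ x => .bvar x

/-- `t[s/x]`, where `x` is the last bound variable. -/
def inst {Γ : List (Ty B)} {γ β : Ty B} (t : Tm K (γ :: Γ) β) (s : Tm K Γ γ) : Tm K Γ β :=
  bsubst (instSub s) t

/-- Simultaneous substitution for logic variables. -/
def fsubst (σ : ∀ x : FVar B, Tm K [] x.ty) : ∀ {Γ : List (Ty B)} {β : Ty B},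
    Tm K Γ β → Tm K Γ β
  | _, _, .bvar x => .bvar x
  | _, _, .fvar x => wkNil (σ x)
  | _, _, .con hτ i c => .con hτ i c
  | _, _, .log c => .log c
  | _, _, .inc e t => .inc e (fsubst σ t)
  | _, _, .app t s => .app (fsubst σ t) (fsubst σ s)
  | _, _, .lam hα t => .lam hα (fsubst σ t)

/-- The logic variables occurring in a term. -/
def fv : ∀ {Γ : List (Ty B)} {β : Ty B}, Tm K Γ β → Set (FVar B)
  | _, _, .bvar _ => ∅
  | _, _, .fvar x => {x}
  | _, _, .con _ _ _ => ∅
  | _, _, .log _ => ∅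
  | _, _, .inc _ t => fv t
  | _, _, .app t s => fv t ∪ fv s
  | _, _, .lam _ t => fv t

/-- The non-logical constants (with type and label) occurring in a term. -/
def cons : ∀ {Γ : List (Ty B)} {β : Ty B}, Tm K Γ β → Set (Σ (τ : Ty B) (i : ℕ), K τ i)
  | _, _, .bvar _ => ∅
  | _, _, .fvar _ => ∅
  | _, _, .con (τ := τ) _ i c => {⟨τ, i, c⟩}
  | _, _, .log _ => ∅
  | _, _, .inc _ t => cons t
  | _, _, .app t s => cons t ∪ cons s
  | _, _, .lam _ t => cons t

/-- All labels of logic variables and non-logical constants of the term are at most `i`. -/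
def LevelLE (i : ℕ) : ∀ {Γ : List (Ty B)} {β : Ty B}, Tm K Γ β → Prop
  | _, _, .bvar _ => True
  | _, _, .fvar x => x.label ≤ i
  | _, _, .con _ j _ => j ≤ i
  | _, _, .log _ => True
  | _, _, .inc _ t => LevelLE i t
  | _, _, .app t s => LevelLE i t ∧ LevelLE i s
  | _, _, .lam _ t => LevelLE i t

/-- Terms whose head is a logic variable or a non-logical constant. -/
inductive Neutral : ∀ {β : Ty B}, Tm K [] β → Prop
  | fvar (x : FVar B) : Neutral (.fvar x)
  | con {τ : Ty B} (hτ : ConTy τ) (i : ℕ) (c : K τ i) : Neutral (.con hτ i c)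
  | app {α β : Ty B} {t : Tm K [] (α ⇾ β)} (s : Tm K [] α) : Neutral t → Neutral (.app t s)

theorem LevelLE.mono {i j : ℕ} (hij : i ≤ j) : ∀ {Γ : List (Ty B)} {β : Ty B} {t : Tm K Γ β},
    t.LevelLE i → t.LevelLE j
  | _, _, .bvar _, _ => trivial
  | _, _, .fvar _, h => le_trans h hij
  | _, _, .con _ _ _, h => le_trans h hij
  | _, _, .log _, _ => trivial
  | _, _, .inc _ t, h => LevelLE.mono hij (t := t) h
  | _, _, .app t s, h => ⟨LevelLE.mono hij (t := t) h.1, LevelLE.mono hij (t := s) h.2⟩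
  | _, _, .lam _ t, h => LevelLE.mono hij (t := t) h

theorem LevelLE.rename {i : ℕ} : ∀ {Γ Δ : List (Ty B)} {β : Ty B}
    (ρ : ∀ {α : Ty B}, Ix Γ α → Ix Δ α) {t : Tm K Γ β}, t.LevelLE i → (t.rename ρ).LevelLE i
  | _, _, _, _, .bvar _, _ => trivial
  | _, _, _, _, .fvar _, h => h
  | _, _, _, _, .con _ _ _, h => h
  | _, _, _, _, .log _, _ => trivial
  | _, _, _, ρ, .inc _ t, h => LevelLE.rename ρ (t := t) h
  | _, _, _, ρ, .app t s, h => ⟨LevelLE.rename ρ (t := t) h.1, LevelLE.rename ρ (t := s) h.2⟩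
  | _, _, _, ρ, .lam _ t, h => LevelLE.rename (liftRen ρ _) (t := t) h

theorem LevelLE.bsubst {i : ℕ} : ∀ {Γ Δ : List (Ty B)} {β : Ty B}
    (σ : ∀ {α : Ty B}, Ix Γ α → Tm K Δ α), (∀ {α : Ty B} (x : Ix Γ α), (σ x).LevelLE i) →
    ∀ {t : Tm K Γ β}, t.LevelLE i → (t.bsubst σ).LevelLE i
  | _, _, _, _, hσ, .bvar x, _ => hσ x
  | _, _, _, _, _, .fvar _, h => h
  | _, _, _, _, _, .con _ _ _, h => h
  | _, _, _, _, _, .log _, _ => trivial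
  | _, _, _, σ, hσ, .inc _ t, h => LevelLE.bsubst σ hσ (t := t) h
  | _, _, _, σ, hσ, .app t s, h =>
      ⟨LevelLE.bsubst σ hσ (t := t) h.1, LevelLE.bsubst σ hσ (t := s) h.2⟩
  | _, _, _, σ, hσ, .lam _ t, h => by
      refine LevelLE.bsubst (liftSub σ _) (fun x => ?_) (t := t) h
      cases x with
      | zero => trivial
      | succ x => exact LevelLE.rename _ (hσ x)

theorem LevelLE.inst {i : ℕ} {Γ : List (Ty B)} {γ β : Ty B} {t : Tm K (γ :: Γ) β} {s : Tm K Γ γ}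
    (ht : t.LevelLE i) (hs : s.LevelLE i) : (t.inst s).LevelLE i := by
  refine LevelLE.bsubst (instSub s) (fun x => ?_) ht
  cases x with
  | zero => exact hs
  | succ x => trivial

theorem LevelLE.fsubst {i : ℕ} (σ : ∀ x : FVar B, Tm K [] x.ty)
    (hσ : ∀ x : FVar B, (σ x).LevelLE x.label) : ∀ {Γ : List (Ty B)} {β : Ty B} {t : Tm K Γ β},
    t.LevelLE i → (t.fsubst σ).LevelLE i
  | _, _, .bvar _, _ => trivial
  | _, _, .fvar x, h => LevelLE.rename _ (LevelLE.mono h (hσ x))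
  | _, _, .con _ _ _, h => h
  | _, _, .log _, _ => trivial
  | _, _, .inc _ t, h => LevelLE.fsubst σ hσ (t := t) h
  | _, _, .app t s, h => ⟨LevelLE.fsubst σ hσ (t := t) h.1, LevelLE.fsubst σ hσ (t := s) h.2⟩
  | _, _, .lam _ t, h => LevelLE.fsubst σ hσ (t := t) h

end Tm

/-- Convertibility of terms: `βη`-conversion, together with the identification of a positive
formula with the goal it is (the inclusion of `h` into `g` turns the logical constants of type `h`
into those of type `g`). -/
inductive Conv : ∀ {Γ : List (Ty B)} {β : Ty B}, Tm K Γ β → Tm K Γ β → Prop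
  | refl {Γ : List (Ty B)} {β : Ty B} (t : Tm K Γ β) : Conv t t
  | symm {Γ : List (Ty B)} {β : Ty B} {t s : Tm K Γ β} : Conv t s → Conv s t
  | trans {Γ : List (Ty B)} {β : Ty B} {t s r : Tm K Γ β} : Conv t s → Conv s r → Conv t r
  | inc {Γ : List (Ty B)} {α β : Ty B} (e : Incl α β) {t s : Tm K Γ α} :
      Conv t s → Conv (.inc e t) (.inc e s)
  | app {Γ : List (Ty B)} {α β : Ty B} {t t' : Tm K Γ (α ⇾ β)} {s s' : Tm K Γ α} :
      Conv t t' → Conv s s' → Conv (.app t s) (.app t' s')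
  | lam {Γ : List (Ty B)} {α β : Ty B} (hα : VarTy α) {t s : Tm K (α :: Γ) β} :
      Conv t s → Conv (.lam hα t) (.lam hα s)
  | beta {Γ : List (Ty B)} {α β : Ty B} (hα : VarTy α) (t : Tm K (α :: Γ) β) (s : Tm K Γ α) :
      Conv (.app (.lam hα t) s) (t.inst s)
  | eta {Γ : List (Ty B)} {α β : Ty B} (hα : VarTy α) (t : Tm K Γ (α ⇾ β)) :
      Conv (.lam hα (.app (t.wk α) (.bvar .zero))) t
  | incAtom {Γ : List (Ty B)} (t : Tm K Γ Ty.a) : Conv (.inc .hg (.inc .ah t)) (.inc .ag t)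
  | incTop {Γ : List (Ty B)} : Conv (Γ := Γ) (.inc .hg (.log .topH)) (.log .topG)
  | incAnd {Γ : List (Ty B)} (t s : Tm K Γ Ty.h) :
      Conv (.inc .hg (.app (.app (.log .andH) t) s))
        (.app (.app (.log .andG) (.inc .hg t)) (.inc .hg s))
  | incOr {Γ : List (Ty B)} (t s : Tm K Γ Ty.h) :
      Conv (.inc .hg (.app (.app (.log .orH) t) s))
        (.app (.app (.log .orG) (.inc .hg t)) (.inc .hg s))
  | incSigma {Γ : List (Ty B)} {α : Ty B} (hα : VarTy α) (t : Tm K Γ (α ⇾ Ty.h)) :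
      Conv (.inc .hg (.app (.log (.sigmaH α hα)) t))
        (.app (.log (.sigmaG α hα)) (.lam hα (.inc .hg (.app (t.wk α) (.bvar .zero)))))
  | incPi {Γ : List (Ty B)} {α : Ty B} (hα : VarTy α) (t : Tm K Γ (α ⇾ Ty.h)) :
      Conv (.inc .hg (.app (.log (.piH α hα)) t))
        (.app (.log (.piG α hα)) (.lam hα (.inc .hg (.app (t.wk α) (.bvar .zero)))))

/-- Convertibility as a setoid on the terms without loose bound variables. -/
instance convSetoid (K : Ty B → ℕ → Type v) (β : Ty B) : Setoid (Tm K [] β) where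
  r := Conv
  iseqv := ⟨Conv.refl, Conv.symm, Conv.trans⟩

/-- Terms up to convertibility; these stand for the terms in principal normal form. -/
def NF (K : Ty B → ℕ → Type v) (β : Ty B) : Type (max u v) :=
  Quotient (convSetoid K β)

/-- `TD K i β`: the terms in normal form of type `β` and level `i` or less. -/
def TD (K : Ty B → ℕ → Type v) (i : ℕ) (β : Ty B) : Type (max u v) :=
  {q : NF K β // ∃ t : Tm K [] β, Quotient.mk _ t = q ∧ t.LevelLE i}

namespace TD

def mk {i : ℕ} {β : Ty B} (t : Tm K [] β) (ht : t.LevelLE i) : TD K i β :=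
  ⟨Quotient.mk _ t, t, rfl, ht⟩

/-- A representative of level `i` or less. -/
noncomputable def rep {i : ℕ} {β : Ty B} (q : TD K i β) : Tm K [] β :=
  q.2.choose

theorem rep_level {i : ℕ} {β : Ty B} (q : TD K i β) : q.rep.LevelLE i :=
  q.2.choose_spec.2

/-- A logic variable as a term. -/
def var (x : FVar B) : TD K x.label x.ty :=
  mk (.fvar x) (le_refl x.label)

/-- The logic variables occurring in the normal form, i.e. in every convertible term. -/
def fv {i : ℕ} {β : Ty B} (q : TD K i β) : Set (FVar B) :=
  {x | ∀ t : Tm K [] β, Quotient.mk _ t = q.1 → x ∈ t.fv}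

/-- The non-logical constants occurring in the normal form. -/
def cons {i : ℕ} {β : Ty B} (q : TD K i β) : Set (Σ (τ : Ty B) (i : ℕ), K τ i) :=
  {c | ∀ t : Tm K [] β, Quotient.mk _ t = q.1 → c ∈ t.cons}

end TD

end Terms

/-! ### Uniform applicative structures -/

/-- The data of an indexed typed applicative structure for the language with non-logical
constants `K`: carriers, application, interpretation of the constants, inclusions between types
and inclusions between levels. -/
structure AppStr {B : Type u} (K : Ty B → ℕ → Type v) where
  D : ℕ → Ty B → Type w
  app : ∀ {i : ℕ} {α β : Ty B}, D i (α ⇾ β) → D i α → D i β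
  con : ∀ {τ : Ty B}, ConTy τ → ∀ {i : ℕ}, K τ i → D i τ
  log : ∀ {τ : Ty B}, LC τ → D 0 τ
  inc : ∀ {i : ℕ} {α β : Ty B}, Incl α β → D i α → D i β
  lift : ∀ {i j : ℕ} {α : Ty B}, i ≤ j → D i α → D j α

namespace AppStr

variable {B : Type u} {K : Ty B → ℕ → Type v} (A : AppStr.{u, v, w} K)

/-- The interpretation of a logical constant at level `i`. -/
def logAt (i : ℕ) {τ : Ty B} (c : LC τ) : A.D i τ := A.lift (Nat.zero_le i) (A.log c)

def topG (i : ℕ) : A.D i Ty.g := A.logAt i .topG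
def topP (i : ℕ) : A.D i Ty.p := A.logAt i .topP
def andP {i : ℕ} (x y : A.D i Ty.p) : A.D i Ty.p := A.app (A.app (A.logAt i .andP) x) y
def andG {i : ℕ} (x y : A.D i Ty.g) : A.D i Ty.g := A.app (A.app (A.logAt i .andG) x) y
def orG {i : ℕ} (x y : A.D i Ty.g) : A.D i Ty.g := A.app (A.app (A.logAt i .orG) x) y
def impG {i : ℕ} (x : A.D i Ty.p) (y : A.D i Ty.g) : A.D i Ty.g :=
  A.app (A.app (A.logAt i .impG) x) y
def impP {i : ℕ} (x : A.D i Ty.g) (y : A.D i Ty.r) : A.D i Ty.p :=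
  A.app (A.app (A.logAt i .impP) x) y
def sigmaG {i : ℕ} {α : Ty B} (hα : VarTy α) (f : A.D i (α ⇾ Ty.g)) : A.D i Ty.g :=
  A.app (A.logAt i (.sigmaG α hα)) f
def piG {i : ℕ} {α : Ty B} (hα : VarTy α) (f : A.D i (α ⇾ Ty.g)) : A.D i Ty.g :=
  A.app (A.logAt i (.piG α hα)) f
def piP {i : ℕ} {α : Ty B} (hα : VarTy α) (f : A.D i (α ⇾ Ty.p)) : A.D i Ty.p :=
  A.app (A.logAt i (.piP α hα)) f

/-- A rigid atom as a goal. -/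
def rigidG {i : ℕ} (x : A.D i Ty.r) : A.D i Ty.g := A.inc .ag (A.inc .ra x)
/-- A rigid atom as a program. -/
def rigidP {i : ℕ} (x : A.D i Ty.r) : A.D i Ty.p := A.inc .rp x

/-- Assignments of elements of the structure to the logic variables, respecting types and
labels. -/
def Assignment : Type (max u w) := ∀ x : FVar B, A.D x.label x.ty

open Classical in
/-- `φ[d/x]`. -/
noncomputable def update (φ : A.Assignment) (x : FVar B) (d : A.D x.label x.ty) : A.Assignment :=
  Function.update φ x d

end AppStr

/-- The data of a uniform applicative structure: an indexed typed applicative structure with a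
relation on the carriers of programs. -/
structure UnifStr {B : Type u} (K : Ty B → ℕ → Type v) extends AppStr.{u, v, w} K where
  leP : ∀ {i : ℕ}, D i Ty.p → D i Ty.p → Prop

/-- The laws of uniform applicative structures. -/
structure IsUniformStr {B : Type u} {K : Ty B → ℕ → Type v} (A : UnifStr.{u, v, w} K) : Prop where
  /-- functional extensionality -/
  ext : ∀ {i : ℕ} {α β : Ty B} (f f' : A.D i (α ⇾ β)),
    (∀ d : A.D i α, A.app f d = A.app f' d) → f = f'
  inc_injective : ∀ {i : ℕ} {α β : Ty B} (e : Incl α β),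
    Function.Injective (A.inc e : A.D i α → A.D i β)
  lift_injective : ∀ {i j : ℕ} {α : Ty B} (h : i ≤ j),
    Function.Injective (A.lift h : A.D i α → A.D j α)
  lift_refl : ∀ {i : ℕ} {α : Ty B} (d : A.D i α), A.lift (le_refl i) d = d
  lift_lift : ∀ {i j k : ℕ} {α : Ty B} (h : i ≤ j) (h' : j ≤ k) (d : A.D i α),
    A.lift h' (A.lift h d) = A.lift (le_trans h h') d
  lift_app : ∀ {i j : ℕ} {α β : Ty B} (h : i ≤ j) (f : A.D i (α ⇾ β)) (d : A.D i α),
    A.lift h (A.app f d) = A.app (A.lift h f) (A.lift h d)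
  leP_refl : ∀ {i : ℕ} (x : A.D i Ty.p), A.leP x x
  leP_trans : ∀ {i : ℕ} (x y z : A.D i Ty.p), A.leP x y → A.leP y z → A.leP x z
  le_andP : ∀ {i : ℕ} (x y : A.D i Ty.p), A.leP x (A.andP x y)
  andP_comm : ∀ {i : ℕ} (x y : A.D i Ty.p), A.leP (A.andP x y) (A.andP y x)
  andP_top : ∀ {i : ℕ} (x : A.D i Ty.p),
    A.leP (A.andP x (A.topP i)) x ∧ A.leP (A.andP (A.topP i) x) x ∧
    A.leP x (A.andP x (A.topP i)) ∧ A.leP x (A.andP (A.topP i) x)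
  app_le_piP : ∀ {i : ℕ} {α : Ty B} (hα : VarTy α) (f : A.D i (α ⇾ Ty.p)) (d : A.D i α),
    A.leP (A.app f d) (A.piP hα f)

/-! ### Uniform algebras -/

/-- `I` is an `Ω`-valuation on the structure `A`. -/
structure IsValuation {B : Type u} {K : Ty B → ℕ → Type v} (A : UnifStr.{u, v, w} K)
    {Ω : Type*} [DistribLattice Ω] [OrderTop Ω]
    (I : ∀ i : ℕ, A.D i Ty.p → A.D i Ty.g → Ω) : Prop where
  atom : ∀ (i : ℕ) (x : A.D i Ty.r), I i (A.rigidP x) (A.rigidG x) = ⊤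
  mono_level : ∀ (i : ℕ) (P : A.D i Ty.p) (G : A.D i Ty.g),
    I i P G ≤ I (i + 1) (A.lift (Nat.le_succ i) P) (A.lift (Nat.le_succ i) G)
  top : ∀ (i : ℕ) (P : A.D i Ty.p), I i P (A.topG i) = ⊤
  and : ∀ (i : ℕ) (P : A.D i Ty.p) (G G' : A.D i Ty.g),
    I i P (A.andG G G') = I i P G ⊓ I i P G'
  or : ∀ (i : ℕ) (P : A.D i Ty.p) (G G' : A.D i Ty.g),
    I i P (A.orG G G') = I i P G ⊔ I i P G'
  imp : ∀ (i : ℕ) (P Q : A.D i Ty.p) (G : A.D i Ty.g),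
    I i P (A.impG Q G) = I i (A.andP P Q) G
  inst : ∀ (i : ℕ) {α : Ty B} (hα : VarTy α) (P : A.D i Ty.p) (f : A.D i (α ⇾ Ty.g)),
    IsLUB (Set.range fun d : A.D i α => I i P (A.app f d)) (I i P (A.sigmaG hα f))
  generic : ∀ (i : ℕ) {α : Ty B} (hα : VarTy α) (P : A.D i Ty.p) (f : A.D i (α ⇾ Ty.g)),
    IsGLB (Set.range fun d : A.D i α => I i P (A.app f d)) (I i P (A.piG hα f))
  mono_prog : ∀ (i : ℕ) (P P' : A.D i Ty.p) (G : A.D i Ty.g), A.leP P P' → I i P G ≤ I i P' G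
  backchain : ∀ (i : ℕ) (P : A.D i Ty.p) (G : A.D i Ty.g) (x : A.D i Ty.r),
    A.leP (A.impP G x) P → I i P G ≤ I i P (A.rigidG x)

/-- `U` interprets the terms (in normal form) in the structure `A`: the terms of type `β` and
level `i` or less are mapped to `A.D i β`, relative to assignments, subject to the environmental
model condition. -/
structure IsMeaning {B : Type u} {K : Ty B → ℕ → Type v} (A : AppStr.{u, v, w} K)
    (U : A.Assignment → ∀ {i : ℕ} {β : Ty B}, TD K i β → A.D i β) : Prop where
  level : ∀ (φ : A.Assignment) {i j : ℕ} (h : i ≤ j) {β : Ty B} (t : Tm K [] β)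
    (ht : t.LevelLE i), U φ (TD.mk t (ht.mono h)) = A.lift h (U φ (TD.mk t ht))
  con : ∀ (φ : A.Assignment) {τ : Ty B} (hτ : ConTy τ) {i : ℕ} (c : K τ i),
    U φ (TD.mk (i := i) (.con hτ i c) (le_refl i)) = A.con hτ c
  log : ∀ (φ : A.Assignment) {τ : Ty B} (c : LC τ),
    U φ (TD.mk (i := 0) (.log c) trivial) = A.log c
  var : ∀ (φ : A.Assignment) (x : FVar B), U φ (TD.var x) = φ x
  inc : ∀ (φ : A.Assignment) {i : ℕ} {α β : Ty B} (e : Incl α β) (t : Tm K [] α)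
    (ht : t.LevelLE i), U φ (TD.mk (i := i) (.inc e t) ht) = A.inc e (U φ (TD.mk t ht))
  app : ∀ (φ : A.Assignment) {i : ℕ} {α β : Ty B} (t : Tm K [] (α ⇾ β)) (s : Tm K [] α)
    (ht : t.LevelLE i) (hs : s.LevelLE i),
    U φ (TD.mk (i := i) (.app t s) ⟨ht, hs⟩) = A.app (U φ (TD.mk t ht)) (U φ (TD.mk s hs))
  lam : ∀ (φ : A.Assignment) {i : ℕ} (y : FVar B) (hy : y.label ≤ i) {β : Ty B}
    (t : Tm K [y.ty] β) (ht : t.LevelLE i), y ∉ t.fv → ∀ d : A.D y.label y.ty,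
    A.app (U φ (TD.mk (i := i) (.lam y.ok t) ht)) (A.lift hy d) =
      U (A.update φ y d) (TD.mk (t.inst (.fvar y)) (ht.inst hy))
  lam_unique : ∀ (φ : A.Assignment) (y : FVar B) {β : Ty B} (t : Tm K [y.ty] β)
    (ht : t.LevelLE y.label), y ∉ t.fv → ∀ e : A.D y.label (y.ty ⇾ β),
    (∀ d : A.D y.label y.ty,
      A.app e d = U (A.update φ y d) (TD.mk (t.inst (.fvar y)) (ht.inst (le_refl y.label)))) →
    e = U φ (TD.mk (i := y.label) (.lam y.ok t) ht)

/-- `⟨A, U, Ω, I⟩` is a uniform algebra. -/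
structure IsUniformAlgebra {B : Type u} {K : Ty B → ℕ → Type v} (A : UnifStr.{u, v, w} K)
    (U : A.Assignment → ∀ {i : ℕ} {β : Ty B}, TD K i β → A.D i β)
    {Ω : Type*} [DistribLattice Ω] [OrderTop Ω]
    (I : ∀ i : ℕ, A.D i Ty.p → A.D i Ty.g → Ω) : Prop where
  uniform : IsUniformStr A
  meaning : IsMeaning A.toAppStr U
  valuation : IsValuation A I

/-! ### The term structure -/

section TermStructure

variable {B : Type u} {K : Ty B → ℕ → Type v}

/-- The applicative structure of terms in normal form. -/
noncomputable abbrev termApp (K : Ty B → ℕ → Type v) : AppStr.{u, v, max u v} K where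
  D := TD K
  app f d := TD.mk (.app f.rep d.rep) ⟨f.rep_level, d.rep_level⟩
  con hτ i c := TD.mk (.con hτ i c) (le_refl i)
  log c := TD.mk (.log c) trivial
  inc e d := TD.mk (.inc e d.rep) d.rep_level
  lift h d := ⟨d.1, d.rep, d.2.choose_spec.1, d.rep_level.mono h⟩

/-- `tφ`, in normal form. -/
noncomputable def termMeaning (φ : (termApp K).Assignment) {i : ℕ} {β : Ty B} (q : TD K i β) :
    TD K i β :=
  TD.mk (q.rep.fsubst fun x => (φ x).rep) (Tm.LevelLE.fsubst _ (fun x => (φ x).rep_level) q.rep_level)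

/-- A clause `K'` belongs to the elaboration of the program formula `D`. In the last case the
bound variable is replaced by a fresh logic variable `X`. -/
inductive Elab {i : ℕ} : TD K i Ty.p → TD K i Ty.p → Prop
  | atom (x : TD K i Ty.r) : Elab ((termApp K).rigidP x) ((termApp K).rigidP x)
  | imp (G : TD K i Ty.g) (x : TD K i Ty.r) :
      Elab ((termApp K).impP G x) ((termApp K).impP G x)
  | left {D₁ C : TD K i Ty.p} (D₂ : TD K i Ty.p) : Elab D₁ C → Elab ((termApp K).andP D₁ D₂) C
  | right {D₂ C : TD K i Ty.p} (D₁ : TD K i Ty.p) : Elab D₂ C → Elab ((termApp K).andP D₁ D₂) C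
  | all (X : FVar B) (hX : X.label ≤ i) (f f' : TD K i (X.ty ⇾ Ty.p)) :
      X ∉ f.fv → X ∉ f'.fv →
      Elab ((termApp K).app f ((termApp K).lift hX (TD.var X)))
        ((termApp K).app f' ((termApp K).lift hX (TD.var X))) →
      Elab ((termApp K).piP X.ok f) ((termApp K).piP X.ok f')

/-- `ClauseInst C ts M`: `C` is `∀ x₁ … xₙ. M₀` and `M` is `M₀[t₁/x₁, …, tₙ/xₙ]`, where
`ts = [t₁, …, tₙ]`. -/
inductive ClauseInst {i : ℕ} : TD K i Ty.p → List (Σ α : Ty B, TD K i α) → TD K i Ty.p → Prop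
  | nil (M : TD K i Ty.p) : ClauseInst M [] M
  | cons {α : Ty B} (hα : VarTy α) (f : TD K i (α ⇾ Ty.p)) (t : TD K i α)
      {ts : List (Σ α : Ty B, TD K i α)} {M : TD K i Ty.p} :
      ClauseInst ((termApp K).app f t) ts M →
      ClauseInst ((termApp K).piP hα f) (⟨α, t⟩ :: ts) M

/-- `M` has no outermost universal quantifier: it is `A` or `G ⊃ A` with `A` a rigid atom. -/
def IsMatrix {i : ℕ} (M : TD K i Ty.p) : Prop :=
  (∃ x : TD K i Ty.r, M = (termApp K).rigidP x) ∨
    ∃ (G : TD K i Ty.g) (x : TD K i Ty.r), M = (termApp K).impP G x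

/-- The extension of a program formula at level `i`: the instances by terms of level `i` or less
of the clauses of its elaboration. -/
def extension {i : ℕ} (D : TD K i Ty.p) : Set (TD K i Ty.p) :=
  {M | IsMatrix M ∧ ∃ (C : TD K i Ty.p) (ts : List (Σ α : Ty B, TD K i α)),
    Elab D C ∧ ClauseInst C ts M}

/-- The term structure. -/
noncomputable abbrev termStr (K : Ty B → ℕ → Type v) : UnifStr.{u, v, max u v} K where
  toAppStr := termApp K
  leP P P' := extension P ⊆ extension P'

end TermStructure

/-! ### Substitutions and resolution -/

section Resolution

variable {B : Type u} {K : Ty B → ℕ → Type v}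

/-- Legal substitutions: type- and level-preserving, with finite support. -/
structure Sub (K : Ty B → ℕ → Type v) where
  toFun : (termApp K).Assignment
  finite_support : {x | toFun x ≠ TD.var x}.Finite

namespace Sub

/-- The domain of a substitution. -/
def dom (θ : Sub K) : Set (FVar B) := {x | θ.toFun x ≠ TD.var x}

/-- The variables occurring in a substitution, in its domain or its range. -/
def occV (θ : Sub K) : Set (FVar B) := θ.dom ∪ ⋃ x ∈ θ.dom, (θ.toFun x).fv

/-- The constants occurring in the range of a substitution. -/
def occC (θ : Sub K) : Set (Σ (τ : Ty B) (i : ℕ), K τ i) := ⋃ x ∈ θ.dom, (θ.toFun x).cons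

/-- The identity substitution. -/
def id : Sub K where
  toFun := TD.var
  finite_support := by simp

/-- Safe (idempotent) substitutions. -/
def Safe (θ : Sub K) : Prop := ∀ x ∈ θ.dom, Disjoint (θ.toFun x).fv θ.dom

end Sub

/-- Application of a substitution: `tθ`. -/
noncomputable def TD.sub {i : ℕ} {β : Ty B} (q : TD K i β) (θ : Sub K) : TD K i β :=
  termMeaning θ.toFun q

/-- States: a level, a program (a set of program formulas) and a goal, of that level. -/
structure State (K : Ty B → ℕ → Type v) where
  lvl : ℕ
  prog : Set (TD K lvl Ty.p)
  goal : TD K lvl Ty.g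

namespace State

def fv (S : State K) : Set (FVar B) := (⋃ D ∈ S.prog, D.fv) ∪ S.goal.fv

def cons (S : State K) : Set (Σ (τ : Ty B) (i : ℕ), K τ i) :=
  (⋃ D ∈ S.prog, D.cons) ∪ S.goal.cons

noncomputable def sub (S : State K) (θ : Sub K) : State K :=
  ⟨S.lvl, (fun D => D.sub θ) '' S.prog, S.goal.sub θ⟩

end State

/-- State vectors. -/
abbrev StateVec (K : Ty B → ℕ → Type v) := List (State K)

def StateVec.fv (V : StateVec K) : Set (FVar B) := ⋃ S ∈ V, State.fv S

def StateVec.cons (V : StateVec K) : Set (Σ (τ : Ty B) (i : ℕ), K τ i) := ⋃ S ∈ V, State.cons S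

noncomputable def StateVec.sub (V : StateVec K) (θ : Sub K) : StateVec K :=
  V.map fun S => S.sub θ

/-- Atomic goals: the head of the normal form is not a logical constant. -/
def IsAtomic {i : ℕ} (G : TD K i Ty.g) : Prop :=
  (∃ x : TD K i Ty.a, G = (termApp K).inc .ag x) ∨
    ∃ t : Tm K [] Ty.h, t.Neutral ∧ G.1 = Quotient.mk _ (.inc .hg t)

/-- Logic variables of level `i` or less, as a list of terms. -/
noncomputable def varList {i : ℕ} (ws : List {x : FVar B // x.label ≤ i}) : List (Σ α : Ty B, TD K i α) :=
  ws.map fun x => ⟨x.1.ty, (termApp K).lift x.2 (TD.var x.1)⟩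

/-- What a resolution step does to the selected state. `RStep V C S θ W T`: the state `S` is
replaced by the state vector `T` under the substitution `θ`. `V` and `C` are the variables and the
constants used so far in the derivation, and `W` the fresh variables by which the bound variables
of a clause are renamed. -/
inductive RStep (V : Set (FVar B)) (C : Set (Σ (τ : Ty B) (i : ℕ), K τ i)) :
    State K → Sub K → Set (FVar B) → StateVec K → Prop
  | null (i : ℕ) (P : Set (TD K i Ty.p)) :
      RStep V C ⟨i, P, (termApp K).topG i⟩ Sub.id ∅ []
  | true (i : ℕ) (P : Set (TD K i Ty.p)) (G : TD K i Ty.g) (θ : Sub K) :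
      IsAtomic G → G.sub θ = (termApp K).topG i → θ ≠ Sub.id →
      RStep V C ⟨i, P, G⟩ θ ∅ [State.sub ⟨i, P, (termApp K).topG i⟩ θ]
  | backchain (i : ℕ) (P : Set (TD K i Ty.p)) (x : TD K i Ty.r) (D cl : TD K i Ty.p)
      (ws : List {x : FVar B // x.label ≤ i}) (G : TD K i Ty.g) (y : TD K i Ty.r) (θ : Sub K) :
      D ∈ P → Elab D cl → ws.Nodup → (∀ w ∈ ws, w.1 ∉ V) →
      ClauseInst cl (varList ws) ((termApp K).impP G y) → x.sub θ = y.sub θ →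
      RStep V C ⟨i, P, (termApp K).rigidG x⟩ θ {w | ∃ w' ∈ ws, w'.1 = w} [State.sub ⟨i, P, G⟩ θ]
  | axiom' (i : ℕ) (P : Set (TD K i Ty.p)) (x : TD K i Ty.r) (D cl : TD K i Ty.p)
      (ws : List {x : FVar B // x.label ≤ i}) (y : TD K i Ty.r) (θ : Sub K) :
      D ∈ P → Elab D cl → ws.Nodup → (∀ w ∈ ws, w.1 ∉ V) →
      ClauseInst cl (varList ws) ((termApp K).rigidP y) → x.sub θ = y.sub θ →
      RStep V C ⟨i, P, (termApp K).rigidG x⟩ θ {w | ∃ w' ∈ ws, w'.1 = w} []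
  | or₁ (i : ℕ) (P : Set (TD K i Ty.p)) (G₁ G₂ : TD K i Ty.g) :
      RStep V C ⟨i, P, (termApp K).orG G₁ G₂⟩ Sub.id ∅ [⟨i, P, G₁⟩]
  | or₂ (i : ℕ) (P : Set (TD K i Ty.p)) (G₁ G₂ : TD K i Ty.g) :
      RStep V C ⟨i, P, (termApp K).orG G₁ G₂⟩ Sub.id ∅ [⟨i, P, G₂⟩]
  | and (i : ℕ) (P : Set (TD K i Ty.p)) (G₁ G₂ : TD K i Ty.g) :
      RStep V C ⟨i, P, (termApp K).andG G₁ G₂⟩ Sub.id ∅ [⟨i, P, G₁⟩, ⟨i, P, G₂⟩]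
  | inst (i : ℕ) (P : Set (TD K i Ty.p)) {α : Ty B} (hα : VarTy α) (f : TD K i (α ⇾ Ty.g))
      (t : TD K i α) :
      RStep V C ⟨i, P, (termApp K).sigmaG hα f⟩ Sub.id ∅ [⟨i, P, (termApp K).app f t⟩]
  | augment (i : ℕ) (P : Set (TD K i Ty.p)) (D : TD K i Ty.p) (G : TD K i Ty.g) :
      RStep V C ⟨i, P, (termApp K).impG D G⟩ Sub.id ∅ [⟨i, P ∪ {D}, G⟩]
  | generic (i : ℕ) (P : Set (TD K i Ty.p)) {α : Ty B} (hα : VarTy α) (f : TD K i (α ⇾ Ty.g))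
      (c : K α (i + 1)) : (⟨α, i + 1, c⟩ : Σ (τ : Ty B) (i : ℕ), K τ i) ∉ C →
      RStep V C ⟨i, P, (termApp K).piG hα f⟩ Sub.id ∅
        [⟨i + 1, (termApp K).lift (Nat.le_succ i) '' P,
          (termApp K).app ((termApp K).lift (Nat.le_succ i) f) ((termApp K).con (Or.inl hα) c)⟩]

/-- `Resolves V C S η`: there is a derivation from the state vector `S` to the empty state vector,
using fresh variables outside `V` and fresh constants outside `C`, such that `η` is the composition
of all the intervening substitutions. -/
inductive Resolves : Set (FVar B) → Set (Σ (τ : Ty B) (i : ℕ), K τ i) → StateVec K →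
    (termApp K).Assignment → Prop
  | nil (V : Set (FVar B)) (C : Set (Σ (τ : Ty B) (i : ℕ), K τ i)) : Resolves V C [] TD.var
  | step {V : Set (FVar B)} {C : Set (Σ (τ : Ty B) (i : ℕ), K τ i)} (L R : StateVec K)
      {S : State K} {θ : Sub K} {W : Set (FVar B)} {T : StateVec K}
      {η : (termApp K).Assignment} :
      RStep V C S θ W T →
      Resolves (V ∪ W ∪ θ.occV ∪ StateVec.fv (L.sub θ ++ T ++ R.sub θ))
        (C ∪ θ.occC ∪ StateVec.cons (L.sub θ ++ T ++ R.sub θ)) (L.sub θ ++ T ++ R.sub θ) η →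
      Resolves V C (L ++ S :: R) (fun x => termMeaning η (θ.toFun x))

/-- The state `S` resolves to the empty state vector with the identity as computed answer. -/
def ResolvesId (S : State K) : Prop :=
  ∃ η : (termApp K).Assignment, Resolves (StateVec.fv [S]) (StateVec.cons [S]) [S] η ∧
    ∀ x ∈ S.fv, η x = TD.var x

end Resolution

/-! ### The substitution algebra -/

section SubstitutionAlgebra

variable {B : Type u}

/-- Safe legal substitutions. -/
def SafeSub (K : Ty B → ℕ → Type v) : Type (max u v) := {θ : Sub K // θ.Safe}

variable {K : Ty B → ℕ → Type v}

/-- `θ ≤ φ` iff `φ = θγ` for some substitution `γ`. -/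
instance : LE (SafeSub K) where
  le θ φ := ∃ γ : Sub K, ∀ x : FVar B, φ.1.toFun x = (θ.1.toFun x).sub γ

/-- The upward closed sets of safe substitutions, ordered by inclusion (Mathlib orders upper sets
by reverse inclusion, hence the order dual). -/
abbrev OmegaS (K : Ty B → ℕ → Type v) : Type (max u v) := (UpperSet (SafeSub K))ᵒᵈ

/-- The set of safe substitutions underlying a truth value. -/
def OmegaS.carrier (U : OmegaS K) : Set (SafeSub K) := (OrderDual.ofDual U : UpperSet (SafeSub K))

/-- The substitution valuation: the set of safe substitutions `θ` that send the logic variables of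
label at most `i` to terms of level at most `i` and for which `Pθ ⊢ Gθ` resolves at level `i` with
identity answer. -/
def substVal (i : ℕ) (P : TD K i Ty.p) (G : TD K i Ty.g) : Set (SafeSub K) :=
  {θ | (∀ x : FVar B, x.label ≤ i → ∃ t : Tm K [] x.ty,
      Quotient.mk _ t = (θ.1.toFun x).1 ∧ t.LevelLE i) ∧
    ResolvesId ⟨i, {P.sub θ.1}, G.sub θ.1⟩}

end SubstitutionAlgebra

end UCTT

/-! Resolution threads unifiers through a whole state vector and depends on freshness, so it is
traded for `Prov`, an inductive calculus of uniform proofs of single states. There a clause is used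
through its instances (`Inst`), and the rule for ∀ asks for all constants of the next label. By
`resolvesId_iff`, a state with a finite program resolves with identity answer iff it has a uniform
proof. For soundness, each step carries provability backwards along the substitutions still to come.
For completeness, the unifier is chosen to send the fresh variables of a clause to the terms of the
wanted instance, so that it fixes every variable used before. Hence θ belongs to the value of (P, G)
iff `Prov i {Pθ} (Gθ)` (`mem_substVal`), and the laws of a valuation become facts about `Prov`.

Most of these facts come down to `Prov.map`: provability survives every substitution for variables
and constants that takes level i to level j. This gives upward closure and monotonicity in the
level. It also lets one new constant, all new constants, all terms, or a fresh variable stand for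
the generic element of a ∀. In the supremum law a term t witnessing an existential goal after θ must
become a witness before θ; t itself works, since safe substitutions are idempotent. In the infimum
law the generic element is a variable outside the domain of θ. Monotonicity in the program needs
inclusion of extensions to be stable under substitution (`Inst.map_mono`): an instance of PF is the
image of an instance of P by fresh variables (`Inst.exists_generic`).

Inverting the rules requires that different logical forms are never convertible. This is read off a
set-theoretic model, sound for conversion by `Conv.sem`, in which the value of a formula exhibits
its outermost connective and the classes of its immediate parts. Conversely, a reducibility argument
(`Red.eval`) brings every program to a canonical form and shows that every function on a type
without variables is a partially applied logical constant. Extensionality of the term structure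
follows: where variables exist, apply both functions to a fresh one and use η; elsewhere compare
logical forms.

The top truth value is join-irreducible because the identity is the least safe substitution: an
upward closed set containing it is everything. -/

namespace UCTT

universe u v w

/-! ### Simultaneous substitution for bound variables, logic variables and constants -/

section Substitution

variable {B : Type u} {K : Ty B → ℕ → Type v}

/-- A simultaneous substitution for bound variables, logic variables and non-logical constants. -/
@[ext]
structure MSub (K : Ty B → ℕ → Type v) (Γ Δ : List (Ty B)) where
  b : ∀ α : Ty B, Ix Γ α → Tm K Δ α
  f : ∀ x : FVar B, Tm K Δ x.ty
  c : ∀ s : (Σ (τ : Ty B) (i : ℕ), K τ i), ConTy s.1 → Tm K Δ s.1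

namespace MSub

/-- Lifting under a binder. -/
def lift {Γ Δ : List (Ty B)} (F : MSub K Γ Δ) (γ : Ty B) : MSub K (γ :: Γ) (γ :: Δ) where
  b _ x := Tm.liftSub (fun {α} x => F.b α x) γ x
  f x := (F.f x).wk γ
  c s h := (F.c s h).wk γ

/-- Renaming the bound variables of the values. -/
def ren {Γ Δ Ξ : List (Ty B)} (F : MSub K Γ Δ) (ρ : ∀ {α : Ty B}, Ix Δ α → Ix Ξ α) :
    MSub K Γ Ξ where
  b α x := (F.b α x).rename ρ
  f x := (F.f x).rename ρ
  c s h := (F.c s h).rename ρ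

/-- The substitution for bound variables only. -/
def ofB {Γ Δ : List (Ty B)} (σ : ∀ {α : Ty B}, Ix Γ α → Tm K Δ α) : MSub K Γ Δ where
  b _ x := σ x
  f x := .fvar x
  c s h := .con h s.2.1 s.2.2

/-- The identity. -/
def idm (K : Ty B → ℕ → Type v) (Γ : List (Ty B)) : MSub K Γ Γ := ofB fun x => .bvar x

end MSub

namespace Tm

/-- Application of a simultaneous substitution. -/
def msub : ∀ {Γ Δ : List (Ty B)} {β : Ty B}, Tm K Γ β → MSub K Γ Δ → Tm K Δ β
  | _, _, _, .bvar x, F => F.b _ x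
  | _, _, _, .fvar x, F => F.f x
  | _, _, _, .con (τ := τ) hτ i c, F => F.c ⟨τ, i, c⟩ hτ
  | _, _, _, .log c, _ => .log c
  | _, _, _, .inc e t, F => .inc e (msub t F)
  | _, _, _, .app t s, F => .app (msub t F) (msub s F)
  | _, _, _, .lam hα t, F => .lam hα (msub t (F.lift _))

end Tm

/-- Composition. -/
def MSub.comp {Γ Δ Ξ : List (Ty B)} (F : MSub K Γ Δ) (G : MSub K Δ Ξ) : MSub K Γ Ξ where
  b α x := (F.b α x).msub G
  f x := (F.f x).msub G
  c s h := (F.c s h).msub G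

namespace Tm

theorem rename_congr : ∀ {Γ Δ : List (Ty B)} {β : Ty B} (t : Tm K Γ β)
    {ρ ρ' : ∀ {α : Ty B}, Ix Γ α → Ix Δ α}, (∀ {α : Ty B} (x : Ix Γ α), ρ x = ρ' x) →
    t.rename ρ = t.rename ρ'
  | _, _, _, .bvar x, _, _, h => by simp [rename, h x]
  | _, _, _, .fvar _, _, _, _ => rfl
  | _, _, _, .con _ _ _, _, _, _ => rfl
  | _, _, _, .log _, _, _, _ => rfl
  | _, _, _, .inc _ t, ρ, ρ', h => by
      simp only [rename]; rw [rename_congr t (ρ := ρ) (ρ' := ρ') h]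
  | _, _, _, .app t s, ρ, ρ', h => by
      simp only [rename]
      rw [rename_congr t (ρ := ρ) (ρ' := ρ') h, rename_congr s (ρ := ρ) (ρ' := ρ') h]
  | _, _, _, .lam _ t, ρ, ρ', h => by
      simp only [rename]
      rw [rename_congr t (ρ := liftRen ρ _) (ρ' := liftRen ρ' _)]
      intro α x
      cases x with
      | zero => rfl
      | succ x => simp [liftRen, h x]

theorem rename_rename : ∀ {Γ Δ Ξ : List (Ty B)} {β : Ty B} (t : Tm K Γ β)
    (ρ : ∀ {α : Ty B}, Ix Γ α → Ix Δ α) (ρ' : ∀ {α : Ty B}, Ix Δ α → Ix Ξ α),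
    (t.rename ρ).rename ρ' = t.rename fun x => ρ' (ρ x)
  | _, _, _, _, .bvar x, _, _ => rfl
  | _, _, _, _, .fvar _, _, _ => rfl
  | _, _, _, _, .con _ _ _, _, _ => rfl
  | _, _, _, _, .log _, _, _ => rfl
  | _, _, _, _, .inc _ t, ρ, ρ' => by
      simp only [rename]; rw [rename_rename t]
  | _, _, _, _, .app t s, ρ, ρ' => by
      simp only [rename]; rw [rename_rename t, rename_rename s]
  | _, _, _, _, .lam _ t, ρ, ρ' => by
      simp only [rename]
      rw [rename_rename t]
      congr 1
      refine rename_congr t fun x => ?_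
      cases x <;> rfl

theorem msub_rename : ∀ {Γ Δ Ξ : List (Ty B)} {β : Ty B} (t : Tm K Γ β)
    (ρ : ∀ {α : Ty B}, Ix Γ α → Ix Δ α) (F : MSub K Δ Ξ),
    (t.rename ρ).msub F = t.msub ⟨fun α x => F.b α (ρ x), F.f, F.c⟩
  | _, _, _, _, .bvar x, _, _ => rfl
  | _, _, _, _, .fvar _, _, _ => rfl
  | _, _, _, _, .con _ _ _, _, _ => rfl
  | _, _, _, _, .log _, _, _ => rfl
  | _, _, _, _, .inc _ t, ρ, F => by
      simp only [rename, msub]; rw [msub_rename t]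
  | _, _, _, _, .app t s, ρ, F => by
      simp only [rename, msub]; rw [msub_rename t, msub_rename s]
  | _, _, _, _, .lam _ t, ρ, F => by
      simp only [rename, msub]
      rw [msub_rename t]
      congr 2
      ext α x
      · cases x <;> rfl
      · rfl
      · rfl

theorem wk_rename {Γ Δ : List (Ty B)} {β γ : Ty B} (t : Tm K Γ β)
    (ρ : ∀ {α : Ty B}, Ix Γ α → Ix Δ α) :
    (t.wk γ).rename (liftRen ρ γ) = (t.rename ρ).wk γ := by
  rw [wk, wk, rename_rename, rename_rename]
  exact rename_congr t fun x => rfl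

theorem rename_msub : ∀ {Γ Δ Ξ : List (Ty B)} {β : Ty B} (t : Tm K Γ β) (F : MSub K Γ Δ)
    (ρ : ∀ {α : Ty B}, Ix Δ α → Ix Ξ α), (t.msub F).rename ρ = t.msub (F.ren ρ)
  | _, _, _, _, .bvar x, _, _ => rfl
  | _, _, _, _, .fvar _, _, _ => rfl
  | _, _, _, _, .con _ _ _, _, _ => rfl
  | _, _, _, _, .log _, _, _ => rfl
  | _, _, _, _, .inc _ t, F, ρ => by
      simp only [rename, msub]; rw [rename_msub t]
  | _, _, _, _, .app t s, F, ρ => by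
      simp only [rename, msub]; rw [rename_msub t, rename_msub s]
  | _, _, _, _, .lam _ t, F, ρ => by
      simp only [rename, msub]
      rw [rename_msub t]
      congr 2
      ext α x
      · cases x with
        | zero => rfl
        | succ x => exact wk_rename _ _
      · exact wk_rename _ _
      · exact wk_rename _ _

theorem wk_msub {Γ Δ : List (Ty B)} {β : Ty B} (γ : Ty B) (t : Tm K Γ β) (F : MSub K Γ Δ) :
    (t.wk γ).msub (F.lift γ) = (t.msub F).wk γ := by
  rw [wk, wk, msub_rename, rename_msub]
  rfl

/-- Under a binder, lifting weakens the values, so the fusion laws build on each other: two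
renamings, a renaming with a substitution in either order, and only then two substitutions. -/
theorem msub_msub : ∀ {Γ Δ Ξ : List (Ty B)} {β : Ty B} (t : Tm K Γ β) (F : MSub K Γ Δ)
    (G : MSub K Δ Ξ), (t.msub F).msub G = t.msub (F.comp G)
  | _, _, _, _, .bvar x, _, _ => rfl
  | _, _, _, _, .fvar _, _, _ => rfl
  | _, _, _, _, .con _ _ _, _, _ => rfl
  | _, _, _, _, .log _, _, _ => rfl
  | _, _, _, _, .inc _ t, F, G => by
      simp only [msub]; rw [msub_msub t]
  | _, _, _, _, .app t s, F, G => by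
      simp only [msub]; rw [msub_msub t, msub_msub s]
  | _, _, _, _, .lam _ t, F, G => by
      simp only [msub]
      rw [msub_msub t]
      congr 2
      ext α x
      · cases x with
        | zero => rfl
        | succ x => exact wk_msub _ _ _
      · exact wk_msub _ _ _
      · exact wk_msub _ _ _

theorem bsubst_eq : ∀ {Γ Δ : List (Ty B)} {β : Ty B} (t : Tm K Γ β)
    (σ : ∀ {α : Ty B}, Ix Γ α → Tm K Δ α), t.bsubst σ = t.msub (.ofB σ)
  | _, _, _, .bvar x, _ => rfl
  | _, _, _, .fvar _, _ => rfl
  | _, _, _, .con _ _ _, _ => rfl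
  | _, _, _, .log _, _ => rfl
  | _, _, _, .inc _ t, σ => by
      simp only [bsubst, msub]; rw [bsubst_eq t]
  | _, _, _, .app t s, σ => by
      simp only [bsubst, msub]; rw [bsubst_eq t, bsubst_eq s]
  | _, _, _, .lam _ t, σ => by
      simp only [bsubst, msub]; rw [bsubst_eq t]; rfl

theorem rename_eq : ∀ {Γ Δ : List (Ty B)} {β : Ty B} (t : Tm K Γ β)
    (ρ : ∀ {α : Ty B}, Ix Γ α → Ix Δ α), t.rename ρ = t.msub (.ofB fun x => .bvar (ρ x))
  | _, _, _, .bvar x, _ => rfl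
  | _, _, _, .fvar _, _ => rfl
  | _, _, _, .con _ _ _, _ => rfl
  | _, _, _, .log _, _ => rfl
  | _, _, _, .inc _ t, ρ => by
      simp only [rename, msub]; rw [rename_eq t]
  | _, _, _, .app t s, ρ => by
      simp only [rename, msub]; rw [rename_eq t, rename_eq s]
  | _, _, _, .lam _ t, ρ => by
      simp only [rename, msub]
      rw [rename_eq t]
      congr 2
      ext α x
      · cases x <;> rfl
      · rfl
      · rfl

theorem fsubst_eq (σ : ∀ x : FVar B, Tm K [] x.ty) : ∀ {Γ : List (Ty B)} {β : Ty B}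
    (t : Tm K Γ β), t.fsubst σ =
      t.msub ⟨fun _ x => .bvar x, fun x => (σ x).wkNil, fun s h => .con h s.2.1 s.2.2⟩
  | _, _, .bvar x => rfl
  | _, _, .fvar _ => rfl
  | _, _, .con _ _ _ => rfl
  | _, _, .log _ => rfl
  | _, _, .inc _ t => by
      simp only [fsubst, msub]; rw [fsubst_eq σ t]
  | _, _, .app t s => by
      simp only [fsubst, msub]; rw [fsubst_eq σ t, fsubst_eq σ s]
  | _, _, .lam _ t => by
      simp only [fsubst, msub]
      rw [fsubst_eq σ t]
      congr 2
      ext α x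
      · cases x <;> rfl
      · rename_i x
        simp only [MSub.lift, wk, wkNil]
        rw [rename_rename]
        exact rename_congr _ fun x => nomatch x
      · rfl

theorem msub_id : ∀ {Γ : List (Ty B)} {β : Ty B} (t : Tm K Γ β), t.msub (.idm K Γ) = t
  | _, _, .bvar x => rfl
  | _, _, .fvar _ => rfl
  | _, _, .con _ _ _ => rfl
  | _, _, .log _ => rfl
  | _, _, .inc _ t => by
      simp only [msub]; rw [msub_id t]
  | _, _, .app t s => by
      simp only [msub]; rw [msub_id t, msub_id s]
  | _, _, .lam _ t => by
      simp only [msub]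
      conv_rhs => rw [← msub_id t]
      congr 2
      ext α x
      · cases x <;> rfl
      · rfl
      · rfl

theorem wkNil_eq {β : Ty B} (t : Tm K [] β) : t.wkNil (Γ := []) = t := by
  conv_rhs => rw [← msub_id t]
  rw [wkNil, rename_eq]
  congr 1
  ext α x
  · cases x
  · rfl
  · rfl

theorem inst_msub {Γ Δ : List (Ty B)} {γ β : Ty B} (t : Tm K (γ :: Γ) β) (s : Tm K Γ γ)
    (F : MSub K Γ Δ) : (t.inst s).msub F = (t.msub (F.lift γ)).inst (s.msub F) := by
  rw [inst, inst, bsubst_eq, bsubst_eq, msub_msub, msub_msub]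
  -- Lifted values do not mention the new bound variable, so instantiating it gives them back.
  have key : ∀ {β : Ty B} (r : Tm K Δ β),
      r = (r.wk γ).msub (.ofB (instSub (s.msub F))) := by
    intro β r
    rw [wk, msub_rename]
    exact (msub_id r).symm
  congr 1
  ext α x
  · cases x with
    | zero => rfl
    | succ x => exact key _
  · exact key _
  · exact key _

theorem wk_inst {Γ : List (Ty B)} {γ β : Ty B} (t : Tm K Γ β) (s : Tm K Γ γ) :
    (t.wk γ).inst s = t := by
  rw [inst, bsubst_eq, wk, msub_rename]
  exact msub_id t

/-! #### Occurrences -/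

theorem fv_rename : ∀ {Γ Δ : List (Ty B)} {β : Ty B} (t : Tm K Γ β)
    (ρ : ∀ {α : Ty B}, Ix Γ α → Ix Δ α), (t.rename ρ).fv = t.fv
  | _, _, _, .bvar x, _ => rfl
  | _, _, _, .fvar _, _ => rfl
  | _, _, _, .con _ _ _, _ => rfl
  | _, _, _, .log _, _ => rfl
  | _, _, _, .inc _ t, ρ => by simp only [rename, fv]; rw [fv_rename t]
  | _, _, _, .app t s, ρ => by simp only [rename, fv]; rw [fv_rename t, fv_rename s]
  | _, _, _, .lam _ t, ρ => by simp only [rename, fv]; rw [fv_rename t]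

theorem fv_finite : ∀ {Γ : List (Ty B)} {β : Ty B} (t : Tm K Γ β), t.fv.Finite
  | _, _, .bvar _ => Set.finite_empty
  | _, _, .fvar _ => Set.finite_singleton _
  | _, _, .con _ _ _ => Set.finite_empty
  | _, _, .log _ => Set.finite_empty
  | _, _, .inc _ t => fv_finite t
  | _, _, .app t s => (fv_finite t).union (fv_finite s)
  | _, _, .lam _ t => fv_finite t

theorem cons_finite : ∀ {Γ : List (Ty B)} {β : Ty B} (t : Tm K Γ β), t.cons.Finite
  | _, _, .bvar _ => Set.finite_empty
  | _, _, .fvar _ => Set.finite_empty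
  | _, _, .con _ _ _ => Set.finite_singleton _
  | _, _, .log _ => Set.finite_empty
  | _, _, .inc _ t => cons_finite t
  | _, _, .app t s => (cons_finite t).union (cons_finite s)
  | _, _, .lam _ t => cons_finite t

theorem notMem_fv_msub (z : FVar B) : ∀ {Γ Δ : List (Ty B)} {β : Ty B} (t : Tm K Γ β)
    (F : MSub K Γ Δ), (∀ α x, z ∉ (F.b α x).fv) → (∀ x ∈ t.fv, z ∉ (F.f x).fv) →
    (∀ s h, z ∉ (F.c s h).fv) → z ∉ (t.msub F).fv
  | _, _, _, .bvar x, F, hb, _, _ => hb _ x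
  | _, _, _, .fvar x, F, _, hf, _ => hf x rfl
  | _, _, _, .con _ _ _, F, _, _, hc => hc _ _
  | _, _, _, .log _, F, _, _, _ => fun h => h
  | _, _, _, .inc _ t, F, hb, hf, hc => notMem_fv_msub z t F hb hf hc
  | _, _, _, .app t s, F, hb, hf, hc => by
      rintro (h | h)
      · exact notMem_fv_msub z t F hb (fun x hx => hf x (Or.inl hx)) hc h
      · exact notMem_fv_msub z s F hb (fun x hx => hf x (Or.inr hx)) hc h
  | _, _, _, .lam _ t, F, hb, hf, hc => by
      refine notMem_fv_msub z t (F.lift _) (fun α x => ?_) (fun x hx => ?_) fun s h => ?_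
      · cases x with
        | zero => exact fun h => h
        | succ x => exact (fv_rename _ _).symm ▸ hb _ x
      · exact (fv_rename _ _).symm ▸ hf x hx
      · exact (fv_rename _ _).symm ▸ hc s h

theorem msub_congr : ∀ {Γ Δ : List (Ty B)} {β : Ty B} (t : Tm K Γ β) {F G : MSub K Γ Δ},
    (∀ α x, F.b α x = G.b α x) → (∀ x ∈ t.fv, F.f x = G.f x) →
    (∀ s ∈ t.cons, ∀ h, F.c s h = G.c s h) → t.msub F = t.msub G
  | _, _, _, .bvar x, _, _, hb, _, _ => hb _ x
  | _, _, _, .fvar x, _, _, _, hf, _ => hf x rfl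
  | _, _, _, .con _ _ _, _, _, _, _, hc => hc _ rfl _
  | _, _, _, .log _, _, _, _, _, _ => rfl
  | _, _, _, .inc _ t, _, _, hb, hf, hc => by
      simp only [msub]; rw [msub_congr t hb hf hc]
  | _, _, _, .app t s, _, _, hb, hf, hc => by
      simp only [msub]
      rw [msub_congr t hb (fun x hx => hf x (Or.inl hx)) fun x hx => hc x (Or.inl hx),
        msub_congr s hb (fun x hx => hf x (Or.inr hx)) fun x hx => hc x (Or.inr hx)]
  | _, _, _, .lam _ t, F, G, hb, hf, hc => by
      simp only [msub]
      rw [msub_congr t (F := F.lift _) (G := G.lift _) (fun α x => ?_) (fun x hx => ?_)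
        fun s hs h => ?_]
      · cases x with
        | zero => rfl
        | succ x => exact congrArg (wk _) (hb _ x)
      · exact congrArg (wk _) (hf x hx)
      · exact congrArg (wk _) (hc s hs h)

theorem LevelLE.label_fv {i : ℕ} : ∀ {Γ : List (Ty B)} {β : Ty B} {t : Tm K Γ β},
    t.LevelLE i → ∀ x ∈ t.fv, x.label ≤ i
  | _, _, .bvar _, _, _, hx => hx.elim
  | _, _, .fvar _, h, _, hx => by cases hx; exact h
  | _, _, .con _ _ _, _, _, hx => hx.elim
  | _, _, .log _, _, _, hx => hx.elim
  | _, _, .inc _ t, h, x, hx => label_fv (t := t) h x hx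
  | _, _, .app t s, h, x, hx =>
      hx.elim (label_fv (t := t) h.1 x) (label_fv (t := s) h.2 x)
  | _, _, .lam _ t, h, x, hx => label_fv (t := t) h x hx

theorem LevelLE.label_cons {i : ℕ} : ∀ {Γ : List (Ty B)} {β : Ty B} {t : Tm K Γ β},
    t.LevelLE i → ∀ s ∈ t.cons, s.2.1 ≤ i
  | _, _, .bvar _, _, _, hx => hx.elim
  | _, _, .fvar _, _, _, hx => hx.elim
  | _, _, .con _ _ _, h, _, hx => by cases hx; exact h
  | _, _, .log _, _, _, hx => hx.elim
  | _, _, .inc _ t, h, x, hx => label_cons (t := t) h x hx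
  | _, _, .app t s, h, x, hx =>
      hx.elim (label_cons (t := t) h.1 x) (label_cons (t := s) h.2 x)
  | _, _, .lam _ t, h, x, hx => label_cons (t := t) h x hx

theorem LevelLE.msub {i j : ℕ} : ∀ {Γ Δ : List (Ty B)} {β : Ty B} {t : Tm K Γ β}
    (F : MSub K Γ Δ), t.LevelLE i → (∀ α x, (F.b α x).LevelLE j) →
    (∀ x : FVar B, x.label ≤ i → (F.f x).LevelLE j) →
    (∀ (s : Σ (τ : Ty B) (i : ℕ), K τ i) h, s.2.1 ≤ i → (F.c s h).LevelLE j) →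
    (t.msub F).LevelLE j
  | _, _, _, .bvar x, _, _, hb, _, _ => hb _ x
  | _, _, _, .fvar x, _, h, _, hf, _ => hf x h
  | _, _, _, .con _ _ _, _, h, _, _, hc => hc _ _ h
  | _, _, _, .log _, _, _, _, _, _ => trivial
  | _, _, _, .inc _ t, F, h, hb, hf, hc => LevelLE.msub (t := t) F h hb hf hc
  | _, _, _, .app t s, F, h, hb, hf, hc =>
      ⟨LevelLE.msub (t := t) F h.1 hb hf hc, LevelLE.msub (t := s) F h.2 hb hf hc⟩
  | _, _, _, .lam _ t, F, h, hb, hf, hc => by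
      refine LevelLE.msub (t := t) (F.lift _) h (fun α x => ?_)
        (fun x hx => LevelLE.rename _ (hf x hx)) fun s hs h => LevelLE.rename _ (hc s hs h)
      cases x with
      | zero => trivial
      | succ x => exact LevelLE.rename _ (hb _ x)

end Tm

/-! #### Convertibility -/

/-- The rules of conversion mention no particular variable or constant, so constants may be replaced
as freely as variables. Eigenconstants will be treated this way. -/
theorem Conv.msub {Γ : List (Ty B)} {β : Ty B} {t s : Tm K Γ β} (h : Conv t s) :
    ∀ {Δ : List (Ty B)} (F : MSub K Γ Δ), Conv (t.msub F) (s.msub F) := by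
  induction h with
  | refl t => exact fun F => .refl _
  | symm _ ih => exact fun F => (ih F).symm
  | trans _ _ ih ih' => exact fun F => (ih F).trans (ih' F)
  | inc e _ ih => exact fun F => .inc e (ih F)
  | app _ _ ih ih' => exact fun F => .app (ih F) (ih' F)
  | lam hα _ ih => exact fun F => .lam hα (ih _)
  | beta hα t s =>
    intro Δ F
    rw [Tm.inst_msub]
    exact .beta hα _ _
  | eta hα t =>
    intro Δ F
    simp only [Tm.msub]
    rw [Tm.wk_msub]
    exact .eta hα _
  | incAtom t => exact fun F => .incAtom _
  | incTop => exact fun F => .incTop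
  | incAnd t s => exact fun F => .incAnd _ _
  | incOr t s => exact fun F => .incOr _ _
  | incSigma hα t =>
    intro Δ F
    simp only [Tm.msub]
    rw [Tm.wk_msub]
    exact .incSigma hα _
  | incPi hα t =>
    intro Δ F
    simp only [Tm.msub]
    rw [Tm.wk_msub]
    exact .incPi hα _

theorem Conv.rename {Γ Δ : List (Ty B)} {β : Ty B} {t s : Tm K Γ β} (h : Conv t s)
    (ρ : ∀ {α : Ty B}, Ix Γ α → Ix Δ α) : Conv (t.rename ρ) (s.rename ρ) := by
  rw [Tm.rename_eq, Tm.rename_eq]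
  exact h.msub _

/-- With `Conv.msub`, this makes substitution well defined when both the term and the substituted
values are taken up to conversion. -/
theorem Conv.msub_right : ∀ {Γ Δ : List (Ty B)} {β : Ty B} (t : Tm K Γ β) {F G : MSub K Γ Δ},
    (∀ α x, Conv (F.b α x) (G.b α x)) → (∀ x, Conv (F.f x) (G.f x)) →
    (∀ s h, Conv (F.c s h) (G.c s h)) → Conv (t.msub F) (t.msub G)
  | _, _, _, .bvar x, _, _, hb, _, _ => hb _ x
  | _, _, _, .fvar x, _, _, _, hf, _ => hf x
  | _, _, _, .con _ _ _, _, _, _, _, hc => hc _ _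
  | _, _, _, .log _, _, _, _, _, _ => .refl _
  | _, _, _, .inc e t, _, _, hb, hf, hc => .inc e (Conv.msub_right t hb hf hc)
  | _, _, _, .app t s, _, _, hb, hf, hc =>
      .app (Conv.msub_right t hb hf hc) (Conv.msub_right s hb hf hc)
  | _, _, _, .lam hα t, F, G, hb, hf, hc => by
      refine .lam hα (Conv.msub_right t (fun α x => ?_) (fun x => (hf x).rename _)
        fun s h => (hc s h).rename _)
      cases x with
      | zero => exact .refl _
      | succ x => exact (hb _ x).rename _

end Substitution

/-! ### Terms up to convertibility -/

section NormalForms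

variable {B : Type u} {K : Ty B → ℕ → Type v}

namespace NF

/-- The class of a term. -/
abbrev mk {β : Ty B} (t : Tm K [] β) : NF K β := Quotient.mk _ t

theorem mk_eq {β : Ty B} {t s : Tm K [] β} : mk t = mk s ↔ Conv t s :=
  ⟨fun h => Quotient.exact h, fun h => Quotient.sound h⟩

theorem ind {β : Ty B} {p : NF K β → Prop} (h : ∀ t, p (mk t)) (q : NF K β) : p q :=
  Quotient.ind h q

def app {α β : Ty B} (f : NF K (α ⇾ β)) (d : NF K α) : NF K β :=
  Quotient.map₂ (fun t s => Tm.app t s) (fun _ _ h _ _ h' => Conv.app h h') f d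

def inc {α β : Ty B} (e : Incl α β) (q : NF K α) : NF K β :=
  Quotient.map (fun t => Tm.inc e t) (fun _ _ h => Conv.inc e h) q

def log {τ : Ty B} (c : LC τ) : NF K τ := mk (.log c)

def con (s : Σ (τ : Ty B) (i : ℕ), K τ i) (h : ConTy s.1) : NF K s.1 := mk (.con h s.2.1 s.2.2)

def var (x : FVar B) : NF K x.ty := mk (.fvar x)

/-- The logic variables occurring in every convertible term. -/
def fv {β : Ty B} (q : NF K β) : Set (FVar B) := {x | ∀ t, mk t = q → x ∈ t.fv}

/-- The normal form has level at most `i`. -/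
def Lev (i : ℕ) {β : Ty B} (q : NF K β) : Prop := ∃ t : Tm K [] β, Quotient.mk _ t = q ∧ t.LevelLE i

theorem Lev.mono {i j : ℕ} (h : i ≤ j) {β : Ty B} {q : NF K β} : Lev i q → Lev j q :=
  fun ⟨t, ht, hl⟩ => ⟨t, ht, hl.mono h⟩

theorem Lev.app {i : ℕ} {α β : Ty B} {f : NF K (α ⇾ β)} {d : NF K α} :
    Lev i f → Lev i d → Lev i (f.app d) := by
  rintro ⟨t, rfl, ht⟩ ⟨s, rfl, hs⟩
  exact ⟨.app t s, rfl, ht, hs⟩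

theorem Lev.inc {i : ℕ} {α β : Ty B} (e : Incl α β) {q : NF K α} : Lev i q → Lev i (q.inc e) := by
  rintro ⟨t, rfl, ht⟩
  exact ⟨.inc e t, rfl, ht⟩

theorem Lev.log {i : ℕ} {τ : Ty B} (c : LC τ) : Lev i (NF.log (K := K) c) := ⟨.log c, rfl, trivial⟩

theorem Lev.var {i : ℕ} (x : FVar B) (h : x.label ≤ i) : Lev i (NF.var (K := K) x) :=
  ⟨.fvar x, rfl, h⟩

theorem Lev.con {i : ℕ} (s : Σ (τ : Ty B) (i : ℕ), K τ i) (hs : ConTy s.1) (h : s.2.1 ≤ i) :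
    Lev i (NF.con s hs) :=
  ⟨_, rfl, h⟩

theorem fv_finite {β : Ty B} (q : NF K β) : q.fv.Finite := by
  induction q using NF.ind with
  | h t => exact t.fv_finite.subset fun x hx => hx t rfl

end NF

/-- A substitution for logic variables and constants, with values in the terms up to
convertibility. -/
@[ext]
structure QSub (K : Ty B → ℕ → Type v) where
  f : ∀ x : FVar B, NF K x.ty
  c : ∀ s : (Σ (τ : Ty B) (i : ℕ), K τ i), ConTy s.1 → NF K s.1

/-- Environments: values for the bound variables. -/
abbrev QEnv (K : Ty B → ℕ → Type v) (Γ : List (Ty B)) := ∀ α : Ty B, Ix Γ α → NF K α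

namespace QEnv

def nil : QEnv K [] := fun _ x => nomatch x

def cons {Γ : List (Ty B)} {γ : Ty B} (ρ : QEnv K Γ) (d : NF K γ) : QEnv K (γ :: Γ)
  | _, .zero => d
  | _, .succ x => ρ _ x

end QEnv

namespace QSub

def id (K : Ty B → ℕ → Type v) : QSub K := ⟨NF.var, NF.con⟩

/-- The simultaneous substitution given by representatives. -/
noncomputable def out (F : QSub K) {Γ : List (Ty B)} (ρ : QEnv K Γ) : MSub K Γ [] where
  b α x := (ρ α x).out
  f x := (F.f x).out
  c s h := (F.c s h).out

open Classical in
/-- `F[d/z]`. -/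
noncomputable def upd (F : QSub K) (z : FVar B) (d : NF K z.ty) : QSub K :=
  ⟨Function.update F.f z d, F.c⟩

@[simp] theorem upd_f_self (F : QSub K) (z : FVar B) (d : NF K z.ty) : (F.upd z d).f z = d := by
  simp [upd]

theorem upd_f_ne (F : QSub K) (z : FVar B) (d : NF K z.ty) {x : FVar B} (h : x ≠ z) :
    (F.upd z d).f x = F.f x := by
  simp [upd, h]

end QSub

/-! ### Values of terms under a substitution and an environment -/

namespace Tm

/-- The value of a term. -/
noncomputable def eval {Γ : List (Ty B)} {β : Ty B} (t : Tm K Γ β) (F : QSub K) (ρ : QEnv K Γ) :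
    NF K β :=
  NF.mk (t.msub (F.out ρ))

/-- Only the classes of the substituted terms matter, so the arbitrary representatives in `QSub.out`
may be exchanged for convenient ones. -/
theorem eval_mk {Γ : List (Ty B)} {β : Ty B} (t : Tm K Γ β) {F : QSub K} {ρ : QEnv K Γ}
    (M : MSub K Γ []) (hb : ∀ α x, NF.mk (M.b α x) = ρ α x) (hf : ∀ x, NF.mk (M.f x) = F.f x)
    (hc : ∀ s h, NF.mk (M.c s h) = F.c s h) : t.eval F ρ = NF.mk (t.msub M) := by
  refine NF.mk_eq.2 (Conv.msub_right t (fun α x => ?_) (fun x => ?_) fun s h => ?_) <;>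
    refine NF.mk_eq.1 ?_
  · rw [hb]; exact Quotient.out_eq _
  · rw [hf]; exact Quotient.out_eq _
  · rw [hc]; exact Quotient.out_eq _

theorem eval_conv {Γ : List (Ty B)} {β : Ty B} {t s : Tm K Γ β} (h : Conv t s) (F : QSub K)
    (ρ : QEnv K Γ) : t.eval F ρ = s.eval F ρ :=
  NF.mk_eq.2 (h.msub _)

section

variable {Γ : List (Ty B)} (F : QSub K) (ρ : QEnv K Γ)

@[simp] theorem eval_bvar {α : Ty B} (x : Ix Γ α) : (bvar x : Tm K Γ α).eval F ρ = ρ α x :=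
  Quotient.out_eq _

@[simp] theorem eval_fvar (x : FVar B) : (fvar x : Tm K Γ x.ty).eval F ρ = F.f x :=
  Quotient.out_eq _

@[simp] theorem eval_con {τ : Ty B} (hτ : ConTy τ) (i : ℕ) (c : K τ i) :
    (con hτ i c : Tm K Γ τ).eval F ρ = F.c ⟨τ, i, c⟩ hτ :=
  Quotient.out_eq _

@[simp] theorem eval_inc {α β : Ty B} (e : Incl α β) (t : Tm K Γ α) :
    (inc e t).eval F ρ = (t.eval F ρ).inc e := rfl

@[simp] theorem eval_app {α β : Ty B} (t : Tm K Γ (α ⇾ β)) (s : Tm K Γ α) :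
    (app t s).eval F ρ = (t.eval F ρ).app (s.eval F ρ) := rfl

theorem eval_rename {Δ : List (Ty B)} {β : Ty B} (t : Tm K Δ β)
    (σ : ∀ {α : Ty B}, Ix Δ α → Ix Γ α) :
    (t.rename σ).eval F ρ = t.eval F fun α x => ρ α (σ x) := by
  rw [eval, msub_rename]
  rfl

theorem eval_upd {β : Ty B} (t : Tm K Γ β) {z : FVar B} (hz : z ∉ t.fv) (F : QSub K)
    (d : NF K z.ty) (ρ : QEnv K Γ) : t.eval F ρ = t.eval (F.upd z d) ρ := by
  refine congrArg NF.mk (msub_congr t (fun _ _ => rfl) (fun x hx => ?_) fun _ _ _ => rfl)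
  refine congrArg Quotient.out (F.upd_f_ne z d ?_).symm
  rintro rfl
  exact hz hx

theorem eval_wk {β γ : Ty B} (t : Tm K Γ β) (d : NF K γ) :
    (t.wk γ).eval F (ρ.cons d) = t.eval F ρ :=
  eval_rename F _ t _

theorem eval_bsubst {Δ : List (Ty B)} {β : Ty B} (t : Tm K Δ β)
    (σ : ∀ {α : Ty B}, Ix Δ α → Tm K Γ α) :
    (t.bsubst σ).eval F ρ = t.eval F fun _ x => (σ x).eval F ρ := by
  rw [eval, bsubst_eq, msub_msub]
  exact (eval_mk t _ (fun _ _ => rfl) (fun x => Quotient.out_eq _) fun s h =>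
    Quotient.out_eq _).symm

theorem eval_inst {β γ : Ty B} (t : Tm K (γ :: Γ) β) (s : Tm K Γ γ) :
    (t.inst s).eval F ρ = t.eval F (ρ.cons (s.eval F ρ)) := by
  rw [inst, eval_bsubst]
  congr 1
  funext α x
  cases x with
  | zero => rfl
  | succ x => exact eval_bvar F ρ x

theorem eval_lam_app {α β : Ty B} (hα : VarTy α) (t : Tm K (α :: Γ) β) (d : NF K α) :
    ((lam hα t).eval F ρ).app d = t.eval F (ρ.cons d) := by
  induction d using NF.ind with
  | h s =>
    have h1 : ((lam hα t).eval F ρ).app (NF.mk s) =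
        NF.mk ((t.msub ((F.out ρ).lift α)).inst s) := NF.mk_eq.2 (.beta _ _ _)
    rw [h1, inst, bsubst_eq, msub_msub]
    refine (eval_mk t _ (fun _ x => ?_) (fun x => ?_) fun s h => ?_).symm
    · cases x with
      | zero => rfl
      | succ x =>
        refine (congrArg NF.mk ?_).trans (Quotient.out_eq (ρ _ x))
        exact (bsubst_eq _ _).symm.trans (wk_inst _ _)
    · refine (congrArg NF.mk ?_).trans (Quotient.out_eq (F.f x))
      exact (bsubst_eq _ _).symm.trans (wk_inst _ _)
    · rename_i s'
      refine (congrArg NF.mk ?_).trans (Quotient.out_eq (F.c s h))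
      exact (bsubst_eq _ _).symm.trans (wk_inst _ _)

end

end Tm

/-! ### Substitution on terms up to conversion -/

namespace NF

/-- Application of a substitution. -/
noncomputable def sub {β : Ty B} (q : NF K β) (F : QSub K) : NF K β :=
  Quotient.lift (fun t => t.eval F .nil) (fun _ _ h => Tm.eval_conv h F _) q

section

variable (F : QSub K)

theorem sub_mk {β : Ty B} (t : Tm K [] β) : (mk t).sub F = t.eval F .nil := rfl

@[simp] theorem sub_app {α β : Ty B} (f : NF K (α ⇾ β)) (d : NF K α) :
    (f.app d).sub F = (f.sub F).app (d.sub F) := by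
  induction f using NF.ind with
  | h t =>
    induction d using NF.ind with
    | h s => rfl

@[simp] theorem sub_inc {α β : Ty B} (e : Incl α β) (q : NF K α) :
    (q.inc e).sub F = (q.sub F).inc e := by
  induction q using NF.ind with
  | h t => rfl

@[simp] theorem sub_log {τ : Ty B} (c : LC τ) : (log c : NF K τ).sub F = log c := rfl

@[simp] theorem sub_var (x : FVar B) : (var x : NF K x.ty).sub F = F.f x := Tm.eval_fvar F _ x

@[simp] theorem sub_con (s : Σ (τ : Ty B) (i : ℕ), K τ i) (h : ConTy s.1) :
    (con s h).sub F = F.c s h := Tm.eval_con F _ h _ _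

end

end NF

/-- Composition: first `F`, then `G`. -/
noncomputable def QSub.comp (F G : QSub K) : QSub K :=
  ⟨fun x => (F.f x).sub G, fun s h => (F.c s h).sub G⟩

theorem Tm.eval_sub {Γ : List (Ty B)} {β : Ty B} (t : Tm K Γ β) (F G : QSub K) (ρ : QEnv K Γ) :
    (t.eval F ρ).sub G = t.eval (F.comp G) fun α x => (ρ α x).sub G := by
  rw [Tm.eval, NF.sub_mk, Tm.eval, Tm.msub_msub]
  have key : ∀ {β : Ty B} (q : NF K β), NF.mk (q.out.msub (G.out .nil)) = q.sub G := by
    intro β q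
    conv_rhs => rw [← Quotient.out_eq q]
    rfl
  exact (Tm.eval_mk t _ (fun _ _ => key _) (fun _ => key _) fun _ _ => key _).symm

namespace NF

theorem sub_sub {β : Ty B} (q : NF K β) (F G : QSub K) :
    (q.sub F).sub G = q.sub (F.comp G) := by
  induction q using NF.ind with
  | h t =>
    rw [sub_mk, Tm.eval_sub, sub_mk]
    congr 1
    funext α x
    cases x

theorem sub_mk_eq {β : Ty B} (t : Tm K [] β) {F : QSub K} (M : MSub K [] [])
    (hf : ∀ x, NF.mk (M.f x) = F.f x) (hc : ∀ s h, NF.mk (M.c s h) = F.c s h) :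
    (mk t).sub F = mk (t.msub M) :=
  Tm.eval_mk t M (fun _ x => nomatch x) hf hc

@[simp] theorem sub_id {β : Ty B} (q : NF K β) : q.sub (.id K) = q := by
  induction q using NF.ind with
  | h t =>
    rw [sub_mk_eq t (.idm K []) (fun _ => rfl) fun _ _ => rfl, Tm.msub_id]

theorem eval_congr {β : Ty B} (t : Tm K [] β) {F G : QSub K} (hf : ∀ x ∈ t.fv, F.f x = G.f x)
    (hc : ∀ s ∈ t.cons, ∀ h, F.c s h = G.c s h) : (mk t).sub F = (mk t).sub G := by
  refine congrArg mk (Tm.msub_congr t (fun _ x => nomatch x) (fun x hx => ?_) fun s hs h => ?_)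
  · exact congrArg Quotient.out (hf x hx)
  · exact congrArg Quotient.out (hc s hs h)

/-- By definition of `fv`, some representative omits z; evaluate that one. -/
theorem sub_upd_of_notMem {β : Ty B} {q : NF K β} {z : FVar B} (h : z ∉ q.fv) (F : QSub K)
    (d : NF K z.ty) : q.sub (F.upd z d) = q.sub F := by
  simp only [fv, Set.mem_ofPred_eq, not_forall] at h
  obtain ⟨t, rfl, ht⟩ := h
  refine eval_congr t (fun x hx => F.upd_f_ne z d ?_) fun _ _ _ => rfl
  rintro rfl
  exact ht hx

/-- The value of a substitution depends only on the logic variables that occur in the normal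
form. -/
theorem sub_congr {β : Ty B} (q : NF K β) {F G : QSub K} (hf : ∀ x ∈ q.fv, F.f x = G.f x)
    (hc : F.c = G.c) : q.sub F = q.sub G := by
  classical
  -- Each variable outside `q.fv` is absent from some representative, but possibly a different one
  -- for each variable. So F is changed into G one variable at a time; only the finitely many
  -- variables of one fixed representative need treatment.
  have key : ∀ s : Finset (FVar B), (∀ x ∈ s, x ∉ q.fv) →
      ∃ H : QSub K, q.sub H = q.sub F ∧ H.c = F.c ∧ (∀ x ∈ s, H.f x = G.f x) ∧
        ∀ x ∉ s, H.f x = F.f x := by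
    intro s
    induction s using Finset.induction_on with
    | empty => exact fun _ => ⟨F, rfl, rfl, by simp, fun _ _ => rfl⟩
    | insert a s ha ih =>
      intro hs
      obtain ⟨H, h1, h2, h3, h4⟩ := ih fun x hx => hs x (Finset.mem_insert_of_mem hx)
      refine ⟨H.upd a (G.f a), ?_, h2, fun x hx => ?_, fun x hx => ?_⟩
      · rw [sub_upd_of_notMem (hs a (Finset.mem_insert_self _ _)), h1]
      · by_cases hxa : x = a
        · subst hxa; simp
        · rw [H.upd_f_ne _ _ hxa]
          exact h3 x ((Finset.mem_insert.1 hx).resolve_left hxa)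
      · rw [H.upd_f_ne]
        · exact h4 x fun h => hx (Finset.mem_insert_of_mem h)
        · rintro rfl; exact hx (Finset.mem_insert_self _ _)
  obtain ⟨t, rfl⟩ := Quotient.exists_rep q
  obtain ⟨H, h1, h2, h3, h4⟩ := key (t.fv_finite.toFinset.filter fun x => x ∉ (mk t).fv)
    fun x hx => (Finset.mem_filter.1 hx).2
  rw [← h1]
  refine eval_congr t (fun x hx => ?_) fun s _ h => by rw [h2, hc]
  by_cases hq : x ∈ (mk t).fv
  · rw [h4 x (by simp [hq]), hf x hq]
  · exact h3 x (by simp [hx, hq])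

theorem Lev.sub_congr {i : ℕ} {β : Ty B} {q : NF K β} (hq : Lev i q) {F G : QSub K}
    (hf : ∀ x : FVar B, x.label ≤ i → F.f x = G.f x)
    (hc : ∀ (s : Σ (τ : Ty B) (i : ℕ), K τ i) h, s.2.1 ≤ i → F.c s h = G.c s h) :
    q.sub F = q.sub G := by
  obtain ⟨t, rfl, ht⟩ := hq
  exact eval_congr t (fun x hx => hf x (ht.label_fv x hx)) fun s hs h => hc s h (ht.label_cons s hs)

end NF

/-- `F` sends logic variables and constants of label at most `i` to terms of level at most `j`. -/
def QSub.Bdd (F : QSub K) (i j : ℕ) : Prop :=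
  (∀ x : FVar B, x.label ≤ i → (F.f x).Lev j) ∧
    ∀ (s : Σ (τ : Ty B) (i : ℕ), K τ i) h, s.2.1 ≤ i → (F.c s h).Lev j

theorem QSub.Bdd.upd {F : QSub K} {i j : ℕ} (h : F.Bdd i j) {z : FVar B} {d : NF K z.ty}
    (hd : d.Lev j) : (F.upd z d).Bdd i j := by
  refine ⟨fun x hx => ?_, h.2⟩
  by_cases hxz : x = z
  · subst hxz; simpa using hd
  · rw [F.upd_f_ne _ _ hxz]; exact h.1 x hx

theorem QSub.id_bdd {i j : ℕ} (h : i ≤ j) : (QSub.id K).Bdd i j :=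
  ⟨fun x hx => .var x (hx.trans h), fun s hs hl => .con s hs (hl.trans h)⟩

theorem Tm.LevelLE.eval {i j : ℕ} {Γ : List (Ty B)} {β : Ty B} {t : Tm K Γ β} (ht : t.LevelLE i)
    {F : QSub K} (hF : F.Bdd i j) {ρ : QEnv K Γ} (hρ : ∀ α x, (ρ α x).Lev j) :
    (t.eval F ρ).Lev j := by
  classical
  -- `Quotient.out` may return a representative of needlessly high level, so one of level j is
  -- chosen whenever it exists.
  let pick : ∀ {β : Ty B} (q : NF K β), Tm K [] β := fun q =>
    if h : q.Lev j then h.choose else q.out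
  have pick_mk : ∀ {β : Ty B} (q : NF K β), NF.mk (pick q) = q := by
    intro β q
    by_cases h : q.Lev j
    · simp only [pick, h, dif_pos]; exact h.choose_spec.1
    · simp only [pick, h, dif_neg, not_false_eq_true]; exact Quotient.out_eq q
  have pick_lev : ∀ {β : Ty B} (q : NF K β), q.Lev j → (pick q).LevelLE j := by
    intro β q h
    simp only [pick, h, dif_pos]; exact h.choose_spec.2
  refine ⟨_, (Tm.eval_mk t ⟨fun α x => pick (ρ α x), fun x => pick (F.f x),
    fun s h => pick (F.c s h)⟩ (fun _ _ => pick_mk _) (fun x => pick_mk _)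
    fun s h => pick_mk _).symm, ?_⟩
  exact ht.msub _ (fun _ x => pick_lev _ (hρ _ x)) (fun x hx => pick_lev _ (hF.1 x hx))
    fun s h hs => pick_lev _ (hF.2 s h hs)

theorem NF.Lev.sub {i j : ℕ} {β : Ty B} {q : NF K β} (hq : q.Lev i) {F : QSub K} (hF : F.Bdd i j) :
    (q.sub F).Lev j := by
  obtain ⟨t, rfl, ht⟩ := hq
  exact ht.eval hF fun _ x => nomatch x

/-! #### Abstraction of a logic variable -/

open Classical in
/-- The substitution that turns the logic variable `z` into a bound variable. -/
noncomputable def MSub.abs (K : Ty B → ℕ → Type v) (z : FVar B) : MSub K [] [z.ty] where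
  b _ x := nomatch x
  f := Function.update (fun x => .fvar x) z (.bvar .zero)
  c s h := .con h s.2.1 s.2.2

namespace NF

/-- `λz.q` for a logic variable `z`. -/
noncomputable def abs (z : FVar B) {β : Ty B} (q : NF K β) : NF K (z.ty ⇾ β) :=
  Quotient.map (fun t => Tm.lam z.ok (t.msub (MSub.abs K z)))
    (fun _ _ (h : Conv _ _) => Conv.lam _ (h.msub _)) q

theorem abs_app (z : FVar B) {β : Ty B} (q : NF K β) (d : NF K z.ty) :
    (q.abs z).app d = q.sub ((QSub.id K).upd z d) := by
  induction q using NF.ind with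
  | h t =>
    induction d using NF.ind with
    | h s =>
      have h1 : ((mk t).abs z).app (mk s) = mk ((t.msub (MSub.abs K z)).inst s) :=
        mk_eq.2 (.beta _ _ _)
      rw [h1, Tm.inst, Tm.bsubst_eq, Tm.msub_msub]
      refine (sub_mk_eq t _ (fun x => ?_) fun s h => rfl).symm
      by_cases hx : x = z
      · subst hx; simp [MSub.comp, MSub.abs, Tm.msub, MSub.ofB, Tm.instSub]
      · simp [MSub.comp, MSub.abs, hx, Tm.msub, MSub.ofB, QSub.upd_f_ne, QSub.id]
        rfl

theorem abs_app_var (z : FVar B) {β : Ty B} (q : NF K β) : (q.abs z).app (var z) = q := by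
  rw [abs_app]
  conv_rhs => rw [← sub_id q]
  congr 1
  ext x
  · by_cases hx : x = z
    · subst hx; simp [QSub.id]
    · rw [QSub.upd_f_ne _ _ _ hx]
  · rfl

/-- This is η, applied to a representative of f that omits z. -/
theorem abs_app_self {z : FVar B} {β : Ty B} {f : NF K (z.ty ⇾ β)} (hz : z ∉ f.fv) :
    (f.app (var z)).abs z = f := by
  simp only [fv, Set.mem_ofPred_eq, not_forall] at hz
  obtain ⟨t, rfl, ht⟩ := hz
  refine mk_eq.2 ?_
  have h1 : (Tm.app t (.fvar z)).msub (MSub.abs K z) = .app (t.wk z.ty) (.bvar .zero) := by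
    simp only [Tm.msub]
    congr 1
    · rw [Tm.wk, Tm.rename_eq]
      refine Tm.msub_congr t (fun _ x => nomatch x) (fun x hx => ?_) fun _ _ _ => rfl
      have : x ≠ z := by rintro rfl; exact ht hx
      simp [MSub.abs, this, MSub.ofB]
    · simp [MSub.abs]
  show Conv (Tm.lam z.ok ((Tm.app t (.fvar z)).msub (MSub.abs K z))) t
  rw [h1]
  exact .eta _ _

theorem notMem_fv_abs (z : FVar B) {β : Ty B} (q : NF K β) : z ∉ (q.abs z).fv := by
  induction q using NF.ind with
  | h t =>
    intro h
    refine Tm.notMem_fv_msub z t (MSub.abs K z) (fun _ x => nomatch x) (fun x hx => ?_)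
      (fun s h h' => h') (h (.lam z.ok (t.msub (MSub.abs K z))) rfl)
    by_cases hxz : x = z
    · subst hxz; simp [MSub.abs, Tm.fv]
    · simp [MSub.abs, hxz, Tm.fv, Ne.symm hxz]

theorem Lev.abs {i : ℕ} (z : FVar B) {β : Ty B} {q : NF K β} (h : q.Lev i) : (q.abs z).Lev i := by
  obtain ⟨t, rfl, ht⟩ := h
  refine ⟨_, rfl, ht.msub (MSub.abs K z) (fun _ x => nomatch x) (fun x hx => ?_) fun s h hs => hs⟩
  by_cases hxz : x = z
  · subst hxz; simp [MSub.abs, Tm.LevelLE]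
  · simpa [MSub.abs, hxz, Tm.LevelLE] using hx

/-- Extensionality by a fresh logic variable. -/
theorem ext_var {z : FVar B} {β : Ty B} {f g : NF K (z.ty ⇾ β)} (hf : z ∉ f.fv) (hg : z ∉ g.fv)
    (h : f.app (var z) = g.app (var z)) : f = g := by
  rw [← abs_app_self hf, h, abs_app_self hg]

end NF

theorem exists_fresh {α : Ty B} (hα : VarTy α) (i : ℕ) {s : Set (FVar B)} (hs : s.Finite) :
    ∃ n : ℕ, (⟨α, hα, i, n⟩ : FVar B) ∉ s := by
  have hinj : Function.Injective fun n : ℕ => (⟨α, hα, i, n⟩ : FVar B) := by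
    intro m n h
    simpa using h
  obtain ⟨_, ⟨n, rfl⟩, hn⟩ := (Set.infinite_range_of_injective hinj).exists_notMem_finite hs
  exact ⟨n, hn⟩

/-- A fresh variable of label i is itself an argument of level i, and by η the value at a fresh
variable determines the function. -/
theorem NF.ext_of_lev {α β : Ty B} (hα : VarTy α) (i : ℕ) {f g : NF K (α ⇾ β)}
    (h : ∀ d : NF K α, d.Lev i → f.app d = g.app d) : f = g := by
  obtain ⟨n, hn⟩ := exists_fresh hα i (f.fv_finite.union g.fv_finite)
  rw [Set.mem_union, not_or] at hn
  exact NF.ext_var (z := ⟨α, hα, i, n⟩) hn.1 hn.2 (h _ (.var _ le_rfl))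

end NormalForms

/-! ### A set-theoretic model separating the logical constants -/

section Model

variable {B : Type u} {K : Ty B → ℕ → Type v}

namespace NF

/-- `λx. f x` as a function into goals, for a function `f` into positive formulae. -/
def incFun {α : Ty B} (hα : VarTy α) (q : NF K (α ⇾ Ty.h)) : NF K (α ⇾ Ty.g) :=
  Quotient.map (fun t => Tm.lam hα (.inc .hg (.app (t.wk α) (.bvar .zero))))
    (fun _ _ (h : Conv _ _) => .lam hα (.inc _ (.app (h.rename _) (.refl _)))) q

end NF

/-- The outermost logical structure of a positive formula. -/
inductive ShapeH (K : Ty B → ℕ → Type v) : Type (max u v)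
  | top
  | and (a b : NF K Ty.h)
  | or (a b : NF K Ty.h)
  | sigma (α : Ty B) (hα : VarTy α) (f : NF K (α ⇾ Ty.h))
  | pi (α : Ty B) (hα : VarTy α) (f : NF K (α ⇾ Ty.h))
  | atom (a : NF K Ty.a)
  | other

/-- The outermost logical structure of a goal. -/
inductive ShapeG (K : Ty B → ℕ → Type v) : Type (max u v)
  | top
  | and (a b : NF K Ty.g)
  | or (a b : NF K Ty.g)
  | imp (a : NF K Ty.p) (b : NF K Ty.g)
  | sigma (α : Ty B) (hα : VarTy α) (f : NF K (α ⇾ Ty.g))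
  | pi (α : Ty B) (hα : VarTy α) (f : NF K (α ⇾ Ty.g))
  | atom (a : NF K Ty.a)
  | other

/-- The outermost logical structure of a program. -/
inductive ShapeP (K : Ty B → ℕ → Type v) : Type (max u v)
  | top
  | and (a b : NF K Ty.p)
  | imp (a : NF K Ty.g) (b : NF K Ty.r)
  | pi (α : Ty B) (hα : VarTy α) (f : NF K (α ⇾ Ty.p))
  | rigid (a : NF K Ty.r)
  | other

/-- A positive formula as a goal. -/
def ShapeH.toG : ShapeH K → ShapeG K
  | .top => .top
  | .and a b => .and (a.inc .hg) (b.inc .hg)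
  | .or a b => .or (a.inc .hg) (b.inc .hg)
  | .sigma α hα f => .sigma α hα (f.incFun hα)
  | .pi α hα f => .pi α hα (f.incFun hα)
  | .atom a => .atom a
  | .other => .other

/-- Semantic values. The second component of the value of a goal is the positive formula that
the goal comes from, if there is one. -/
def Sem (K : Ty B → ℕ → Type v) : Ty B → Type (max u v)
  | .ι => PUnit
  | .user _ => PUnit
  | .r => PUnit
  | .a => Option (NF K Ty.r)
  | .h => ShapeH K
  | .g => ShapeG K × Option (NF K Ty.h)
  | .p => ShapeP K
  | .arr α β => NF K α → Sem K α → Sem K β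

/-- The value of every variable and non-logical constant: terms with such a head show no logical
structure. -/
def Sem.other : ∀ β : Ty B, Sem K β
  | .ι => PUnit.unit
  | .user _ => PUnit.unit
  | .r => PUnit.unit
  | .a => (none : Option (NF K Ty.r))
  | .h => ShapeH.other
  | .g => (ShapeG.other, none)
  | .p => ShapeP.other
  | .arr _ β => fun _ _ => Sem.other β

/-- Combination of the positive formulae that two goals come from. -/
def optAnd (c : LC (B := B) (Ty.h ⇾ Ty.h ⇾ Ty.h)) :
    Option (NF K Ty.h) → Option (NF K Ty.h) → Option (NF K Ty.h)
  | some a, some b => some (((NF.log c).app a).app b)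
  | _, _ => none

open Classical in
/-- Combination of the positive formulae that a family of goals comes from. -/
noncomputable def optQ {α : Ty B} (c : LC ((α ⇾ Ty.h) ⇾ Ty.h)) (n : Sem K (α ⇾ Ty.g)) :
    Option (NF K Ty.h) :=
  if h : ∃ q : NF K (α ⇾ Ty.h), ∀ x m, (n x m).2 = some (q.app x) then
    some ((NF.log c).app h.choose) else none

/-- On goals, the second component rebuilds a positive formula whenever the parts come from positive
formulae; it must agree with what the inclusion of h into g records. An implication never comes from
one. -/
noncomputable def LC.sem : ∀ {τ : Ty B}, LC τ → Sem K τ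
  | _, .topG => (ShapeG.top, some (NF.log .topH))
  | _, .topH => ShapeH.top
  | _, .topP => ShapeP.top
  | _, .andP => fun a _ b _ => ShapeP.and a b
  | _, .andG => fun a m b n => (ShapeG.and a b, optAnd .andH m.2 n.2)
  | _, .andH => fun a _ b _ => ShapeH.and a b
  | _, .orG => fun a m b n => (ShapeG.or a b, optAnd .orH m.2 n.2)
  | _, .orH => fun a _ b _ => ShapeH.or a b
  | _, .impG => fun a _ b _ => (ShapeG.imp a b, none)
  | _, .impP => fun a _ b _ => ShapeP.imp a b
  | _, .sigmaG α hα => fun f n => (ShapeG.sigma α hα f, optQ (.sigmaH α hα) n)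
  | _, .sigmaH α hα => fun f _ => ShapeH.sigma α hα f
  | _, .piG α hα => fun f n => (ShapeG.pi α hα f, optQ (.piH α hα) n)
  | _, .piP α hα => fun f _ => ShapeP.pi α hα f
  | _, .piH α hα => fun f _ => ShapeH.pi α hα f

/-- Each inclusion remembers its argument, possibly after a further inclusion, so that injectivity
can be read off. For a ⊆ g the argument is remembered as a positive formula, to respect
`Conv.incAtom`. -/
def Incl.sem : ∀ {α β : Ty B}, Incl α β → NF K α → Sem K α → Sem K β
  | _, _, .ra, q, _ => some q
  | _, _, .ah, q, _ => ShapeH.atom q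
  | _, _, .ag, q, _ => (ShapeG.atom q, some (q.inc .ah))
  | _, _, .hg, q, n => (ShapeH.toG n, some q)
  | _, _, .rp, q, _ => ShapeP.rigid q

/-- Semantic values of the bound variables. -/
abbrev SEnv (K : Ty B → ℕ → Type v) (Γ : List (Ty B)) := ∀ α : Ty B, Ix Γ α → Sem K α

def SEnv.cons {Γ : List (Ty B)} {γ : Ty B} (ν : SEnv K Γ) (m : Sem K γ) : SEnv K (γ :: Γ)
  | _, .zero => m
  | _, .succ x => ν _ x

namespace Tm

/-- Functions receive the class of the argument along with its value, because the forms of compound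
formulae record the classes of their parts. -/
noncomputable def sem : ∀ {Γ : List (Ty B)} {β : Ty B}, Tm K Γ β → QEnv K Γ → SEnv K Γ → Sem K β
  | _, _, .bvar x, _, ν => ν _ x
  | _, _, .fvar _, _, _ => Sem.other _
  | _, _, .con _ _ _, _, _ => Sem.other _
  | _, _, .log c, _, _ => c.sem
  | _, _, .inc e t, ρ, ν => e.sem (t.eval (.id K) ρ) (sem t ρ ν)
  | _, _, .app t s, ρ, ν => sem t ρ ν (s.eval (.id K) ρ) (sem s ρ ν)
  | _, _, .lam _ t, ρ, ν => fun d m => sem t (ρ.cons d) (ν.cons m)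

theorem sem_rename : ∀ {Γ Δ : List (Ty B)} {β : Ty B} (t : Tm K Γ β)
    (σ : ∀ {α : Ty B}, Ix Γ α → Ix Δ α) (ρ : QEnv K Δ) (ν : SEnv K Δ),
    (t.rename σ).sem ρ ν = t.sem (fun _ x => ρ _ (σ x)) (fun _ x => ν _ (σ x))
  | _, _, _, .bvar x, _, _, _ => rfl
  | _, _, _, .fvar _, _, _, _ => rfl
  | _, _, _, .con _ _ _, _, _, _ => rfl
  | _, _, _, .log _, _, _, _ => rfl
  | _, _, _, .inc _ t, σ, ρ, ν => by
      simp only [rename, sem]; rw [sem_rename t, eval_rename]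
  | _, _, _, .app t s, σ, ρ, ν => by
      simp only [rename, sem]; rw [sem_rename t, sem_rename s, eval_rename]
  | _, _, _, .lam _ t, σ, ρ, ν => by
      simp only [rename, sem]
      funext d m
      rw [sem_rename t]
      congr 1 <;> · funext α x; cases x <;> rfl

theorem sem_bsubst : ∀ {Γ Δ : List (Ty B)} {β : Ty B} (t : Tm K Γ β)
    (σ : ∀ {α : Ty B}, Ix Γ α → Tm K Δ α) (ρ : QEnv K Δ) (ν : SEnv K Δ),
    (t.bsubst σ).sem ρ ν =
      t.sem (fun _ x => (σ x).eval (.id K) ρ) (fun _ x => (σ x).sem ρ ν)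
  | _, _, _, .bvar x, _, _, _ => rfl
  | _, _, _, .fvar _, _, _, _ => rfl
  | _, _, _, .con _ _ _, _, _, _ => rfl
  | _, _, _, .log _, _, _, _ => rfl
  | _, _, _, .inc _ t, σ, ρ, ν => by
      simp only [bsubst, sem]; rw [sem_bsubst t, eval_bsubst]
  | _, _, _, .app t s, σ, ρ, ν => by
      simp only [bsubst, sem]; rw [sem_bsubst t, sem_bsubst s, eval_bsubst]
  | _, _, _, .lam _ t, σ, ρ, ν => by
      simp only [bsubst, sem]
      funext d m
      rw [sem_bsubst t]
      congr 1
      · funext α x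
        cases x with
        | zero => exact eval_bvar _ _ _
        | succ x => exact eval_wk _ _ _ _
      · funext α x
        cases x with
        | zero => rfl
        | succ x => exact sem_rename _ _ _ _

theorem sem_inst {Γ : List (Ty B)} {γ β : Ty B} (t : Tm K (γ :: Γ) β) (s : Tm K Γ γ)
    (ρ : QEnv K Γ) (ν : SEnv K Γ) :
    (t.inst s).sem ρ ν = t.sem (ρ.cons (s.eval (.id K) ρ)) (ν.cons (s.sem ρ ν)) := by
  rw [inst, sem_bsubst]
  congr 1 <;> funext α x
  · cases x with
    | zero => rfl
    | succ x => exact eval_bvar _ _ _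
  · cases x <;> rfl

theorem sem_wk {Γ : List (Ty B)} {γ β : Ty B} (t : Tm K Γ β) (ρ : QEnv K Γ) (ν : SEnv K Γ)
    (d : NF K γ) (m : Sem K γ) : (t.wk γ).sem (ρ.cons d) (ν.cons m) = t.sem ρ ν :=
  sem_rename _ _ _ _

theorem eval_incFun {Γ : List (Ty B)} {α : Ty B} (hα : VarTy α) (t : Tm K Γ (α ⇾ Ty.h))
    (F : QSub K) (ρ : QEnv K Γ) :
    (lam hα (.inc .hg (.app (t.wk α) (.bvar .zero)))).eval F ρ = (t.eval F ρ).incFun hα := by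
  refine NF.ext_of_lev hα 0 fun d _ => ?_
  rw [eval_lam_app, eval_inc, eval_app, eval_wk, eval_bvar]
  induction d using NF.ind with
  | h s =>
    refine NF.mk_eq.2 (.symm ((Conv.beta hα _ _).trans ?_))
    have : ∀ r : Tm K [] (α ⇾ Ty.h), (Tm.inc .hg (.app (r.wk α) (.bvar .zero))).inst s =
        Tm.inc .hg (.app r s) := by
      intro r
      conv_rhs => rw [← wk_inst r s]
      rfl
    rw [this]
    exact .refl _

end Tm

/-- By extensionality there is only one such q, so the choice made in `optQ` is harmless. -/
theorem optQ_eq {α : Ty B} (hα : VarTy α) (c : LC ((α ⇾ Ty.h) ⇾ Ty.h)) {n : Sem K (α ⇾ Ty.g)}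
    {q : NF K (α ⇾ Ty.h)} (h : ∀ x m, (n x m).2 = some (q.app x)) :
    optQ c n = some ((NF.log c).app q) := by
  have hex : ∃ q : NF K (α ⇾ Ty.h), ∀ x m, (n x m).2 = some (q.app x) := ⟨q, h⟩
  rw [optQ, dif_pos hex]
  congr 2
  refine NF.ext_of_lev hα 0 fun d _ => ?_
  exact Option.some_injective _ ((hex.choose_spec d (Sem.other _)).symm.trans (h d _))

/-- Non-convertibility is proved by comparing values, which takes the place of a confluence
argument. The cases pushing the inclusion of h into g through a connective are the reason for the
second component of the value of a goal. -/
theorem Conv.sem {Γ : List (Ty B)} {β : Ty B} {t s : Tm K Γ β} (h : Conv t s) :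
    ∀ (ρ : QEnv K Γ) (ν : SEnv K Γ), t.sem ρ ν = s.sem ρ ν := by
  induction h with
  | refl t => exact fun _ _ => rfl
  | symm _ ih => exact fun ρ ν => (ih ρ ν).symm
  | trans _ _ ih ih' => exact fun ρ ν => (ih ρ ν).trans (ih' ρ ν)
  | inc e h ih =>
    intro ρ ν
    simp only [Tm.sem]
    rw [Tm.eval_conv h, ih]
  | app _ h' ih ih' =>
    intro ρ ν
    simp only [Tm.sem]
    rw [ih, ih', Tm.eval_conv h']
  | lam hα _ ih =>
    intro ρ ν
    simp only [Tm.sem]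
    funext d m
    exact ih _ _
  | beta hα t s =>
    intro ρ ν
    rw [Tm.sem_inst]
    rfl
  | eta hα t =>
    intro ρ ν
    simp only [Tm.sem]
    funext d m
    rw [Tm.sem_wk, Tm.eval_bvar]
    rfl
  | incAtom t => exact fun ρ ν => rfl
  | incTop => exact fun ρ ν => rfl
  | incAnd t s => exact fun ρ ν => rfl
  | incOr t s => exact fun ρ ν => rfl
  | incSigma hα t =>
    intro ρ ν
    refine Prod.ext ?_ (Eq.symm (optQ_eq (q := t.eval (.id K) ρ) hα _ fun x m => ?_))
    · exact congrArg (ShapeG.sigma _ hα) (Tm.eval_incFun hα t _ ρ).symm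
    · simp only [Tm.sem, Incl.sem, Tm.eval_app, Tm.eval_wk, Tm.eval_bvar]
      rfl
  | incPi hα t =>
    intro ρ ν
    refine Prod.ext ?_ (Eq.symm (optQ_eq (q := t.eval (.id K) ρ) hα _ fun x m => ?_))
    · exact congrArg (ShapeG.pi _ hα) (Tm.eval_incFun hα t _ ρ).symm
    · simp only [Tm.sem, Incl.sem, Tm.eval_app, Tm.eval_wk, Tm.eval_bvar]
      rfl

namespace NF

/-- The semantic value of a normal form. -/
noncomputable def sem {β : Ty B} (q : NF K β) : Sem K β :=
  Quotient.lift (fun t => t.sem .nil fun _ x => nomatch x) (fun _ _ h => Conv.sem h _ _) q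

@[simp] theorem sem_app {α β : Ty B} (f : NF K (α ⇾ β)) (d : NF K α) :
    (f.app d).sem = f.sem d d.sem := by
  induction f using NF.ind with
  | h t =>
    induction d using NF.ind with
    | h s =>
      have h : s.eval (.id K) .nil = mk s := sub_id (mk s)
      show t.sem _ _ (s.eval (.id K) .nil) _ = _
      rw [h]
      rfl

@[simp] theorem sem_log {τ : Ty B} (c : LC τ) : (log c : NF K τ).sem = c.sem := rfl

@[simp] theorem sem_inc {α β : Ty B} (e : Incl α β) (q : NF K α) :
    (q.inc e).sem = e.sem q q.sem := by
  induction q using NF.ind with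
  | h t =>
    have h : t.eval (.id K) .nil = mk t := sub_id (mk t)
    show e.sem (t.eval (.id K) .nil) _ = _
    rw [h]
    rfl

/-- The argument of an inclusion is recorded in the semantic value. For a ⊆ g only its image in h is
recorded, so that case goes through a ⊆ h. -/
theorem inc_injective {α β : Ty B} (e : Incl α β) :
    Function.Injective (inc e : NF K α → NF K β) := by
  have hah : Function.Injective (inc .ah : NF K Ty.a → NF K Ty.h) := by
    intro q q' h
    have := congrArg sem h
    rw [sem_inc, sem_inc] at this
    exact ShapeH.atom.inj this
  intro q q' h
  have := congrArg sem h
  rw [sem_inc, sem_inc] at this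
  cases e with
  | ra => exact Option.some_injective _ this
  | ah => exact hah h
  | ag => exact hah (Option.some_injective _ (Prod.ext_iff.1 this).2)
  | hg => exact Option.some_injective _ (Prod.ext_iff.1 this).2
  | rp => exact ShapeP.rigid.inj this

/-- The outermost logical structure of a goal. -/
noncomputable def shapeG (q : NF K Ty.g) : ShapeG K := q.sem.1

/-- The outermost logical structure of a program. -/
noncomputable def shapeP (q : NF K Ty.p) : ShapeP K := q.sem

/-- The outermost logical structure of a positive formula. -/
noncomputable def shapeH (q : NF K Ty.h) : ShapeH K := q.sem

end NF

end Model

/-! ### Canonical forms -/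

section Canonical

variable {B : Type u} {K : Ty B → ℕ → Type v}

theorem VarTy.h : VarTy (Ty.h : Ty B) := Or.inr (Or.inr .nil)

/-- Variables and non-logical constants take arguments only at types that have variables. This is
what confines functions on the remaining types to logical constants. -/
theorem ConTy.of_arr {α β : Ty B} (h : ConTy (α ⇾ β)) : VarTy α ∧ ConTy β := by
  have aux : ∀ {α : Ty B}, (α = Ty.h ∨ NonLog α) → VarTy α := by
    rintro α (rfl | h)
    · exact .h
    · exact Or.inl h
  rcases h with (h | h | h) | h <;> cases h <;> rename_i h1 h2
  · exact ⟨Or.inl h1, Or.inl (Or.inl h2)⟩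
  · exact ⟨aux h1, Or.inl (Or.inr (Or.inl h2))⟩
  · exact ⟨aux h1, Or.inl (Or.inr (Or.inr h2))⟩
  · exact ⟨aux h1, Or.inr h2⟩

theorem not_conTy_p : ¬ ConTy (Ty.p : Ty B) := by
  rintro ((h | h | h) | h) <;> cases h

/-- The canonical forms of programs. -/
inductive CanonP (i : ℕ) : NF K Ty.p → Prop
  | top : CanonP i (.log .topP)
  | rigid {x : NF K Ty.r} : x.Lev i → CanonP i (x.inc .rp)
  | imp {G : NF K Ty.g} {x : NF K Ty.r} : G.Lev i → x.Lev i →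
      CanonP i (((NF.log .impP).app G).app x)
  | and {D₁ D₂ : NF K Ty.p} : D₁.Lev i → D₂.Lev i → CanonP i (((NF.log .andP).app D₁).app D₂)
  | pi {α : Ty B} (hα : VarTy α) {f : NF K (α ⇾ Ty.p)} : f.Lev i →
      CanonP i ((NF.log (.piP α hα)).app f)

/-- The canonical forms of functions on a type without variables. -/
def CanonFun {α β : Ty B} (q : NF K (α ⇾ β)) : Prop :=
  (∃ c, q = .log c) ∨ ∃ (γ : Ty B) (c : LC (γ ⇾ α ⇾ β)) (s : NF K γ), q = (NF.log c).app s

/-- Reducibility at level `i`. -/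
def Red (i : ℕ) : ∀ {β : Ty B}, NF K β → Prop
  | .p, q => q.Lev i ∧ CanonP i q
  | .arr α β, q => q.Lev i ∧ (¬ VarTy α → CanonFun q) ∧
      ∀ d : NF K α, Red i d → Red i (β := β) (q.app d)
  | .ι, q => q.Lev i
  | .user _, q => q.Lev i
  | .h, q => q.Lev i
  | .a, q => q.Lev i
  | .r, q => q.Lev i
  | .g, q => q.Lev i

theorem Red.lev {i : ℕ} : ∀ {β : Ty B} {q : NF K β}, Red i q → q.Lev i
  | .p, _, h => h.1
  | .arr _ _, _, h => h.1
  | .ι, _, h => h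
  | .user _, _, h => h
  | .h, _, h => h
  | .a, _, h => h
  | .r, _, h => h
  | .g, _, h => h

/-- At these types reducibility is only a bound on the level: no result is a program, and every
argument type has variables, which makes the condition `CanonFun` void. -/
theorem Red.of_conTy {i : ℕ} : ∀ {β : Ty B} {q : NF K β}, ConTy β → q.Lev i → Red i q
  | .p, _, hβ, _ => (not_conTy_p hβ).elim
  | .arr _ _, _, hβ, h =>
      ⟨h, fun hα => (hα hβ.of_arr.1).elim, fun _ hd => Red.of_conTy hβ.of_arr.2 (h.app hd.lev)⟩
  | .ι, _, _, h => h
  | .user _, _, _, h => h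
  | .h, _, _, h => h
  | .a, _, _, h => h
  | .r, _, _, h => h
  | .g, _, _, h => h

theorem Red.log (i : ℕ) {τ : Ty B} (c : LC τ) : Red i (NF.log (K := K) c) := by
  have hc : (NF.log (K := K) c).Lev i := .log c
  cases c with
  | topG => exact hc
  | topH => exact hc
  | topP => exact ⟨hc, .top⟩
  | andP =>
    exact ⟨hc, fun _ => Or.inl ⟨_, rfl⟩, fun d hd => ⟨hc.app hd.lev,
      fun _ => Or.inr ⟨_, _, _, rfl⟩, fun e he => ⟨(hc.app hd.lev).app he.lev, .and hd.lev he.lev⟩⟩⟩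
  | andG =>
    exact ⟨hc, fun _ => Or.inl ⟨_, rfl⟩, fun d hd => ⟨hc.app hd.lev,
      fun _ => Or.inr ⟨_, _, _, rfl⟩, fun e he => (hc.app hd.lev).app he.lev⟩⟩
  | andH =>
    exact ⟨hc, fun _ => Or.inl ⟨_, rfl⟩, fun d hd => ⟨hc.app hd.lev,
      fun _ => Or.inr ⟨_, _, _, rfl⟩, fun e he => (hc.app hd.lev).app he.lev⟩⟩
  | orG =>
    exact ⟨hc, fun _ => Or.inl ⟨_, rfl⟩, fun d hd => ⟨hc.app hd.lev,
      fun _ => Or.inr ⟨_, _, _, rfl⟩, fun e he => (hc.app hd.lev).app he.lev⟩⟩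
  | orH =>
    exact ⟨hc, fun _ => Or.inl ⟨_, rfl⟩, fun d hd => ⟨hc.app hd.lev,
      fun _ => Or.inr ⟨_, _, _, rfl⟩, fun e he => (hc.app hd.lev).app he.lev⟩⟩
  | impG =>
    exact ⟨hc, fun _ => Or.inl ⟨_, rfl⟩, fun d hd => ⟨hc.app hd.lev,
      fun _ => Or.inr ⟨_, _, _, rfl⟩, fun e he => (hc.app hd.lev).app he.lev⟩⟩
  | impP =>
    exact ⟨hc, fun _ => Or.inl ⟨_, rfl⟩, fun d hd => ⟨hc.app hd.lev,
      fun _ => Or.inr ⟨_, _, _, rfl⟩, fun e he => ⟨(hc.app hd.lev).app he.lev, .imp hd.lev he.lev⟩⟩⟩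
  | sigmaG α hα => exact ⟨hc, fun _ => Or.inl ⟨_, rfl⟩, fun d hd => hc.app hd.lev⟩
  | sigmaH α hα => exact ⟨hc, fun _ => Or.inl ⟨_, rfl⟩, fun d hd => hc.app hd.lev⟩
  | piG α hα => exact ⟨hc, fun _ => Or.inl ⟨_, rfl⟩, fun d hd => hc.app hd.lev⟩
  | piH α hα => exact ⟨hc, fun _ => Or.inl ⟨_, rfl⟩, fun d hd => hc.app hd.lev⟩
  | piP α hα =>
    exact ⟨hc, fun _ => Or.inl ⟨_, rfl⟩, fun d hd => ⟨hc.app hd.lev, .pi hα hd.lev⟩⟩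

theorem Red.inc {i : ℕ} {α β : Ty B} (e : Incl α β) {q : NF K α} (hq : q.Lev i) :
    Red i (q.inc e) := by
  have h : (q.inc e).Lev i := hq.inc e
  cases e with
  | ra => exact h
  | ah => exact h
  | ag => exact h
  | hg => exact h
  | rp => exact ⟨h, .rigid hq⟩

/-- The fundamental lemma of the logical relation. An abstraction never has to be a `CanonFun`,
since only types with variables can be bound. -/
theorem Red.eval {i : ℕ} : ∀ {Γ : List (Ty B)} {β : Ty B} (t : Tm K Γ β) (ρ : QEnv K Γ),
    t.LevelLE i → (∀ α x, Red i (ρ α x)) → Red i (t.eval (.id K) ρ)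
  | _, _, .bvar x, ρ, _, hρ => by rw [Tm.eval_bvar]; exact hρ _ x
  | _, _, .fvar x, ρ, ht, _ => by
      rw [Tm.eval_fvar]; exact .of_conTy (Or.inl x.ok) (.var x ht)
  | _, _, .con hτ j c, ρ, ht, _ => by
      rw [Tm.eval_con]; exact .of_conTy hτ (.con _ _ ht)
  | _, _, .log c, _, _, _ => .log i c
  | _, _, .inc e t, ρ, ht, hρ => .inc e (Red.eval t ρ ht hρ).lev
  | _, _, .app t s, ρ, ht, hρ => (Red.eval t ρ ht.1 hρ).2.2 _ (Red.eval s ρ ht.2 hρ)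
  | _, _, .lam (α := α) (β := β) hα t, ρ, ht, hρ => by
      have hl : ((Tm.lam hα t).eval (.id K) ρ).Lev i :=
        Tm.LevelLE.eval (t := .lam hα t) ht (QSub.id_bdd le_rfl) fun α x => (hρ α x).lev
      refine ⟨hl, fun h => (h hα).elim, fun d hd => ?_⟩
      rw [Tm.eval_lam_app]
      refine Red.eval t _ ht fun γ x => ?_
      cases x with
      | zero => exact hd
      | succ x => exact hρ _ x

theorem NF.Lev.red {i : ℕ} {β : Ty B} {q : NF K β} (h : q.Lev i) : Red i q := by
  obtain ⟨t, rfl, ht⟩ := h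
  have := Red.eval t .nil ht fun _ x => nomatch x
  rwa [← NF.sub_mk _ t, NF.sub_id] at this

theorem NF.Lev.canonP {i : ℕ} {q : NF K Ty.p} (h : q.Lev i) : CanonP i q := h.red.2

theorem NF.canonFun {α β : Ty B} (q : NF K (α ⇾ β)) (hα : ¬ VarTy α) (i : ℕ) (h : q.Lev i) :
    CanonFun q := h.red.2.1 hα

/-- Constant functions. -/
noncomputable def NF.const {α β : Ty B} (hα : VarTy α) (q : NF K β) : NF K (α ⇾ β) :=
  NF.abs ⟨α, hα, 0, 0⟩ q

theorem NF.Lev.const {i : ℕ} {α β : Ty B} (hα : VarTy α) {q : NF K β} (h : q.Lev i) :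
    (q.const hα).Lev i := h.abs _

/-- Functional extensionality. -/
theorem NF.Lev.funext (hr : Nonempty (K Ty.r 0)) {i : ℕ} {α β : Ty B} {f g : NF K (α ⇾ β)}
    (hf : f.Lev i) (hg : g.Lev i) (h : ∀ d : NF K α, d.Lev i → f.app d = g.app d) : f = g := by
  by_cases hα : VarTy α
  · exact NF.ext_of_lev hα i h
  -- Comparing values requires an argument of each type on which a logical constant acts. Rigid
  -- atoms are the only such base type without a logical constant, hence r₀; predicates are provided
  -- by constant functions.
  · obtain ⟨r₀⟩ := hr
    have dg : ∃ d : NF K Ty.g, d.Lev i := ⟨_, .log .topG⟩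
    have dp : ∃ d : NF K Ty.p, d.Lev i := ⟨_, .log .topP⟩
    have dh : ∃ d : NF K Ty.h, d.Lev i := ⟨_, .log .topH⟩
    have dr : ∃ d : NF K Ty.r, d.Lev i :=
      ⟨_, .con ⟨Ty.r, 0, r₀⟩ (Or.inr .nil) (Nat.zero_le i)⟩
    have df : ∀ {β : Ty B} (α : Ty B), VarTy α → (∃ d : NF K β, d.Lev i) →
        ∃ d : NF K (α ⇾ β), d.Lev i := fun α hα ⟨d, hd⟩ => ⟨_, hd.const hα⟩
    -- Both functions are logical constants with at most one argument supplied. Saturating them with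
    -- the sample arguments exposes the constant and that first argument in the logical form.
    rcases NF.canonFun f hα i hf with ⟨c, rfl⟩ | ⟨γ, c, s, rfl⟩ <;>
    rcases NF.canonFun g hα i hg with ⟨c', rfl⟩ | ⟨γ', c', s', rfl⟩ <;>
    cases c <;> cases c' <;>
    first
    | rfl
    | exact (hα .h).elim
    | obtain ⟨d, hd⟩ := dg
      have e := congrArg NF.shapeG (h d hd)
      simp [NF.shapeG, LC.sem] at e
      try rw [e]
    | obtain ⟨d, hd⟩ := dg
      have e := congrArg (fun q => NF.shapeG (q.app d)) (h d hd)
      simp [NF.shapeG, LC.sem] at e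
    | obtain ⟨d, hd⟩ := df _ (by assumption) dg
      have e := congrArg NF.shapeG (h d hd)
      simp [NF.shapeG, LC.sem] at e
    | obtain ⟨d, hd⟩ := df _ (by assumption) dh
      have e := congrArg NF.shapeH (h d hd)
      simp [NF.shapeH, LC.sem] at e
    | obtain ⟨d, hd⟩ := dp
      have e := congrArg NF.shapeP (h d hd)
      simp [NF.shapeP, LC.sem] at e
      rw [e]
    | obtain ⟨d, hd⟩ := dr
      have e := congrArg NF.shapeP (h d hd)
      simp [NF.shapeP, LC.sem] at e
      rw [e]

end Canonical

/-! ### The term structure as an applicative structure -/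

section TermModel

variable {B : Type u} {K : Ty B → ℕ → Type v}

theorem TD.ext {i : ℕ} {β : Ty B} {q q' : TD K i β} (h : q.1 = q'.1) : q = q' := Subtype.ext h

/-- An element of `TD` from its value. -/
def TD.of {i : ℕ} {β : Ty B} (q : NF K β) (h : q.Lev i) : TD K i β := ⟨q, h⟩

@[simp] theorem TD.of_val {i : ℕ} {β : Ty B} (q : NF K β) (h : q.Lev i) : (TD.of q h).1 = q := rfl

theorem TD.mk_rep {i : ℕ} {β : Ty B} (q : TD K i β) : NF.mk q.rep = q.1 := q.2.choose_spec.1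

/-! ### Underlying classes of the operations of the term structure -/

section Values

variable {i j : ℕ} {α β : Ty B}

@[simp] theorem TD.mk_val (t : Tm K [] β) (ht : t.LevelLE i) : (TD.mk t ht).1 = NF.mk t := rfl

@[simp] theorem TD.var_val (x : FVar B) : (TD.var (K := K) x).1 = NF.var x := rfl

@[simp] theorem termApp_app_val (f : TD K i (α ⇾ β)) (d : TD K i α) :
    ((termApp K).app f d).1 = f.1.app d.1 := by
  rw [← f.mk_rep, ← d.mk_rep]
  rfl

@[simp] theorem termApp_inc_val (e : Incl α β) (d : TD K i α) :
    ((termApp K).inc e d).1 = d.1.inc e := by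
  rw [← d.mk_rep]
  rfl

@[simp] theorem termApp_lift_val (h : i ≤ j) (d : TD K i α) : ((termApp K).lift h d).1 = d.1 := rfl

@[simp] theorem termApp_logAt_val {τ : Ty B} (c : LC τ) :
    ((termApp K).logAt i c).1 = NF.log c := rfl

@[simp] theorem topG_val : ((termApp K).topG i).1 = NF.log .topG := rfl

@[simp] theorem topP_val : ((termApp K).topP i).1 = NF.log .topP := rfl

@[simp] theorem andP_val (x y : TD K i Ty.p) :
    ((termApp K).andP x y).1 = ((NF.log .andP).app x.1).app y.1 := by
  rw [AppStr.andP, termApp_app_val, termApp_app_val, termApp_logAt_val]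

@[simp] theorem andG_val (x y : TD K i Ty.g) :
    ((termApp K).andG x y).1 = ((NF.log .andG).app x.1).app y.1 := by
  rw [AppStr.andG, termApp_app_val, termApp_app_val, termApp_logAt_val]

@[simp] theorem orG_val (x y : TD K i Ty.g) :
    ((termApp K).orG x y).1 = ((NF.log .orG).app x.1).app y.1 := by
  rw [AppStr.orG, termApp_app_val, termApp_app_val, termApp_logAt_val]

@[simp] theorem impG_val (x : TD K i Ty.p) (y : TD K i Ty.g) :
    ((termApp K).impG x y).1 = ((NF.log .impG).app x.1).app y.1 := by
  rw [AppStr.impG, termApp_app_val, termApp_app_val, termApp_logAt_val]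

@[simp] theorem impP_val (x : TD K i Ty.g) (y : TD K i Ty.r) :
    ((termApp K).impP x y).1 = ((NF.log .impP).app x.1).app y.1 := by
  rw [AppStr.impP, termApp_app_val, termApp_app_val, termApp_logAt_val]

@[simp] theorem sigmaG_val (hα : VarTy α) (f : TD K i (α ⇾ Ty.g)) :
    ((termApp K).sigmaG hα f).1 = (NF.log (.sigmaG α hα)).app f.1 := by
  rw [AppStr.sigmaG, termApp_app_val, termApp_logAt_val]

@[simp] theorem piG_val (hα : VarTy α) (f : TD K i (α ⇾ Ty.g)) :
    ((termApp K).piG hα f).1 = (NF.log (.piG α hα)).app f.1 := by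
  rw [AppStr.piG, termApp_app_val, termApp_logAt_val]

@[simp] theorem piP_val (hα : VarTy α) (f : TD K i (α ⇾ Ty.p)) :
    ((termApp K).piP hα f).1 = (NF.log (.piP α hα)).app f.1 := by
  rw [AppStr.piP, termApp_app_val, termApp_logAt_val]

@[simp] theorem rigidG_val (x : TD K i Ty.r) :
    ((termApp K).rigidG x).1 = (x.1.inc .ra).inc .ag := by
  rw [AppStr.rigidG, termApp_inc_val, termApp_inc_val]

@[simp] theorem rigidP_val (x : TD K i Ty.r) : ((termApp K).rigidP x).1 = x.1.inc .rp := by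
  rw [AppStr.rigidP, termApp_inc_val]

end Values

/-- An assignment of terms as a substitution. -/
def QSub.ofAsg (φ : (termApp K).Assignment) : QSub K := ⟨fun x => (φ x).1, NF.con⟩

theorem QSub.ofAsg_bdd (φ : (termApp K).Assignment) (i : ℕ) : (QSub.ofAsg φ).Bdd i i :=
  ⟨fun x hx => NF.Lev.mono hx (φ x).2, fun s h hs => .con s h hs⟩

theorem termMeaning_val (φ : (termApp K).Assignment) {i : ℕ} {β : Ty B} (q : TD K i β) :
    (termMeaning φ q).1 = q.1.sub (.ofAsg φ) := by
  rw [← q.mk_rep, termMeaning, TD.mk_val, Tm.fsubst_eq]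
  refine (NF.sub_mk_eq _ _ (fun x => ?_) fun s h => rfl).symm
  exact (congrArg NF.mk (Tm.wkNil_eq _)).trans (TD.mk_rep _)

/-- Composition of assignments: first `φ`, then `η`. -/
noncomputable def compAsg (φ η : (termApp K).Assignment) : (termApp K).Assignment :=
  fun x => termMeaning η (φ x)

theorem QSub.ofAsg_comp (φ η : (termApp K).Assignment) :
    (QSub.ofAsg φ).comp (.ofAsg η) = .ofAsg (compAsg φ η) := by
  ext
  · exact (termMeaning_val _ _).symm
  · exact NF.sub_con _ _ _

open Classical in
theorem QSub.ofAsg_update (φ : (termApp K).Assignment) (y : FVar B) (d : TD K y.label y.ty) :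
    QSub.ofAsg ((termApp K).update φ y d) = (QSub.ofAsg φ).upd y d.1 := by
  ext x
  · by_cases h : x = y
    · subst h
      rw [QSub.upd_f_self]
      exact congrArg Subtype.val (Function.update_self ..)
    · rw [QSub.upd_f_ne _ _ _ h]
      exact congrArg Subtype.val (Function.update_of_ne h ..)
  · rfl

/-! ### Substitutions between levels of the term structure -/

namespace TD

/-- Application of a substitution that respects levels. -/
noncomputable def map (F : QSub K) {i j : ℕ} (h : F.Bdd i j) {β : Ty B} (q : TD K i β) :
    TD K j β :=
  ⟨q.1.sub F, NF.Lev.sub q.2 h⟩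

section Map

variable {F : QSub K} {i j : ℕ} (h : F.Bdd i j) {α β : Ty B}

@[simp] theorem map_val (q : TD K i β) : (q.map F h).1 = q.1.sub F := rfl

theorem map_app (f : TD K i (α ⇾ β)) (d : TD K i α) :
    ((termApp K).app f d).map F h = (termApp K).app (f.map F h) (d.map F h) :=
  TD.ext (by rw [termApp_app_val, map_val, map_val, map_val, termApp_app_val, NF.sub_app])

theorem map_topG : ((termApp K).topG i).map F h = (termApp K).topG j := TD.ext (by simp)

theorem map_andP (x y : TD K i Ty.p) :
    ((termApp K).andP x y).map F h = (termApp K).andP (x.map F h) (y.map F h) :=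
  TD.ext (by simp)

theorem map_andG (x y : TD K i Ty.g) :
    ((termApp K).andG x y).map F h = (termApp K).andG (x.map F h) (y.map F h) :=
  TD.ext (by simp)

theorem map_orG (x y : TD K i Ty.g) :
    ((termApp K).orG x y).map F h = (termApp K).orG (x.map F h) (y.map F h) :=
  TD.ext (by simp)

theorem map_impG (x : TD K i Ty.p) (y : TD K i Ty.g) :
    ((termApp K).impG x y).map F h = (termApp K).impG (x.map F h) (y.map F h) :=
  TD.ext (by simp)

theorem map_impP (x : TD K i Ty.g) (y : TD K i Ty.r) :
    ((termApp K).impP x y).map F h = (termApp K).impP (x.map F h) (y.map F h) :=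
  TD.ext (by simp)

theorem map_sigmaG (hα : VarTy α) (f : TD K i (α ⇾ Ty.g)) :
    ((termApp K).sigmaG hα f).map F h = (termApp K).sigmaG hα (f.map F h) :=
  TD.ext (by simp)

theorem map_piG (hα : VarTy α) (f : TD K i (α ⇾ Ty.g)) :
    ((termApp K).piG hα f).map F h = (termApp K).piG hα (f.map F h) :=
  TD.ext (by simp)

theorem map_piP (hα : VarTy α) (f : TD K i (α ⇾ Ty.p)) :
    ((termApp K).piP hα f).map F h = (termApp K).piP hα (f.map F h) :=
  TD.ext (by simp)

theorem map_rigidG (x : TD K i Ty.r) :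
    ((termApp K).rigidG x).map F h = (termApp K).rigidG (x.map F h) :=
  TD.ext (by simp)

theorem map_rigidP (x : TD K i Ty.r) :
    ((termApp K).rigidP x).map F h = (termApp K).rigidP (x.map F h) :=
  TD.ext (by simp)

theorem map_lift_id (hij : i ≤ j) (q : TD K i β) :
    (termApp K).lift hij q = q.map (.id K) (QSub.id_bdd hij) :=
  TD.ext (by simp)

theorem map_id (q : TD K i β) : q.map (.id K) (QSub.id_bdd le_rfl) = q := TD.ext (by simp)

end Map

theorem termMeaning_eq_map (φ : (termApp K).Assignment) {i : ℕ} {β : Ty B} (q : TD K i β) :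
    termMeaning φ q = q.map (.ofAsg φ) (QSub.ofAsg_bdd φ i) :=
  TD.ext (termMeaning_val φ q)

theorem sub_eq_map {i : ℕ} {β : Ty B} (q : TD K i β) (θ : Sub K) :
    q.sub θ = q.map (.ofAsg θ.toFun) (QSub.ofAsg_bdd _ i) :=
  termMeaning_eq_map _ q

theorem sub_val {i : ℕ} {β : Ty B} (q : TD K i β) (θ : Sub K) :
    (q.sub θ).1 = q.1.sub (.ofAsg θ.toFun) :=
  termMeaning_val _ q

/-! #### Canonical programs -/

theorem canonP {i : ℕ} (D : TD K i Ty.p) :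
    D = (termApp K).topP i ∨ (∃ x, D = (termApp K).rigidP x) ∨
    (∃ G x, D = (termApp K).impP G x) ∨ (∃ D₁ D₂, D = (termApp K).andP D₁ D₂) ∨
    ∃ (α : Ty B) (hα : VarTy α) (f : TD K i (α ⇾ Ty.p)), D = (termApp K).piP hα f := by
  have h := NF.Lev.canonP (q := D.1) D.2
  generalize hq : D.1 = q at h
  cases h with
  | top => exact Or.inl (TD.ext hq)
  | rigid h => exact Or.inr (Or.inl ⟨.of _ h, TD.ext (by simp [hq])⟩)
  | imp h h' => exact Or.inr (Or.inr (Or.inl ⟨.of _ h, .of _ h', TD.ext (by simp [hq])⟩))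
  | and h h' => exact Or.inr (Or.inr (Or.inr (Or.inl ⟨.of _ h, .of _ h', TD.ext (by simp [hq])⟩)))
  | pi hα h => exact Or.inr (Or.inr (Or.inr (Or.inr ⟨_, hα, .of _ h, TD.ext (by simp [hq])⟩)))

/-- The outermost logical structure. -/
noncomputable def shapeP {i : ℕ} (D : TD K i Ty.p) : ShapeP K := D.1.shapeP

/-- The outermost logical structure. -/
noncomputable def shapeG {i : ℕ} (G : TD K i Ty.g) : ShapeG K := G.1.shapeG

section Shapes

variable {i : ℕ} {α : Ty B}

@[simp] theorem shapeP_top : ((termApp K).topP i).shapeP = .top := rfl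

@[simp] theorem shapeP_rigid (x : TD K i Ty.r) : ((termApp K).rigidP x).shapeP = .rigid x.1 := by
  simp [shapeP, NF.shapeP, Incl.sem]

@[simp] theorem shapeP_imp (G : TD K i Ty.g) (x : TD K i Ty.r) :
    ((termApp K).impP G x).shapeP = .imp G.1 x.1 := by
  simp [shapeP, NF.shapeP, LC.sem]

@[simp] theorem shapeP_and (D D' : TD K i Ty.p) :
    ((termApp K).andP D D').shapeP = .and D.1 D'.1 := by
  simp [shapeP, NF.shapeP, LC.sem]

@[simp] theorem shapeP_pi (hα : VarTy α) (f : TD K i (α ⇾ Ty.p)) :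
    ((termApp K).piP hα f).shapeP = .pi α hα f.1 := by
  simp [shapeP, NF.shapeP, LC.sem]

@[simp] theorem shapeG_top : ((termApp K).topG i).shapeG = .top := rfl

@[simp] theorem shapeG_rigid (x : TD K i Ty.r) :
    ((termApp K).rigidG x).shapeG = .atom (x.1.inc .ra) := by
  simp [shapeG, NF.shapeG, Incl.sem]

@[simp] theorem shapeG_imp (D : TD K i Ty.p) (G : TD K i Ty.g) :
    ((termApp K).impG D G).shapeG = .imp D.1 G.1 := by
  simp [shapeG, NF.shapeG, LC.sem]

@[simp] theorem shapeG_and (G G' : TD K i Ty.g) :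
    ((termApp K).andG G G').shapeG = .and G.1 G'.1 := by
  simp [shapeG, NF.shapeG, LC.sem]

@[simp] theorem shapeG_or (G G' : TD K i Ty.g) :
    ((termApp K).orG G G').shapeG = .or G.1 G'.1 := by
  simp [shapeG, NF.shapeG, LC.sem]

@[simp] theorem shapeG_sigma (hα : VarTy α) (f : TD K i (α ⇾ Ty.g)) :
    ((termApp K).sigmaG hα f).shapeG = .sigma α hα f.1 := by
  simp [shapeG, NF.shapeG, LC.sem]

@[simp] theorem shapeG_pi (hα : VarTy α) (f : TD K i (α ⇾ Ty.g)) :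
    ((termApp K).piG hα f).shapeG = .pi α hα f.1 := by
  simp [shapeG, NF.shapeG, LC.sem]

end Shapes

/-! ### Recovering the form of a program from its image under a substitution -/

section Inversion

variable {F : QSub K} {i j : ℕ} {h : F.Bdd i j} {D : TD K i Ty.p}

/-- No variable has type p, so a substitution cannot create the outermost form of a program. The
canonical form of D is already the right one, since the other forms keep a different logical shape
after substitution. -/
theorem eq_rigidP_of_map {x : TD K j Ty.r} (e : D.map F h = (termApp K).rigidP x) :
    ∃ x₀, D = (termApp K).rigidP x₀ ∧ x₀.map F h = x := by
  have e' := congrArg shapeP e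
  rcases D.canonP with rfl | ⟨x₀, rfl⟩ | ⟨G, x₀, rfl⟩ | ⟨D₁, D₂, rfl⟩ | ⟨α, hα, f, rfl⟩
  · simp [shapeP, NF.shapeP, LC.sem, Incl.sem] at e'
  · rw [map_rigidP] at e'
    exact ⟨x₀, rfl, TD.ext (by simpa using e')⟩
  · simp [map_impP] at e'
  · simp [map_andP] at e'
  · simp [map_piP] at e'

theorem eq_impP_of_map {G : TD K j Ty.g} {x : TD K j Ty.r}
    (e : D.map F h = (termApp K).impP G x) :
    ∃ G₀ x₀, D = (termApp K).impP G₀ x₀ ∧ G₀.map F h = G ∧ x₀.map F h = x := by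
  have e' := congrArg shapeP e
  rcases D.canonP with rfl | ⟨x₀, rfl⟩ | ⟨G, x₀, rfl⟩ | ⟨D₁, D₂, rfl⟩ | ⟨α, hα, f, rfl⟩
  · simp [shapeP, NF.shapeP, LC.sem] at e'
  · simp [map_rigidP] at e'
  · rw [map_impP] at e'
    simp only [shapeP_imp, ShapeP.imp.injEq] at e'
    exact ⟨G, x₀, rfl, TD.ext e'.1, TD.ext e'.2⟩
  · simp [map_andP] at e'
  · simp [map_piP] at e'

theorem eq_andP_of_map {D₁ D₂ : TD K j Ty.p}
    (e : D.map F h = (termApp K).andP D₁ D₂) :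
    ∃ E₁ E₂, D = (termApp K).andP E₁ E₂ ∧ E₁.map F h = D₁ ∧ E₂.map F h = D₂ := by
  have e' := congrArg shapeP e
  rcases D.canonP with rfl | ⟨x₀, rfl⟩ | ⟨G, x₀, rfl⟩ | ⟨D₁, D₂, rfl⟩ | ⟨α, hα, f, rfl⟩
  · simp [shapeP, NF.shapeP, LC.sem] at e'
  · simp [map_rigidP] at e'
  · simp [map_impP] at e'
  · rw [map_andP] at e'
    simp only [shapeP_and, ShapeP.and.injEq] at e'
    exact ⟨_, _, rfl, TD.ext e'.1, TD.ext e'.2⟩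
  · simp [map_piP] at e'

theorem eq_piP_of_map {α : Ty B} {hα : VarTy α} {f : TD K j (α ⇾ Ty.p)}
    (e : D.map F h = (termApp K).piP hα f) :
    ∃ f₀, D = (termApp K).piP hα f₀ ∧ f₀.map F h = f := by
  have e' := congrArg shapeP e
  rcases D.canonP with rfl | ⟨x₀, rfl⟩ | ⟨G, x₀, rfl⟩ | ⟨D₁, D₂, rfl⟩ | ⟨α, hα, f, rfl⟩
  · simp [shapeP, NF.shapeP, LC.sem] at e'
  · simp [map_rigidP] at e'
  · simp [map_impP] at e'
  · simp [map_andP] at e'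
  · rw [map_piP] at e'
    simp only [shapeP_pi, ShapeP.pi.injEq] at e'
    obtain ⟨rfl, e'⟩ := e'
    exact ⟨_, rfl, TD.ext (eq_of_heq e')⟩

end Inversion

end TD

/-! #### The interpretation of terms -/

theorem termMeaning_mk_val (φ : (termApp K).Assignment) {i : ℕ} {β : Ty B} (t : Tm K [] β)
    (ht : t.LevelLE i) : (termMeaning φ (TD.mk t ht)).1 = t.eval (.ofAsg φ) .nil :=
  termMeaning_val φ _

theorem termMeaning_lam (φ : (termApp K).Assignment) {i j k : ℕ} (y : FVar B) {β : Ty B}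
    (t : Tm K [y.ty] β) (ht : t.LevelLE i) (ht' : (t.inst (.fvar y)).LevelLE j) (hy : y ∉ t.fv)
    (d : TD K y.label y.ty) (d' : TD K k y.ty) (hd : d'.1 = d.1) :
    (termMeaning φ (TD.mk (i := i) (.lam y.ok t) ht)).1.app d'.1 =
      (termMeaning ((termApp K).update φ y d) (TD.mk (i := j) (t.inst (.fvar y)) ht')).1 := by
  refine (congrArg (fun q => NF.app q d'.1) (termMeaning_mk_val φ (.lam y.ok t) ht)).trans ?_
  rw [termMeaning_mk_val, QSub.ofAsg_update, Tm.eval_lam_app, Tm.eval_inst, Tm.eval_fvar,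
    QSub.upd_f_self, hd]
  exact Tm.eval_upd t hy _ _ _

/-- The condition on abstractions is β. Uniqueness is extensionality at the type of y, for which
arguments of level `y.label` suffice. -/
theorem termMeaning_isMeaning : IsMeaning (termApp K) (fun φ => termMeaning φ) where
  level φ i j h β t ht := TD.ext ((termMeaning_mk_val φ t _).trans (termMeaning_mk_val φ t ht).symm)
  con φ τ hτ i c := TD.ext ((termMeaning_val φ _).trans (NF.sub_con _ ⟨τ, i, c⟩ hτ))
  log φ τ c := TD.ext (termMeaning_val φ _)
  var φ x := TD.ext ((termMeaning_val φ _).trans (NF.sub_var _ x))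
  inc φ i α β e t ht := TD.ext (by
    rw [termApp_inc_val, termMeaning_mk_val]
    exact termMeaning_mk_val φ (.inc e t) ht)
  app φ i α β t s ht hs := TD.ext (by
    rw [termApp_app_val, termMeaning_mk_val, termMeaning_mk_val]
    exact termMeaning_mk_val φ (.app t s) ⟨ht, hs⟩)
  lam φ i y hy β t ht hyt d :=
    TD.ext ((termApp_app_val _ _).trans (termMeaning_lam φ y t ht _ hyt d _ rfl))
  lam_unique φ y β t ht hyt e he := by
    refine TD.ext (NF.ext_of_lev y.ok y.label fun d hd => ?_)
    have h := congrArg Subtype.val (he (.of d hd))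
    exact ((termApp_app_val e (.of d hd)).symm.trans h).trans
      (termMeaning_lam φ y t ht _ hyt (.of d hd) (.of d hd) rfl).symm

end TermModel

/-! ### Instances of program clauses -/

section Instances

variable {B : Type u} {K : Ty B → ℕ → Type v}

/-- `M` is an instance of a clause in the elaboration of `D`. -/
inductive Inst {i : ℕ} : TD K i Ty.p → TD K i Ty.p → Prop
  | rigid (x : TD K i Ty.r) : Inst ((termApp K).rigidP x) ((termApp K).rigidP x)
  | imp (G : TD K i Ty.g) (x : TD K i Ty.r) :
      Inst ((termApp K).impP G x) ((termApp K).impP G x)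
  | left {D₁ M : TD K i Ty.p} (D₂ : TD K i Ty.p) : Inst D₁ M → Inst ((termApp K).andP D₁ D₂) M
  | right {D₂ M : TD K i Ty.p} (D₁ : TD K i Ty.p) : Inst D₂ M → Inst ((termApp K).andP D₁ D₂) M
  | pi {α : Ty B} (hα : VarTy α) (f : TD K i (α ⇾ Ty.p)) (t : TD K i α) {M : TD K i Ty.p} :
      Inst ((termApp K).app f t) M → Inst ((termApp K).piP hα f) M

theorem Inst.isMatrix {i : ℕ} {D M : TD K i Ty.p} (h : Inst D M) : IsMatrix M := by
  induction h with
  | rigid x => exact Or.inl ⟨x, rfl⟩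
  | imp G x => exact Or.inr ⟨G, x, rfl⟩
  | left _ _ ih => exact ih
  | right _ _ ih => exact ih
  | pi _ _ _ _ ih => exact ih

theorem Inst.map {i : ℕ} {D M : TD K i Ty.p} (h : Inst D M) {F : QSub K} {j : ℕ}
    (hF : F.Bdd i j) : Inst (D.map F hF) (M.map F hF) := by
  induction h with
  | rigid x => rw [TD.map_rigidP]; exact .rigid _
  | imp G x => rw [TD.map_impP]; exact .imp _ _
  | left _ _ ih => rw [TD.map_andP]; exact .left _ ih
  | right _ _ ih => rw [TD.map_andP]; exact .right _ ih
  | pi hα f t _ ih => rw [TD.map_piP]; rw [TD.map_app] at ih; exact .pi hα _ _ ih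

theorem Inst.and_iff {i : ℕ} {D₁ D₂ M : TD K i Ty.p} :
    Inst ((termApp K).andP D₁ D₂) M ↔ Inst D₁ M ∨ Inst D₂ M := by
  refine ⟨fun h => ?_, fun h => h.elim (.left _) (.right _)⟩
  generalize e : (termApp K).andP D₁ D₂ = D at h
  have e' := congrArg TD.shapeP e
  cases h with
  | rigid x => simp at e'
  | imp G x => simp at e'
  | left _ h =>
    simp only [TD.shapeP_and, ShapeP.and.injEq] at e'
    exact Or.inl ((TD.ext e'.1 : D₁ = _) ▸ h)
  | right _ h =>
    simp only [TD.shapeP_and, ShapeP.and.injEq] at e'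
    exact Or.inr ((TD.ext e'.2 : D₂ = _) ▸ h)
  | pi => simp at e'

theorem not_inst_top {i : ℕ} {M : TD K i Ty.p} : ¬ Inst ((termApp K).topP i) M := by
  intro h
  generalize e : (termApp K).topP i = D at h
  have e' := congrArg TD.shapeP e
  cases h <;> simp at e'

/-- Instantiating a quantified variable after a substitution is the same as opening the quantifier
by a fresh X and then updating the substitution at X. -/
theorem TD.map_upd_app_var {i j : ℕ} {F : QSub K} (h : F.Bdd i j) {β : Ty B} {X : FVar B}
    (hX : X.label ≤ i) {f : TD K i (X.ty ⇾ β)} (hf : X ∉ f.fv) (t : TD K j X.ty)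
    (h' : (F.upd X t.1).Bdd i j) :
    ((termApp K).app f ((termApp K).lift hX (TD.var X))).map (F.upd X t.1) h' =
      (termApp K).app (f.map F h) t := by
  refine TD.ext ?_
  rw [TD.map_val, termApp_app_val, termApp_app_val, NF.sub_app, termApp_lift_val hX, TD.var_val,
    NF.sub_var, QSub.upd_f_self, NF.sub_upd_of_notMem hf, TD.map_val]

theorem ClauseInst.eq_of_ne {i : ℕ} {C M : TD K i Ty.p} {ts : List (Σ α : Ty B, TD K i α)}
    (h : ClauseInst C ts M)
    (hC : ∀ (α : Ty B) (hα : VarTy α) (f : TD K i (α ⇾ Ty.p)), C ≠ (termApp K).piP hα f) :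
    M = C := by
  cases h with
  | nil => rfl
  | cons hα f t h => exact (hC _ hα f rfl).elim

theorem IsMatrix.ne_pi {i : ℕ} {M : TD K i Ty.p} (h : IsMatrix M) {α : Ty B} (hα : VarTy α)
    (f : TD K i (α ⇾ Ty.p)) : M ≠ (termApp K).piP hα f := by
  intro e
  have e' := congrArg TD.shapeP e
  rcases h with ⟨x, rfl⟩ | ⟨G, x, rfl⟩ <;> simp at e'

theorem ClauseInst.exists_of_pi {i : ℕ} {α : Ty B} {hα : VarTy α} {f : TD K i (α ⇾ Ty.p)}
    {M : TD K i Ty.p} {ts : List (Σ α : Ty B, TD K i α)}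
    (h : ClauseInst ((termApp K).piP hα f) ts M) (hM : IsMatrix M) :
    ∃ t ts', ClauseInst ((termApp K).app f t) ts' M := by
  generalize e : (termApp K).piP hα f = D at h
  cases h with
  | nil => exact (hM.ne_pi hα f e.symm).elim
  | cons hα' f' t h =>
    have e' := congrArg TD.shapeP e
    simp only [TD.shapeP_pi, ShapeP.pi.injEq] at e'
    obtain ⟨rfl, e'⟩ := e'
    exact ⟨t, _, (TD.ext (eq_of_heq e') : f = f') ▸ h⟩

/-- The claim is made for all images under substitutions because elaboration opens ∀ with a variable
X: the term instantiating the quantifier enters by updating F at X. -/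
theorem Elab.inst {i : ℕ} {D C : TD K i Ty.p} (h : Elab D C) : ∀ {j : ℕ} {F : QSub K}
    (hF : F.Bdd i j) {ts : List (Σ α : Ty B, TD K j α)} {M : TD K j Ty.p},
    ClauseInst (C.map F hF) ts M → IsMatrix M → Inst (D.map F hF) M := by
  induction h with
  | atom x =>
    intro j F hF ts M h _
    rw [TD.map_rigidP] at h ⊢
    rw [h.eq_of_ne fun α hα f => IsMatrix.ne_pi (Or.inl ⟨_, rfl⟩) hα f]
    exact .rigid _
  | imp G x =>
    intro j F hF ts M h _
    rw [TD.map_impP] at h ⊢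
    rw [h.eq_of_ne fun α hα f => IsMatrix.ne_pi (Or.inr ⟨_, _, rfl⟩) hα f]
    exact .imp _ _
  | left _ _ ih =>
    intro j F hF ts M h hM
    rw [TD.map_andP]
    exact .left _ (ih hF h hM)
  | right _ _ ih =>
    intro j F hF ts M h hM
    rw [TD.map_andP]
    exact .right _ (ih hF h hM)
  | all X hX f f' hf hf' _ ih =>
    intro j F hF ts M h hM
    rw [TD.map_piP] at h ⊢
    obtain ⟨t, ts', h⟩ := h.exists_of_pi hM
    have hF' : (F.upd X t.1).Bdd i j := hF.upd t.2
    rw [← TD.map_upd_app_var hF hX hf' t hF'] at h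
    refine .pi _ _ t ?_
    rw [← TD.map_upd_app_var hF hX hf t hF']
    exact ih hF' h hM

theorem Elab.inst_self {i : ℕ} {D C : TD K i Ty.p} (h : Elab D C)
    {ts : List (Σ α : Ty B, TD K i α)} {M : TD K i Ty.p} (hC : ClauseInst C ts M)
    (hM : IsMatrix M) : Inst D M := by
  have := h.inst (QSub.id_bdd le_rfl) (ts := ts) (M := M) (by rwa [TD.map_id]) hM
  rwa [TD.map_id] at this

/-- A lifting lemma: open each quantifier of D₀ by a fresh variable and let F' send that variable to
the term used in the given instance. Freshness relative to A keeps F' equal to F there. -/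
theorem Inst.exists_generic {j : ℕ} {D M : TD K j Ty.p} (h : Inst D M) : ∀ {i : ℕ}
    (D₀ : TD K i Ty.p) {F : QSub K} (hF : F.Bdd i j), D₀.map F hF = D →
    ∀ {A : Set (FVar B)}, A.Finite → ∃ (F' : QSub K) (hF' : F'.Bdd i j) (M₀ : TD K i Ty.p),
      Inst D₀ M₀ ∧ M₀.map F' hF' = M ∧ F'.c = F.c ∧ ∀ x ∈ A, F'.f x = F.f x := by
  induction h with
  | rigid x =>
    intro i D₀ F hF e A hA
    obtain ⟨x₀, rfl, rfl⟩ := TD.eq_rigidP_of_map e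
    exact ⟨F, hF, _, .rigid _, TD.map_rigidP _ _, rfl, fun _ _ => rfl⟩
  | imp G x =>
    intro i D₀ F hF e A hA
    obtain ⟨G₀, x₀, rfl, rfl, rfl⟩ := TD.eq_impP_of_map e
    exact ⟨F, hF, _, .imp _ _, TD.map_impP _ _ _, rfl, fun _ _ => rfl⟩
  | left _ _ ih =>
    intro i D₀ F hF e A hA
    obtain ⟨E₁, E₂, rfl, e₁, rfl⟩ := TD.eq_andP_of_map e
    obtain ⟨F', hF', M₀, h, h'⟩ := ih E₁ hF e₁ hA
    exact ⟨F', hF', M₀, .left _ h, h'⟩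
  | right _ _ ih =>
    intro i D₀ F hF e A hA
    obtain ⟨E₁, E₂, rfl, rfl, e₂⟩ := TD.eq_andP_of_map e
    obtain ⟨F', hF', M₀, h, h'⟩ := ih E₂ hF e₂ hA
    exact ⟨F', hF', M₀, .right _ h, h'⟩
  | pi hα f t _ ih =>
    rename_i α M _
    intro i D₀ F hF e A hA
    obtain ⟨f₀, rfl, rfl⟩ := TD.eq_piP_of_map e
    obtain ⟨n, hn⟩ := exists_fresh hα i (hA.union f₀.1.fv_finite)
    rw [Set.mem_union, not_or] at hn
    have hF' : (F.upd ⟨α, hα, i, n⟩ t.1).Bdd i j := hF.upd t.2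
    obtain ⟨F', hF', M₀, h, h', hc, hf⟩ := ih
      ((termApp K).app f₀ ((termApp K).lift le_rfl (TD.var ⟨α, hα, i, n⟩))) hF'
      (TD.map_upd_app_var hF (X := ⟨α, hα, i, n⟩) le_rfl hn.2 t hF') hA
    refine ⟨F', hF', M₀, .pi hα _ _ h, h', hc, fun x hx => ?_⟩
    rw [hf x hx, QSub.upd_f_ne]
    rintro rfl
    exact hn.1 hx

/-- Inclusion of extensions is preserved by substitutions. -/
theorem Inst.map_mono {i j : ℕ} {P P' : TD K i Ty.p} (h : ∀ M, Inst P M → Inst P' M)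
    {F : QSub K} (hF : F.Bdd i j) {M : TD K j Ty.p} (hM : Inst (P.map F hF) M) :
    Inst (P'.map F hF) M := by
  -- The variables of P' are avoided, so that F' and F agree on P'.
  obtain ⟨F', hF', M₀, h₀, rfl, hc, hf⟩ := hM.exists_generic P hF rfl P'.1.fv_finite
  have := (h M₀ h₀).map hF'
  rwa [show P'.map F' hF' = P'.map F hF from TD.ext (NF.sub_congr _ hf hc)] at this

/-! #### Fresh variants of clauses -/

open Classical in
/-- `θ[d/z]`. -/
noncomputable def Sub.upd (θ : Sub K) (z : FVar B) (d : TD K z.label z.ty) : Sub K where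
  toFun := (termApp K).update θ.toFun z d
  finite_support := by
    refine (θ.finite_support.union (Set.finite_singleton z)).subset fun x hx => ?_
    by_cases h : x = z
    · exact Or.inr h
    · refine Or.inl fun h' => hx ?_
      rw [← h']
      exact Function.update_of_ne h ..

theorem Sub.ofAsg_upd (θ : Sub K) (z : FVar B) (d : TD K z.label z.ty) :
    QSub.ofAsg (θ.upd z d).toFun = (QSub.ofAsg θ.toFun).upd z d.1 :=
  QSub.ofAsg_update _ _ _

theorem Sub.upd_ne (θ : Sub K) (z : FVar B) (d : TD K z.label z.ty) {x : FVar B} (h : x ≠ z) :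
    (θ.upd z d).toFun x = θ.toFun x := by
  classical
  exact Function.update_of_ne h ..

theorem TD.sub_upd_app_var {i : ℕ} {X : FVar B} (hX : X.label ≤ i) {β : Ty B}
    {f : TD K i (X.ty ⇾ β)} (hf : X ∉ f.fv) (θ : Sub K) (t : TD K X.label X.ty) :
    ((termApp K).app f ((termApp K).lift hX (TD.var X))).sub (θ.upd X t) =
      (termApp K).app (f.sub θ) ((termApp K).lift hX t) := by
  refine TD.ext ?_
  rw [TD.sub_val, Sub.ofAsg_upd, termApp_app_val, termApp_app_val, NF.sub_app, termApp_lift_val hX,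
    TD.var_val, NF.sub_var, QSub.upd_f_self, NF.sub_upd_of_notMem hf, TD.sub_val,
    termApp_lift_val hX]

/-- The lifting lemma in the form resolution uses: an elaborated clause, renamed by distinct fresh
variables, with a legal substitution producing the instance. The substitution θ₀ is there for the
induction, since under ∀ the body is already instantiated. The last conjunct serves `extension_eq`.
-/
theorem Inst.exists_clause {i : ℕ} {D M : TD K i Ty.p} (h : Inst D M) :
    ∀ (D₀ : TD K i Ty.p) (θ₀ : Sub K), D₀.sub θ₀ = D → ∀ {A : Set (FVar B)}, A.Finite →
      ∃ (C : TD K i Ty.p) (ws : List {x : FVar B // x.label ≤ i}) (M' : TD K i Ty.p) (θ : Sub K),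
        Elab D₀ C ∧ ClauseInst C (varList ws) M' ∧ ws.Nodup ∧ (∀ w ∈ ws, w.1 ∉ A) ∧
        (∀ x, (∀ w ∈ ws, w.1 ≠ x) → θ.toFun x = θ₀.toFun x) ∧ M'.sub θ = M ∧
        ∃ ts, ClauseInst (C.sub θ₀) ts M := by
  induction h with
  | rigid x =>
    intro D₀ θ₀ e A hA
    rw [TD.sub_eq_map] at e
    obtain ⟨x₀, rfl, rfl⟩ := TD.eq_rigidP_of_map e
    rw [← TD.map_rigidP, ← TD.sub_eq_map]
    exact ⟨_, [], _, θ₀, .atom _, .nil _, List.nodup_nil, by simp, fun _ _ => rfl, rfl, [], .nil _⟩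
  | imp G x =>
    intro D₀ θ₀ e A hA
    rw [TD.sub_eq_map] at e
    obtain ⟨G₀, x₀, rfl, rfl, rfl⟩ := TD.eq_impP_of_map e
    rw [← TD.map_impP, ← TD.sub_eq_map]
    exact ⟨_, [], _, θ₀, .imp _ _, .nil _, List.nodup_nil, by simp, fun _ _ => rfl, rfl, [], .nil _⟩
  | left _ _ ih =>
    intro D₀ θ₀ e A hA
    rw [TD.sub_eq_map] at e
    obtain ⟨E₁, E₂, rfl, e₁, rfl⟩ := TD.eq_andP_of_map e
    rw [← TD.sub_eq_map] at e₁
    obtain ⟨C, ws, M', θ, h, h'⟩ := ih E₁ θ₀ e₁ hA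
    exact ⟨C, ws, M', θ, .left _ h, h'⟩
  | right _ _ ih =>
    intro D₀ θ₀ e A hA
    rw [TD.sub_eq_map] at e
    obtain ⟨E₁, E₂, rfl, rfl, e₂⟩ := TD.eq_andP_of_map e
    rw [← TD.sub_eq_map] at e₂
    obtain ⟨C, ws, M', θ, h, h'⟩ := ih E₂ θ₀ e₂ hA
    exact ⟨C, ws, M', θ, .right _ h, h'⟩
  | pi hα f t _ ih =>
    rename_i α M _
    intro D₀ θ₀ e A hA
    rw [TD.sub_eq_map] at e
    obtain ⟨f₀, rfl, rfl⟩ := TD.eq_piP_of_map e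
    rw [← TD.sub_eq_map] at ih
    obtain ⟨n, hn⟩ := exists_fresh hα i (hA.union f₀.1.fv_finite)
    rw [Set.mem_union, not_or] at hn
    -- The new variable joins the set to be avoided, so that the later ones are distinct from it.
    obtain ⟨C₀, ws, M', θ, hE, hC, hnd, hws, hθ, hM, ts, hts⟩ := ih
      ((termApp K).app f₀ ((termApp K).lift le_rfl (TD.var ⟨α, hα, i, n⟩)))
      (θ₀.upd ⟨α, hα, i, n⟩ t) (TD.sub_upd_app_var (X := ⟨α, hα, i, n⟩) le_rfl hn.2 θ₀ t)
      (A := insert ⟨α, hα, i, n⟩ A) (hA.insert _)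
    -- Elaboration of the opened body yields a clause in the fresh variable; abstracting that
    -- variable gives the body of the quantified clause.
    have hCf : C₀ = (termApp K).app (TD.of (C₀.1.abs ⟨α, hα, i, n⟩) (NF.Lev.abs _ C₀.2))
        ((termApp K).lift le_rfl (TD.var ⟨α, hα, i, n⟩)) :=
      TD.ext ((termApp_app_val (α := α) _ _).trans (NF.abs_app_var ⟨α, hα, i, n⟩ C₀.1)).symm
    obtain ⟨f₀', hf₀', hfr⟩ : ∃ f₀' : TD K i (α ⇾ Ty.p), C₀ = (termApp K).app f₀'
        ((termApp K).lift le_rfl (TD.var ⟨α, hα, i, n⟩)) ∧ (⟨α, hα, i, n⟩ : FVar B) ∉ f₀'.fv :=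
      ⟨_, hCf, NF.notMem_fv_abs ⟨α, hα, i, n⟩ C₀.1⟩
    clear hCf
    subst hf₀'
    rw [TD.sub_upd_app_var (X := ⟨α, hα, i, n⟩) le_rfl hfr θ₀ t] at hts
    refine ⟨(termApp K).piP hα f₀', ⟨⟨α, hα, i, n⟩, le_rfl⟩ :: ws, M', θ,
      .all ⟨α, hα, i, n⟩ le_rfl f₀ f₀' hn.2 hfr hE, .cons hα f₀' _ hC, ?_, ?_, ?_, hM,
      ⟨α, t⟩ :: ts, ?_⟩
    · exact List.nodup_cons.2 ⟨fun h => hws _ h (Set.mem_insert _ _), hnd⟩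
    · intro w hw
      rcases List.mem_cons.1 hw with rfl | hw
      · exact hn.1
      · exact fun h => hws w hw (Set.mem_insert_of_mem _ h)
    · intro x hx
      rw [hθ x fun w hw => hx w (List.mem_cons_of_mem _ hw), Sub.upd_ne]
      exact (hx _ List.mem_cons_self).symm
    · rw [TD.sub_eq_map, TD.map_piP, ← TD.sub_eq_map]
      exact .cons hα _ t hts

/-- Elaborating first and instantiating afterwards yields the same matrices as unfolding
conjunctions and quantifiers together; the latter has the simpler induction. -/
theorem extension_eq {i : ℕ} (D : TD K i Ty.p) : extension D = {M | Inst D M} := by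
  ext M
  constructor
  · rintro ⟨hM, C, ts, hE, hC⟩
    exact hE.inst_self hC hM
  · intro h
    have hid : ∀ D : TD K i Ty.p, D.sub Sub.id = D := fun D => TD.ext (by
      rw [TD.sub_val]; exact NF.sub_id _)
    obtain ⟨C, -, -, -, hE, -, -, -, -, -, ts, hts⟩ :=
      h.exists_clause D Sub.id (hid D) Set.finite_empty
    exact ⟨h.isMatrix, C, ts, hE, by rwa [hid] at hts⟩

end Instances

/-! ### Uniform proofs -/

section Proofs

variable {B : Type u} {K : Ty B → ℕ → Type v}

/-- Uniform proofs. -/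
inductive Prov : ∀ i : ℕ, Set (TD K i Ty.p) → TD K i Ty.g → Prop
  | top {i : ℕ} (P : Set (TD K i Ty.p)) : Prov i P ((termApp K).topG i)
  | fact {i : ℕ} {P : Set (TD K i Ty.p)} {D : TD K i Ty.p} {x : TD K i Ty.r} :
      D ∈ P → Inst D ((termApp K).rigidP x) → Prov i P ((termApp K).rigidG x)
  | backchain {i : ℕ} {P : Set (TD K i Ty.p)} {D : TD K i Ty.p} {G : TD K i Ty.g}
      {x : TD K i Ty.r} : D ∈ P → Inst D ((termApp K).impP G x) → Prov i P G →
      Prov i P ((termApp K).rigidG x)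
  | and {i : ℕ} {P : Set (TD K i Ty.p)} {G G' : TD K i Ty.g} :
      Prov i P G → Prov i P G' → Prov i P ((termApp K).andG G G')
  | or₁ {i : ℕ} {P : Set (TD K i Ty.p)} {G : TD K i Ty.g} (G' : TD K i Ty.g) :
      Prov i P G → Prov i P ((termApp K).orG G G')
  | or₂ {i : ℕ} {P : Set (TD K i Ty.p)} {G' : TD K i Ty.g} (G : TD K i Ty.g) :
      Prov i P G' → Prov i P ((termApp K).orG G G')
  | augment {i : ℕ} {P : Set (TD K i Ty.p)} {D : TD K i Ty.p} {G : TD K i Ty.g} :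
      Prov i (P ∪ {D}) G → Prov i P ((termApp K).impG D G)
  | inst {i : ℕ} {P : Set (TD K i Ty.p)} {α : Ty B} (hα : VarTy α) (f : TD K i (α ⇾ Ty.g))
      (t : TD K i α) : Prov i P ((termApp K).app f t) → Prov i P ((termApp K).sigmaG hα f)
  | generic {i : ℕ} {P : Set (TD K i Ty.p)} {α : Ty B} (hα : VarTy α) (f : TD K i (α ⇾ Ty.g)) :
      (∀ c : K α (i + 1), Prov (i + 1) ((termApp K).lift (Nat.le_succ i) '' P)
        ((termApp K).app ((termApp K).lift (Nat.le_succ i) f)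
          ((termApp K).con (Or.inl hα) c))) →
      Prov i P ((termApp K).piG hα f)

/-! ### Closure of uniform proofs under substitution -/

/-- Every admissible type has a constant of every label. -/
def HasCon (K : Ty B → ℕ → Type v) : Prop := ∀ τ : Ty B, ConTy τ → ∀ i : ℕ, Nonempty (K τ i)

/-- The substitution of constants of label `k`. -/
noncomputable def QSub.consts (hK : HasCon K) (k : ℕ) : QSub K where
  f x := .con ⟨x.ty, k, (hK x.ty (Or.inl x.ok) k).some⟩ (Or.inl x.ok)
  c s h := .con ⟨s.1, k, (hK s.1 h k).some⟩ h

/-- `F` on labels at most `i` and `G` on other labels. -/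
def QSub.ite (i : ℕ) (F G : QSub K) : QSub K where
  f x := if x.label ≤ i then F.f x else G.f x
  c s h := if s.2.1 ≤ i then F.c s h else G.c s h

theorem QSub.Bdd.ite {i j k l : ℕ} {F G : QSub K} (hF : F.Bdd i k) (hkl : k ≤ l)
    (hG : G.Bdd j l) : (QSub.ite i F G).Bdd j l := by
  constructor
  · intro x hx
    simp only [QSub.ite]
    split_ifs with h
    · exact (hF.1 x h).mono hkl
    · exact hG.1 x hx
  · intro s hs hx
    simp only [QSub.ite]
    split_ifs with h
    · exact (hF.2 s hs h).mono hkl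
    · exact hG.2 s hs hx

theorem NF.Lev.sub_ite {i : ℕ} {β : Ty B} {q : NF K β} (hq : q.Lev i) (F G : QSub K) :
    q.sub (.ite i F G) = q.sub F :=
  hq.sub_congr (fun x hx => by simp [QSub.ite, hx]) fun s h hs => by simp [QSub.ite, hs]

theorem TD.map_con_val {i j : ℕ} {F : QSub K} (h : F.Bdd i j) {τ : Ty B} (hτ : ConTy τ)
    (c : K τ i) : (((termApp K).con hτ c).map F h).1 = F.c ⟨τ, i, c⟩ hτ :=
  NF.sub_con F ⟨τ, i, c⟩ hτ

theorem TD.image_map_lift {i j k l : ℕ} (h : i ≤ j) {F G : QSub K} (hF : F.Bdd i k)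
    (hG : G.Bdd j l) (hkl : k ≤ l) {β : Ty B} (P : Set (TD K i β))
    (e : ∀ q ∈ P, q.1.sub G = q.1.sub F) :
    TD.map G hG '' ((termApp K).lift h '' P) = (termApp K).lift hkl '' (TD.map F hF '' P) := by
  rw [Set.image_image, Set.image_image]
  refine Set.image_congr fun q hq => TD.ext ?_
  exact e q hq

-- A constant c of label i+1 cannot occur in P or f, which have level i, so it behaves like a
-- variable. Extend F by sending c to t: the program and f are transformed as by F, and the generic
-- element becomes t. The target level l is left free so that it can be raised or kept.
open Classical in
theorem Prov.map_generic (hK : HasCon K) {i k l : ℕ} {P : Set (TD K i Ty.p)} {α : Ty B}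
    (hα : VarTy α) {f : TD K i (α ⇾ Ty.g)} (c : K α (i + 1))
    (h : ∀ {j : ℕ} {F : QSub K} (hF : F.Bdd (i + 1) j),
      Prov j (TD.map F hF '' ((termApp K).lift (Nat.le_succ i) '' P))
        (((termApp K).app ((termApp K).lift (Nat.le_succ i) f)
          ((termApp K).con (Or.inl hα) c)).map F hF))
    {F : QSub K} (hF : F.Bdd i k) (hkl : k ≤ l) (t : TD K l α) :
    Prov l ((termApp K).lift hkl '' (TD.map F hF '' P))
      ((termApp K).app ((termApp K).lift hkl (f.map F hF)) t) := by
  -- G matters only at label i+1. Apart from c, symbols of that label go to constants of label 0,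
  -- which are available at every level.
  let G : QSub K := ⟨(QSub.consts hK 0).f,
    Function.update (QSub.consts hK 0).c ⟨α, i + 1, c⟩ fun _ => t.1⟩
  have hG : G.Bdd (i + 1) l := by
    refine ⟨fun x hx => .con _ _ (Nat.zero_le l), fun s hs hx => ?_⟩
    by_cases e : s = ⟨α, i + 1, c⟩
    · subst e
      simp only [G, Function.update_self]
      exact t.2
    · simp only [G, Function.update_of_ne e]
      exact .con _ _ (Nat.zero_le l)
  have hF' : (QSub.ite i F G).Bdd (i + 1) l := hF.ite hkl hG
  have := h hF'
  rw [TD.image_map_lift (Nat.le_succ i) hF hF' hkl P fun q _ => NF.Lev.sub_ite q.2 _ _,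
    TD.map_app] at this
  convert this using 2
  · exact TD.ext (NF.Lev.sub_ite f.2 _ _).symm
  · refine TD.ext (Eq.trans ?_ (TD.map_con_val hF' (Or.inl hα) c).symm)
    simp [QSub.ite, G]

/-- Instances are stable under substitution, so all rules are. For ∀ the induction hypothesis must
cover all substitutions, because the constant introduced upstairs has to be replaced by each
constant demanded downstairs. -/
theorem Prov.map (hK : HasCon K) {i : ℕ} {P : Set (TD K i Ty.p)} {G : TD K i Ty.g}
    (h : Prov i P G) : ∀ {j : ℕ} {F : QSub K} (hF : F.Bdd i j),
    Prov j (TD.map F hF '' P) (G.map F hF) := by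
  induction h with
  | top P => intro j F hF; rw [TD.map_topG]; exact .top _
  | fact hD h =>
    intro j F hF
    rw [TD.map_rigidG]
    have := h.map hF
    rw [TD.map_rigidP] at this
    exact .fact (Set.mem_image_of_mem _ hD) this
  | backchain hD h _ ih =>
    intro j F hF
    rw [TD.map_rigidG]
    have := h.map hF
    rw [TD.map_impP] at this
    exact .backchain (Set.mem_image_of_mem _ hD) this (ih hF)
  | and _ _ ih ih' => intro j F hF; rw [TD.map_andG]; exact .and (ih hF) (ih' hF)
  | or₁ _ _ ih => intro j F hF; rw [TD.map_orG]; exact .or₁ _ (ih hF)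
  | or₂ _ _ ih => intro j F hF; rw [TD.map_orG]; exact .or₂ _ (ih hF)
  | augment _ ih =>
    intro j F hF
    rw [TD.map_impG]
    have := ih hF
    rw [Set.image_union, Set.image_singleton] at this
    exact .augment this
  | inst hα f t _ ih =>
    intro j F hF
    rw [TD.map_sigmaG]
    have := ih hF
    rw [TD.map_app] at this
    exact .inst hα _ _ this
  | @generic i P α hα f _ ih =>
    intro j F hF
    rw [TD.map_piG]
    exact .generic hα _ fun c =>
      Prov.map_generic hK hα _ (ih (hK α (Or.inl hα) (i + 1)).some) hF (Nat.le_succ j) _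

theorem Prov.map_single (hK : HasCon K) {i : ℕ} {D : TD K i Ty.p} {G : TD K i Ty.g}
    (h : Prov i {D} G) {j : ℕ} {F : QSub K} (hF : F.Bdd i j) :
    Prov j {D.map F hF} (G.map F hF) := by
  have := h.map hK hF
  rwa [Set.image_singleton] at this

/-- The instances are compared at every level j ≥ i because the rule for ∀ raises the level, where
more instances exist. -/
theorem Prov.mono {i : ℕ} {P : Set (TD K i Ty.p)} {G : TD K i Ty.g} (h : Prov i P G) :
    ∀ {P' : Set (TD K i Ty.p)}, (∀ D ∈ P, ∀ (j : ℕ) (hj : i ≤ j) (M : TD K j Ty.p),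
      Inst ((termApp K).lift hj D) M → ∃ D' ∈ P', Inst ((termApp K).lift hj D') M) →
    Prov i P' G := by
  induction h with
  | top P => exact fun _ => .top _
  | fact hD h =>
    intro P' H
    obtain ⟨D', hD', h'⟩ := H _ hD _ le_rfl _ h
    exact .fact hD' h'
  | backchain hD h _ ih =>
    intro P' H
    obtain ⟨D', hD', h'⟩ := H _ hD _ le_rfl _ h
    exact .backchain hD' h' (ih H)
  | and _ _ ih ih' => exact fun H => .and (ih H) (ih' H)
  | or₁ _ _ ih => exact fun H => .or₁ _ (ih H)
  | or₂ _ _ ih => exact fun H => .or₂ _ (ih H)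
  | augment _ ih =>
    intro P' H
    refine .augment (ih ?_)
    rintro D (hD | hD) j hj M hM
    · obtain ⟨D', hD', h'⟩ := H D hD j hj M hM
      exact ⟨D', Or.inl hD', h'⟩
    · exact ⟨D, Or.inr hD, hM⟩
  | inst hα f t _ ih => exact fun H => .inst hα _ _ (ih H)
  | generic hα f _ ih =>
    intro P' H
    refine .generic hα _ fun c => ih c ?_
    rintro _ ⟨D, hD, rfl⟩ j hj M hM
    obtain ⟨D', hD', h'⟩ := H D hD j (Nat.le_of_succ_le hj) M hM
    exact ⟨_, Set.mem_image_of_mem _ hD', h'⟩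

/-! #### Inversion -/

section Inversion

variable {i : ℕ} {P : Set (TD K i Ty.p)}

/-- The logical form of a goal is invariant under conversion and leaves only one rule that can have
been applied last; the following inversions use the same argument. -/
theorem Prov.and_iff {G G' : TD K i Ty.g} :
    Prov i P ((termApp K).andG G G') ↔ Prov i P G ∧ Prov i P G' := by
  refine ⟨fun h => ?_, fun h => .and h.1 h.2⟩
  generalize e : (termApp K).andG G G' = X at h
  have e' := congrArg TD.shapeG e
  cases h with
  | and h h' =>
    simp only [TD.shapeG_and, ShapeG.and.injEq] at e'
    obtain rfl := TD.ext e'.1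
    obtain rfl := TD.ext e'.2
    exact ⟨h, h'⟩
  | _ => simp at e'

theorem Prov.or_iff {G G' : TD K i Ty.g} :
    Prov i P ((termApp K).orG G G') ↔ Prov i P G ∨ Prov i P G' := by
  refine ⟨fun h => ?_, fun h => h.elim (.or₁ _) (.or₂ _)⟩
  generalize e : (termApp K).orG G G' = X at h
  have e' := congrArg TD.shapeG e
  cases h with
  | or₁ _ h =>
    simp only [TD.shapeG_or, ShapeG.or.injEq] at e'
    obtain rfl := TD.ext e'.1
    exact Or.inl h
  | or₂ _ h =>
    simp only [TD.shapeG_or, ShapeG.or.injEq] at e'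
    obtain rfl := TD.ext e'.2
    exact Or.inr h
  | _ => simp at e'

theorem Prov.imp_iff {D : TD K i Ty.p} {G : TD K i Ty.g} :
    Prov i P ((termApp K).impG D G) ↔ Prov i (P ∪ {D}) G := by
  refine ⟨fun h => ?_, .augment⟩
  generalize e : (termApp K).impG D G = X at h
  have e' := congrArg TD.shapeG e
  cases h with
  | augment h =>
    simp only [TD.shapeG_imp, ShapeG.imp.injEq] at e'
    obtain rfl := TD.ext e'.1
    obtain rfl := TD.ext e'.2
    exact h
  | _ => simp at e'

theorem Prov.sigma_iff {α : Ty B} {hα : VarTy α} {f : TD K i (α ⇾ Ty.g)} :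
    Prov i P ((termApp K).sigmaG hα f) ↔ ∃ t, Prov i P ((termApp K).app f t) := by
  refine ⟨fun h => ?_, fun ⟨t, h⟩ => .inst _ _ t h⟩
  generalize e : (termApp K).sigmaG hα f = X at h
  have e' := congrArg TD.shapeG e
  cases h with
  | inst _ _ t h =>
    simp only [TD.shapeG_sigma, ShapeG.sigma.injEq] at e'
    obtain ⟨rfl, e'⟩ := e'
    obtain rfl := TD.ext (eq_of_heq e')
    exact ⟨t, h⟩
  | _ => simp at e'

theorem Prov.con_of_pi {α : Ty B} {hα : VarTy α} {f : TD K i (α ⇾ Ty.g)}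
    (h : Prov i P ((termApp K).piG hα f)) (c : K α (i + 1)) :
    Prov (i + 1) ((termApp K).lift (Nat.le_succ i) '' P)
      ((termApp K).app ((termApp K).lift (Nat.le_succ i) f)
        ((termApp K).con (Or.inl hα) c)) := by
  generalize e : (termApp K).piG hα f = X at h
  have e' := congrArg TD.shapeG e
  cases h with
  | generic _ _ h =>
    simp only [TD.shapeG_pi, ShapeG.pi.injEq] at e'
    obtain ⟨rfl, e'⟩ := e'
    obtain rfl := TD.ext (eq_of_heq e')
    exact h c
  | _ => simp at e'

end Inversion

/-! ### Interchangeable generic elements for ∀ -/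

theorem TD.image_map_id {i : ℕ} {β : Ty B} (P : Set (TD K i β)) :
    TD.map (.id K) (QSub.id_bdd le_rfl) '' P = P := by
  conv_rhs => rw [← Set.image_id P]
  exact Set.image_congr fun q _ => TD.map_id q

/-- One constant of label i+1 is enough, because it can be replaced by any other. This matches the
single constant of a resolution step with the rule of `Prov`. -/
theorem Prov.pi_of_con (hK : HasCon K) {i : ℕ} {P : Set (TD K i Ty.p)} {α : Ty B}
    (hα : VarTy α) {f : TD K i (α ⇾ Ty.g)} (c : K α (i + 1))
    (h : Prov (i + 1) ((termApp K).lift (Nat.le_succ i) '' P)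
      ((termApp K).app ((termApp K).lift (Nat.le_succ i) f) ((termApp K).con (Or.inl hα) c))) :
    Prov i P ((termApp K).piG hα f) := by
  refine .generic hα _ fun c' => ?_
  have := Prov.map_generic hK hα c (h.map hK) (QSub.id_bdd le_rfl) (Nat.le_succ i)
    ((termApp K).con (Or.inl hα) c')
  rwa [TD.image_map_id, TD.map_id] at this

/-- Replacing the generic constant by t also removes the only need for level i+1, so the proof comes
back to level i. -/
theorem Prov.of_pi (hK : HasCon K) {i : ℕ} {P : Set (TD K i Ty.p)} {α : Ty B}
    {hα : VarTy α} {f : TD K i (α ⇾ Ty.g)} (h : Prov i P ((termApp K).piG hα f)) (t : TD K i α) :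
    Prov i P ((termApp K).app f t) := by
  have := Prov.map_generic hK hα _ ((h.con_of_pi (hK α (Or.inl hα) (i + 1)).some).map hK)
    (QSub.id_bdd le_rfl) le_rfl t
  rw [TD.image_map_id, TD.map_id] at this
  have hl : ∀ {β : Ty B} (q : TD K i β), (termApp K).lift le_rfl q = q := fun q => TD.ext rfl
  rw [hl] at this
  convert this using 1
  conv_lhs => rw [← Set.image_id P]
  exact Set.image_congr fun q _ => (hl q).symm

/-- A variable that occurs in neither the program nor f can be sent to any constant of label i+1,
with the level raised by one. -/
theorem Prov.pi_of_fresh (hK : HasCon K) {i : ℕ} {P : Set (TD K i Ty.p)} {x : FVar B}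
    (hx : x.label ≤ i) {f : TD K i (x.ty ⇾ Ty.g)} (hf : x ∉ f.fv) (hP : ∀ D ∈ P, x ∉ D.fv)
    (h : Prov i P ((termApp K).app f ((termApp K).lift hx (TD.var x)))) :
    Prov i P ((termApp K).piG x.ok f) := by
  refine .generic x.ok f fun c => ?_
  have hF : ((QSub.id K).upd x ((termApp K).con (Or.inl x.ok) c).1).Bdd i (i + 1) :=
    (QSub.id_bdd (Nat.le_succ i)).upd ((termApp K).con (Or.inl x.ok) _).2
  have := h.map hK hF
  rw [TD.map_upd_app_var (QSub.id_bdd (Nat.le_succ i)) hx hf _ hF] at this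
  convert this using 2
  · rename_i D hD
    refine TD.ext ?_
    rw [TD.map_val, NF.sub_upd_of_notMem (hP D hD), NF.sub_id]
  · exact TD.ext (NF.sub_id _).symm

end Proofs

/-! ### Resolution and uniform proofs -/

section ResolutionProofs

variable {B : Type u} {K : Ty B → ℕ → Type v}

theorem termMeaning_var {i : ℕ} {β : Ty B} (q : TD K i β) : termMeaning TD.var q = q :=
  TD.ext ((termMeaning_val _ q).trans (NF.sub_id _))

theorem TD.sub_ident {i : ℕ} {β : Ty B} (q : TD K i β) : q.sub Sub.id = q := termMeaning_var q

theorem termMeaning_termMeaning (φ η : (termApp K).Assignment) {i : ℕ} {β : Ty B}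
    (q : TD K i β) :
    termMeaning η (termMeaning φ q) = termMeaning (compAsg φ η) q := by
  refine TD.ext ?_
  rw [termMeaning_val, termMeaning_val, NF.sub_sub, QSub.ofAsg_comp, termMeaning_val]

theorem termMeaning_of_var (η : (termApp K).Assignment) (x : FVar B) :
    termMeaning η (TD.var x) = η x :=
  TD.ext ((termMeaning_val _ _).trans (NF.sub_var _ x))

theorem termMeaning_congr {φ η : (termApp K).Assignment} {i : ℕ} {β : Ty B} {q : TD K i β}
    (h : ∀ x ∈ q.fv, φ x = η x) : termMeaning φ q = termMeaning η q := by
  refine TD.ext ?_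
  rw [termMeaning_val, termMeaning_val]
  exact NF.sub_congr _ (fun x hx => congrArg Subtype.val (h x hx)) rfl

theorem termMeaning_eq_self {η : (termApp K).Assignment} {i : ℕ} {β : Ty B} {q : TD K i β}
    (h : ∀ x ∈ q.fv, η x = TD.var x) : termMeaning η q = q :=
  (termMeaning_congr h).trans (termMeaning_var q)

/-- The instance of the state `S` by the assignment `η` has a uniform proof. -/
def State.Holds (η : (termApp K).Assignment) (S : State K) : Prop :=
  Prov S.lvl ((fun D => termMeaning η D) '' S.prog) (termMeaning η S.goal)

theorem State.holds_mk {η : (termApp K).Assignment} {i : ℕ} {P : Set (TD K i Ty.p)}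
    {G : TD K i Ty.g} : State.Holds η ⟨i, P, G⟩ ↔
      Prov i ((fun D => termMeaning η D) '' P) (termMeaning η G) :=
  Iff.rfl

theorem State.holds_sub {η : (termApp K).Assignment} {θ : Sub K} {S : State K} :
    (S.sub θ).Holds η ↔ S.Holds (compAsg θ.toFun η) := by
  obtain ⟨i, P, G⟩ := S
  refine State.holds_mk.trans (Iff.trans ?_ State.holds_mk.symm)
  rw [Set.image_image]
  simp only [TD.sub, termMeaning_termMeaning]

/-! ### Soundness of resolution for uniform proofs -/

section Soundness

/-- Here η is the composition of the substitutions of later steps. If the new states are provable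
under η, the old one is provable under θη: unified atoms remain equal after η, and the clause used
yields an instance of the transformed program. -/
theorem RStep.sound (hK : HasCon K) {V : Set (FVar B)}
    {C : Set (Σ (τ : Ty B) (i : ℕ), K τ i)} {S : State K}
    {θ : Sub K} {W : Set (FVar B)} {T : StateVec K} (h : RStep V C S θ W T)
    (η : (termApp K).Assignment) (hT : ∀ S' ∈ T, S'.Holds η) :
    S.Holds (compAsg θ.toFun η) := by
  have hid : compAsg (Sub.id (K := K)).toFun η = η :=
    funext fun x => termMeaning_of_var η x
  cases h with
  | null i P =>
    rw [State.holds_mk, TD.termMeaning_eq_map, TD.map_topG]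
    exact .top _
  | true i P G θ _ hG _ =>
    rw [State.holds_mk, ← termMeaning_termMeaning]
    change Prov i _ (termMeaning η (G.sub θ))
    rw [hG, TD.termMeaning_eq_map, TD.map_topG]
    exact .top _
  | backchain i P x D cl ws G y θ hD hcl _ _ hC hxy =>
    have h1 := State.holds_mk.1 (State.holds_sub.1 (hT _ List.mem_cons_self))
    have h2 := (hcl.inst_self hC (Or.inr ⟨_, _, rfl⟩)).map
      (QSub.ofAsg_bdd (compAsg θ.toFun η) i)
    rw [TD.map_impP] at h2
    have h3 : termMeaning (compAsg θ.toFun η) x =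
        termMeaning (compAsg θ.toFun η) y := by
      rw [← termMeaning_termMeaning, ← termMeaning_termMeaning]
      exact congrArg _ hxy
    rw [State.holds_mk, TD.termMeaning_eq_map, TD.map_rigidG, ← TD.termMeaning_eq_map, h3]
    rw [← TD.termMeaning_eq_map, ← TD.termMeaning_eq_map, ← TD.termMeaning_eq_map] at h2
    exact .backchain (Set.mem_image_of_mem _ hD) h2 h1
  | axiom' i P x D cl ws y θ hD hcl _ _ hC hxy =>
    have h2 := (hcl.inst_self hC (Or.inl ⟨_, rfl⟩)).map
      (QSub.ofAsg_bdd (compAsg θ.toFun η) i)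
    rw [TD.map_rigidP] at h2
    have h3 : termMeaning (compAsg θ.toFun η) x =
        termMeaning (compAsg θ.toFun η) y := by
      rw [← termMeaning_termMeaning, ← termMeaning_termMeaning]
      exact congrArg _ hxy
    rw [State.holds_mk, TD.termMeaning_eq_map, TD.map_rigidG, ← TD.termMeaning_eq_map, h3]
    rw [← TD.termMeaning_eq_map, ← TD.termMeaning_eq_map] at h2
    exact .fact (Set.mem_image_of_mem _ hD) h2
  | or₁ i P G₁ G₂ =>
    rw [hid, State.holds_mk, TD.termMeaning_eq_map, TD.map_orG, ← TD.termMeaning_eq_map]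
    exact .or₁ _ (State.holds_mk.1 (hT _ List.mem_cons_self))
  | or₂ i P G₁ G₂ =>
    rw [hid, State.holds_mk, TD.termMeaning_eq_map, TD.map_orG, ← TD.termMeaning_eq_map _ G₂]
    exact .or₂ _ (State.holds_mk.1 (hT _ List.mem_cons_self))
  | and i P G₁ G₂ =>
    rw [hid, State.holds_mk, TD.termMeaning_eq_map, TD.map_andG, ← TD.termMeaning_eq_map,
      ← TD.termMeaning_eq_map]
    exact .and (hT _ List.mem_cons_self) (hT _ (List.mem_cons_of_mem _ List.mem_cons_self))
  | inst i P hα f t =>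
    have h1 := State.holds_mk.1 (hT _ List.mem_cons_self)
    rw [TD.termMeaning_eq_map, TD.map_app, ← TD.termMeaning_eq_map] at h1
    rw [hid, State.holds_mk, TD.termMeaning_eq_map, TD.map_sigmaG, ← TD.termMeaning_eq_map]
    exact .inst _ _ _ h1
  | augment i P D G =>
    have h1 := State.holds_mk.1 (hT _ List.mem_cons_self)
    rw [Set.image_union, Set.image_singleton] at h1
    rw [hid, State.holds_mk, TD.termMeaning_eq_map, TD.map_impG, ← TD.termMeaning_eq_map,
      ← TD.termMeaning_eq_map]
    exact .augment h1
  | generic i P hα f c _ =>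
    have h1 := State.holds_mk.1 (hT _ List.mem_cons_self)
    rw [hid, State.holds_mk, TD.termMeaning_eq_map, TD.map_piG, ← TD.termMeaning_eq_map]
    -- Assignments fix constants and preserve levels, so c is still a constant of label i+1 over a
    -- program and goal of level i.
    refine .pi_of_con hK hα c ?_
    rw [TD.termMeaning_eq_map, TD.map_app] at h1
    have h3 : (fun D => termMeaning η D) '' ((termApp K).lift (Nat.le_succ i) '' P) =
        (termApp K).lift (Nat.le_succ i) '' ((fun D => termMeaning η D) '' P) := by
      rw [Set.image_image, Set.image_image]
      refine Set.image_congr fun D _ => TD.ext ?_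
      exact (termMeaning_val _ _).trans (termMeaning_val η D).symm
    rw [h3] at h1
    convert h1 using 2
    · exact TD.ext (termMeaning_val _ f)
    · exact TD.ext (TD.map_con_val (QSub.ofAsg_bdd η _) (Or.inl hα) c).symm

theorem Resolves.sound (hK : HasCon K) {V : Set (FVar B)}
    {C : Set (Σ (τ : Ty B) (i : ℕ), K τ i)} {T : StateVec K} {η : (termApp K).Assignment} (h : Resolves V C T η) :
    ∀ S ∈ T, S.Holds η := by
  induction h with
  | nil => simp
  | @step V C L R S θ W T η hstep _ ih =>
    intro S' hS'
    rcases List.mem_append.1 hS' with h | h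
    · refine State.holds_sub.1 (ih _ ?_)
      exact List.mem_append_left _ (List.mem_append_left _ (List.mem_map_of_mem h))
    · rcases List.mem_cons.1 h with rfl | h
      · exact hstep.sound hK η fun S'' h'' => ih _
          (List.mem_append_left _ (List.mem_append_right _ h''))
      · exact State.holds_sub.1 (ih _ (List.mem_append_right _ (List.mem_map_of_mem h)))

/-- An identity answer fixes all free variables of the state, so its instance under the answer is
the state itself. -/
theorem ResolvesId.prov (hK : HasCon K) {S : State K}
    (h : ResolvesId S) : Prov S.lvl S.prog S.goal := by
  obtain ⟨η, h, hη⟩ := h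
  have h1 := h.sound hK S List.mem_cons_self
  have h2 : termMeaning η S.goal = S.goal :=
    termMeaning_eq_self fun x hx => hη x (Or.inr hx)
  have h3 : (fun D => termMeaning η D) '' S.prog = S.prog := by
    conv_rhs => rw [← Set.image_id S.prog]
    exact Set.image_congr fun D hD => termMeaning_eq_self fun x hx =>
      hη x (Or.inl (Set.mem_biUnion hD hx))
  change Prov _ ((fun D => termMeaning η D) '' S.prog) (termMeaning η S.goal) at h1
  rwa [h2, h3] at h1

end Soundness

/-! #### Completeness -/

theorem TD.fv_finite {i : ℕ} {β : Ty B} (q : TD K i β) : q.fv.Finite := NF.fv_finite q.1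

theorem TD.cons_finite {i : ℕ} {β : Ty B} (q : TD K i β) : q.cons.Finite :=
  (Tm.cons_finite q.rep).subset fun _ hc => hc _ q.mk_rep

theorem State.fv_finite {S : State K} (h : S.prog.Finite) : S.fv.Finite :=
  (h.biUnion fun D _ => D.fv_finite).union S.goal.fv_finite

theorem State.cons_finite {S : State K} (h : S.prog.Finite) : S.cons.Finite :=
  (h.biUnion fun D _ => D.cons_finite).union S.goal.cons_finite

theorem StateVec.fv_finite {T : StateVec K} (h : ∀ S ∈ T, S.prog.Finite) :
    (StateVec.fv T).Finite :=
  (List.finite_toSet T).biUnion fun S hS => State.fv_finite (h S hS)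

theorem StateVec.cons_finite {T : StateVec K} (h : ∀ S ∈ T, S.prog.Finite) :
    (StateVec.cons T).Finite :=
  (List.finite_toSet T).biUnion fun S hS => State.cons_finite (h S hS)

theorem Sub.occV_finite (θ : Sub K) : θ.occV.Finite :=
  θ.finite_support.union (θ.finite_support.biUnion fun x _ => (θ.toFun x).fv_finite)

theorem Sub.occC_finite (θ : Sub K) : θ.occC.Finite :=
  θ.finite_support.biUnion fun x _ => (θ.toFun x).cons_finite

theorem State.sub_eq_self {S : State K} {θ : Sub K} (h : ∀ x ∈ S.fv, θ.toFun x = TD.var x) :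
    S.sub θ = S := by
  obtain ⟨i, P, G⟩ := S
  have h1 : G.sub θ = G := termMeaning_eq_self fun x hx => h x (Or.inr hx)
  have h2 : (fun D => D.sub θ) '' P = P := by
    conv_rhs => rw [← Set.image_id P]
    exact Set.image_congr fun D hD => termMeaning_eq_self fun x hx =>
      h x (Or.inl (Set.mem_biUnion hD hx))
  rw [State.sub, h1, h2]

theorem StateVec.sub_eq_self {T : StateVec K} {θ : Sub K}
    (h : ∀ x ∈ StateVec.fv T, θ.toFun x = TD.var x) : StateVec.sub T θ = T := by
  conv_rhs => rw [← List.map_id T]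
  exact List.map_congr_left fun S hS => State.sub_eq_self fun x hx => h x (Set.mem_biUnion hS hx)

/-- The state vector resolves to the empty one with identity answer, whatever variables and
constants have been used before. -/
def Resolvable (T : StateVec K) : Prop :=
  (∀ S ∈ T, S.prog.Finite) ∧ ∀ (V : Set (FVar B)) (C : Set (Σ (τ : Ty B) (i : ℕ), K τ i)),
    V.Finite → C.Finite → StateVec.fv T ⊆ V →
      ∃ η : (termApp K).Assignment, Resolves V C T η ∧ ∀ x ∈ V, η x = TD.var x

theorem Resolvable.nil : Resolvable ([] : StateVec K) :=
  ⟨by simp, fun V C _ _ _ => ⟨_, .nil V C, fun _ _ => rfl⟩⟩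

/-- Since θ fixes all variables used before, it leaves the waiting states R alone, and the composed
answer is still the identity on V. The step must be available for every finite history V, C, because
it may occur anywhere in a derivation. -/
theorem Resolvable.step {S : State K} {R : StateVec K} (hS : S.prog.Finite)
    (hR : ∀ S' ∈ R, S'.prog.Finite)
    (h : ∀ (V : Set (FVar B)) (C : Set (Σ (τ : Ty B) (i : ℕ), K τ i)), V.Finite → C.Finite →
      S.fv ⊆ V → ∃ (θ : Sub K) (W : Set (FVar B)) (T : StateVec K), RStep V C S θ W T ∧
        W.Finite ∧ (∀ x ∈ V, θ.toFun x = TD.var x) ∧ Resolvable (T ++ R)) :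
    Resolvable (S :: R) := by
  refine ⟨fun S' h => (List.mem_cons.1 h).elim (fun e => e ▸ hS) (hR S'), fun V C hV hC hSR => ?_⟩
  have hfS : S.fv ⊆ V := fun x hx => hSR (Set.mem_biUnion List.mem_cons_self hx)
  have hfR : StateVec.fv R ⊆ V := fun x hx => by
    obtain ⟨S', hS', hx⟩ := Set.mem_iUnion₂.1 hx
    exact hSR (Set.mem_biUnion (List.mem_cons_of_mem _ hS') hx)
  obtain ⟨θ, W, T, hstep, hW, hθ, hT⟩ := h V C hV hC hfS
  have e : StateVec.sub ([] : StateVec K) θ ++ T ++ StateVec.sub R θ = T ++ R := by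
    rw [StateVec.sub_eq_self fun x hx => hθ x (hfR hx)]
    rfl
  obtain ⟨η, h1, h2⟩ := hT.2 (V ∪ W ∪ θ.occV ∪ StateVec.fv (T ++ R))
    (C ∪ θ.occC ∪ StateVec.cons (T ++ R))
    (((hV.union hW).union θ.occV_finite).union (StateVec.fv_finite hT.1))
    ((hC.union θ.occC_finite).union (StateVec.cons_finite hT.1)) Set.subset_union_right
  refine ⟨_, Resolves.step [] R hstep (by rw [e]; exact h1), fun x hx => ?_⟩
  rw [hθ x hx, termMeaning_of_var]
  exact h2 x (Or.inl (Or.inl (Or.inl hx)))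

theorem Resolvable.step_id {S : State K} {R : StateVec K} (T : StateVec K) (hS : S.prog.Finite)
    (h : ∀ (V : Set (FVar B)) (C : Set (Σ (τ : Ty B) (i : ℕ), K τ i)), RStep V C S Sub.id ∅ T)
    (hT : Resolvable (T ++ R)) : Resolvable (S :: R) :=
  .step hS (fun _ hS' => hT.1 _ (List.mem_append_right _ hS')) fun V C _ _ _ =>
    ⟨Sub.id, ∅, T, h V C, Set.finite_empty, fun _ _ => rfl, hT⟩

theorem Inst.exists_variant {i : ℕ} {D M : TD K i Ty.p} (h : Inst D M) {V : Set (FVar B)}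
    (hV : V.Finite) : ∃ (C : TD K i Ty.p) (ws : List {x : FVar B // x.label ≤ i})
      (M' : TD K i Ty.p) (θ : Sub K), Elab D C ∧ ws.Nodup ∧ (∀ w ∈ ws, w.1 ∉ V) ∧
        ClauseInst C (varList ws) M' ∧ (∀ x ∈ V, θ.toFun x = TD.var x) ∧ M'.sub θ = M := by
  obtain ⟨C, ws, M', θ, hE, hC, hnd, hws, hθ, hM, -⟩ := h.exists_clause D Sub.id D.sub_ident hV
  refine ⟨C, ws, M', θ, hE, hnd, hws, hC, fun x hx => hθ x ?_, hM⟩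
  rintro w hw rfl
  exact hws w hw hx

theorem finite_freshSet {i : ℕ} (ws : List {x : FVar B // x.label ≤ i}) :
    {w | ∃ w' ∈ ws, w'.1 = w}.Finite :=
  ((List.finite_toSet ws).image Subtype.val).subset fun _ h => h

/-- Read the proof as a derivation that always treats the first state and keeps R as continuation; a
conjunction chains the two subderivations. Finiteness of programs keeps the history finite, so fresh
variables and constants never run out. -/
theorem Prov.resolvable (hK : ∀ τ : Ty B, ConTy τ → ∀ i : ℕ, Infinite (K τ i)) {i : ℕ}
    {P : Set (TD K i Ty.p)} {G : TD K i Ty.g} (h : Prov i P G) (hP : P.Finite) :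
    ∀ {R : StateVec K}, Resolvable R → Resolvable (⟨i, P, G⟩ :: R) := by
  induction h with
  | top P => exact fun hR => .step_id [] hP (fun V C => .null _ _) hR
  | @fact i P D x hD h =>
    intro R hR
    refine .step hP hR.1 fun V C hV hC hSV => ?_
    -- The variables of x are avoided separately, so that θ fixes x without comparing them with
    -- those of the goal `rigidG x`.
    obtain ⟨cl, ws, M', θ, hE, hnd, hws, hcl, hθ, hM⟩ := h.exists_variant (hV.union x.fv_finite)
    rw [TD.sub_eq_map] at hM
    obtain ⟨y, rfl, hy⟩ := TD.eq_rigidP_of_map hM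
    refine ⟨θ, _, _, .axiom' i P x D cl ws y θ hD hE hnd (fun w hw h => hws w hw (Or.inl h)) hcl ?_,
      finite_freshSet ws, fun z hz => hθ z (Or.inl hz), hR⟩
    rw [TD.sub_eq_map y, hy]
    exact termMeaning_eq_self fun z hz => hθ z (Or.inr hz)
  | @backchain i P D G x hD h _ ih =>
    intro R hR
    refine .step hP hR.1 fun V C hV hC hSV => ?_
    obtain ⟨cl, ws, M', θ, hE, hnd, hws, hcl, hθ, hM⟩ := h.exists_variant (hV.union x.fv_finite)
    rw [TD.sub_eq_map] at hM
    obtain ⟨G', y, rfl, hG, hy⟩ := TD.eq_impP_of_map hM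
    have hS : State.sub ⟨i, P, G'⟩ θ = ⟨i, P, G⟩ := by
      rw [← TD.sub_eq_map] at hG
      have hP' : (fun D => D.sub θ) '' P = P := by
        conv_rhs => rw [← Set.image_id P]
        exact Set.image_congr fun D hD => termMeaning_eq_self fun z hz =>
          hθ z (Or.inl (hSV (Or.inl (Set.mem_biUnion hD hz))))
      rw [State.sub, hP', hG]
    refine ⟨θ, _, _, .backchain i P x D cl ws G' y θ hD hE hnd
      (fun w hw h => hws w hw (Or.inl h)) hcl ?_, finite_freshSet ws,
      fun z hz => hθ z (Or.inl hz), ?_⟩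
    · rw [TD.sub_eq_map y, hy]
      exact termMeaning_eq_self fun z hz => hθ z (Or.inr hz)
    · rw [hS]
      exact ih hP hR
  | and _ _ ih ih' =>
    exact fun hR => .step_id [_, _] hP (fun V C => .and _ _ _ _) (ih hP (ih' hP hR))
  | or₁ _ _ ih => exact fun hR => .step_id [_] hP (fun V C => .or₁ _ _ _ _) (ih hP hR)
  | or₂ _ _ ih => exact fun hR => .step_id [_] hP (fun V C => .or₂ _ _ _ _) (ih hP hR)
  | augment _ ih =>
    exact fun hR => .step_id [_] hP (fun V C => .augment _ _ _ _)
      (ih (hP.union (Set.finite_singleton _)) hR)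
  | inst hα f t _ ih => exact fun hR => .step_id [_] hP (fun V C => .inst _ _ hα f t) (ih hP hR)
  | @generic i P α hα f _ ih =>
    intro R hR
    refine .step hP hR.1 fun V C hV hC hSV => ?_
    have := hK α (Or.inl hα) (i + 1)
    have hinj : Function.Injective fun c : K α (i + 1) =>
        (⟨α, i + 1, c⟩ : Σ (τ : Ty B) (i : ℕ), K τ i) := by
      intro c c' h
      simpa using h
    obtain ⟨_, ⟨c, rfl⟩, hc⟩ := (Set.infinite_range_of_injective hinj).exists_notMem_finite hC
    exact ⟨Sub.id, ∅, [_], .generic i P hα f c hc, Set.finite_empty, fun _ _ => rfl,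
      ih c (hP.image _) hR⟩

/-- Uniform proofs are the derivations with identity answer. -/
theorem resolvesId_iff (hK : ∀ τ : Ty B, ConTy τ → ∀ i : ℕ, Infinite (K τ i)) {S : State K}
    (hS : S.prog.Finite) : ResolvesId S ↔ Prov S.lvl S.prog S.goal := by
  have hK' : HasCon K := fun τ hτ i => (hK τ hτ i).nonempty
  refine ⟨fun h => h.prov hK', fun h => ?_⟩
  have hS' : ∀ S' ∈ [S], S'.prog.Finite := by simpa using hS
  obtain ⟨η, h1, h2⟩ := (h.resolvable hK hS .nil).2 _ (StateVec.cons [S]) (StateVec.fv_finite hS')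
    (StateVec.cons_finite hS') subset_rfl
  exact ⟨η, h1, fun x hx => h2 x (Set.mem_biUnion List.mem_cons_self hx)⟩

end ResolutionProofs

/-! ### The substitution algebra -/

section SubstitutionAlgebra

variable {B : Type u} {K : Ty B → ℕ → Type v}

theorem SafeSub.sub_of_le {θ φ : SafeSub K} {γ : Sub K}
    (h : ∀ x : FVar B, φ.1.toFun x = (θ.1.toFun x).sub γ) {i : ℕ} {β : Ty B} (q : TD K i β) :
    q.sub φ.1 = (q.sub θ.1).sub γ := by
  have e : φ.1.toFun = compAsg θ.1.toFun γ.toFun := funext h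
  rw [TD.sub, TD.sub, TD.sub, termMeaning_termMeaning, e]

/-- Safe substitutions are idempotent. -/
theorem SafeSub.sub_sub (θ : SafeSub K) {i : ℕ} {β : Ty B} (q : TD K i β) :
    (q.sub θ.1).sub θ.1 = q.sub θ.1 := by
  rw [TD.sub, TD.sub, termMeaning_termMeaning]
  congr 1
  funext x
  by_cases hx : x ∈ θ.1.dom
  · refine termMeaning_eq_self fun y hy => ?_
    by_contra hy'
    exact Set.disjoint_left.1 (θ.2 x hx) hy hy'
  · have e : θ.1.toFun x = TD.var x := by_contra hx
    rw [compAsg, e, termMeaning_of_var, e]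

/-- The identity as a safe substitution. -/
def SafeSub.ident : SafeSub K := ⟨Sub.id, fun _ hx => (hx rfl).elim⟩

theorem SafeSub.ident_le (φ : SafeSub K) : SafeSub.ident ≤ φ :=
  ⟨φ.1, fun x => (termMeaning_of_var φ.1.toFun x).symm⟩

/-- The level condition in `substVal` holds for every legal substitution, because a variable goes to
a term whose level is at most its label. -/
theorem mem_substVal (hK : ∀ τ : Ty B, ConTy τ → ∀ i : ℕ, Infinite (K τ i)) {i : ℕ}
    {P : TD K i Ty.p} {G : TD K i Ty.g} {θ : SafeSub K} :
    θ ∈ substVal i P G ↔ Prov i {P.sub θ.1} (G.sub θ.1) := by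
  rw [substVal]
  refine Iff.trans ⟨fun h => h.2, fun h => ⟨fun x hx => ?_, h⟩⟩
    (resolvesId_iff hK (S := ⟨i, {P.sub θ.1}, G.sub θ.1⟩) (Set.finite_singleton _))
  exact NF.Lev.mono hx (θ.1.toFun x).2

/-- Passing from θ to θγ applies γ to the proof, and uniform proofs are stable under substitution.
-/
theorem isUpperSet_substVal (hK : ∀ τ : Ty B, ConTy τ → ∀ i : ℕ, Infinite (K τ i)) (i : ℕ)
    (P : TD K i Ty.p) (G : TD K i Ty.g) : IsUpperSet (substVal i P G) := by
  rintro θ φ ⟨γ, hγ⟩ h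
  rw [mem_substVal hK] at h ⊢
  rw [SafeSub.sub_of_le hγ, SafeSub.sub_of_le hγ, TD.sub_eq_map _ γ, TD.sub_eq_map _ γ]
  exact h.map_single (fun τ hτ i => (hK τ hτ i).nonempty) _

theorem OmegaS.le_iff {U V : OmegaS K} : U ≤ V ↔ U.carrier ⊆ V.carrier := Iff.rfl

theorem OmegaS.carrier_injective : Function.Injective (OmegaS.carrier (K := K)) :=
  fun _ _ h => congrArg OrderDual.toDual (UpperSet.ext h)

theorem OmegaS.carrier_sup (U V : OmegaS K) : (U ⊔ V).carrier = U.carrier ∪ V.carrier := rfl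

theorem OmegaS.carrier_inf (U V : OmegaS K) : (U ⊓ V).carrier = U.carrier ∩ V.carrier := rfl

/-- If a union is everything, one part contains the identity, the least safe substitution; being
upward closed, that part is everything. -/
theorem OmegaS.supIrred_top : SupIrred (⊤ : OmegaS K) := by
  constructor
  · intro h
    have h1 : (⊤ : OmegaS K) ≤ ⊥ := h bot_le
    exact OmegaS.le_iff.1 h1 (show SafeSub.ident ∈ _ from trivial)
  · intro U V h
    have h1 : (SafeSub.ident : SafeSub K) ∈ U.carrier ∪ V.carrier := by
      rw [← OmegaS.carrier_sup, h]
      trivial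
    have key : ∀ U : OmegaS K, (SafeSub.ident : SafeSub K) ∈ U.carrier →
        U = ⊤ := fun U hU => OmegaS.carrier_injective (Set.eq_univ_of_forall fun φ =>
          (OrderDual.ofDual U).upper (SafeSub.ident_le φ) hU)
    exact h1.imp (key U) (key V)

/-- The substitution valuation. -/
def substValuation (hK : ∀ τ : Ty B, ConTy τ → ∀ i : ℕ, Infinite (K τ i)) (i : ℕ)
    (P : TD K i Ty.p) (G : TD K i Ty.g) : OmegaS K :=
  OrderDual.toDual ⟨substVal i P G, isUpperSet_substVal hK i P G⟩

section Sub

variable {i j : ℕ} {α β : Ty B} (θ : Sub K)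

theorem TD.sub_app (f : TD K i (α ⇾ β)) (d : TD K i α) :
    ((termApp K).app f d).sub θ = (termApp K).app (f.sub θ) (d.sub θ) := by
  rw [TD.sub_eq_map, TD.map_app, ← TD.sub_eq_map, ← TD.sub_eq_map]

theorem TD.sub_lift (h : i ≤ j) (q : TD K i β) :
    ((termApp K).lift h q).sub θ = (termApp K).lift h (q.sub θ) :=
  TD.ext ((termMeaning_val _ _).trans (termMeaning_val _ q).symm)

end Sub

/-- Each law is checked pointwise in θ: substitution commutes with the connectives, and what remains
is a rule of `Prov`, its inversion, or closure under substitution or change of program. -/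
theorem substValuation_isValuation (hK : ∀ τ : Ty B, ConTy τ → ∀ i : ℕ, Infinite (K τ i)) :
    IsValuation (termStr K) (substValuation hK) := by
  have hK' : HasCon K := fun τ hτ i => (hK τ hτ i).nonempty
  have mem : ∀ {i : ℕ} {P : TD K i Ty.p} {G : TD K i Ty.g} {θ : SafeSub K},
      θ ∈ (substValuation hK i P G).carrier ↔ Prov i {P.sub θ.1} (G.sub θ.1) := mem_substVal hK
  -- `Inst.map_mono` with the target level raised, as `Prov.mono` requires.
  have inst_sub : ∀ {i : ℕ} {P P' : TD K i Ty.p} {θ : Sub K}, (∀ M, Inst P M → Inst P' M) →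
      ∀ (j : ℕ) (hj : i ≤ j) (M : TD K j Ty.p), Inst ((termApp K).lift hj (P.sub θ)) M →
        Inst ((termApp K).lift hj (P'.sub θ)) M := by
    intro i P P' θ h j hj M hM
    have hF : (QSub.ofAsg θ.toFun).Bdd i j :=
      ⟨fun x hx => ((QSub.ofAsg_bdd θ.toFun i).1 x hx).mono hj,
        fun s hs hx => ((QSub.ofAsg_bdd θ.toFun i).2 s hs hx).mono hj⟩
    have e : ∀ P : TD K i Ty.p, (termApp K).lift hj (P.sub θ) = P.map _ hF :=
      fun P => TD.ext (TD.sub_val P θ)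
    rw [e] at hM ⊢
    exact Inst.map_mono h hF hM
  refine { atom := ?_, mono_level := ?_, top := ?_, and := ?_, or := ?_, imp := ?_, inst := ?_,
           generic := ?_, mono_prog := ?_, backchain := ?_ }
  · intro i x
    refine OmegaS.carrier_injective (Set.eq_univ_of_forall fun θ => mem.2 ?_)
    rw [TD.sub_eq_map, TD.sub_eq_map, TD.map_rigidP, TD.map_rigidG]
    exact .fact rfl (.rigid _)
  · intro i P G θ h
    have h1 := (mem.1 h).map_single hK' (QSub.id_bdd (Nat.le_succ i))
    refine mem.2 ?_
    rw [TD.sub_lift, TD.sub_lift, TD.map_lift_id, TD.map_lift_id]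
    exact h1
  · intro i P
    refine OmegaS.carrier_injective (Set.eq_univ_of_forall fun θ => mem.2 ?_)
    rw [TD.sub_eq_map ((termApp K).topG i), TD.map_topG]
    exact .top _
  · intro i P G G'
    refine OmegaS.carrier_injective (Set.ext fun θ => ?_)
    rw [OmegaS.carrier_inf, Set.mem_inter_iff, mem, mem, mem,
      TD.sub_eq_map ((termApp K).andG G G'), TD.map_andG, Prov.and_iff, ← TD.sub_eq_map,
      ← TD.sub_eq_map]
  · intro i P G G'
    refine OmegaS.carrier_injective (Set.ext fun θ => ?_)
    rw [OmegaS.carrier_sup, Set.mem_union, mem, mem, mem,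
      TD.sub_eq_map ((termApp K).orG G G'), TD.map_orG, Prov.or_iff, ← TD.sub_eq_map,
      ← TD.sub_eq_map]
  · intro i P Q G
    refine OmegaS.carrier_injective (Set.ext fun θ => ?_)
    rw [mem, mem, TD.sub_eq_map ((termApp K).impG Q G), TD.map_impG, Prov.imp_iff,
      TD.sub_eq_map ((termApp K).andP P Q), TD.map_andP, ← TD.sub_eq_map, ← TD.sub_eq_map,
      ← TD.sub_eq_map]
    have e : ∀ (j : ℕ) (hj : i ≤ j) (D D' : TD K i Ty.p), (termApp K).lift hj
        ((termApp K).andP D D') = (termApp K).andP ((termApp K).lift hj D)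
          ((termApp K).lift hj D') := fun j hj D D' => by
      rw [TD.map_lift_id, TD.map_lift_id, TD.map_lift_id, TD.map_andP]
    -- The set of two programs and their conjunction have the same instances at every level, so they
    -- prove the same goals.
    constructor
    · intro h
      refine h.mono ?_
      rintro D (rfl | rfl) j hj M hM
      · exact ⟨_, rfl, by rw [e]; exact .left _ hM⟩
      · exact ⟨_, rfl, by rw [e]; exact .right _ hM⟩
    · intro h
      refine h.mono ?_
      rintro D rfl j hj M hM
      rw [e, Inst.and_iff] at hM
      rcases hM with hM | hM
      · exact ⟨_, Or.inl rfl, hM⟩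
      · exact ⟨_, Or.inr rfl, hM⟩
  · intro i α hα P f
    constructor
    · rintro _ ⟨d, rfl⟩ θ h
      have h1 := mem.1 h
      refine mem.2 ?_
      rw [TD.sub_app] at h1
      rw [TD.sub_eq_map ((termApp K).sigmaG hα f), TD.map_sigmaG, ← TD.sub_eq_map]
      exact .inst _ _ _ h1
    · intro U hU θ h
      have h1 := mem.1 h
      rw [TD.sub_eq_map ((termApp K).sigmaG hα f), TD.map_sigmaG, ← TD.sub_eq_map,
        Prov.sigma_iff] at h1
      obtain ⟨t, h1⟩ := h1
      -- The witness t need not have the form dθ. Applying θ to the whole proof fixes Pθ and fθ by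
      -- idempotence and turns t into tθ, so d = t serves.
      refine hU ⟨t, rfl⟩ (mem.2 ?_)
      have h2 := h1.map_single hK' (QSub.ofAsg_bdd θ.1.toFun i)
      rw [← TD.sub_eq_map, ← TD.sub_eq_map, TD.sub_app, SafeSub.sub_sub, SafeSub.sub_sub] at h2
      rw [TD.sub_app]
      exact h2
  · intro i α hα P f
    constructor
    · rintro _ ⟨d, rfl⟩ θ h
      have h1 := mem.1 h
      rw [TD.sub_eq_map ((termApp K).piG hα f), TD.map_piG, ← TD.sub_eq_map] at h1
      refine mem.2 ?_
      rw [TD.sub_app]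
      exact h1.of_pi hK' _
    · intro U hU θ h
      refine mem.2 ?_
      -- A variable of label i that is fixed by θ and absent from Pθ and fθ: the lower bound at this
      -- one element already gives the universal goal.
      obtain ⟨n, hn⟩ := exists_fresh hα i
        (((f.sub θ.1).fv_finite.union (P.sub θ.1).fv_finite).union θ.1.finite_support)
      simp only [Set.mem_union, not_or] at hn
      have e : θ.1.toFun ⟨α, hα, i, n⟩ = TD.var ⟨α, hα, i, n⟩ := by_contra hn.2
      have h1 := mem.1 (hU ⟨TD.var ⟨α, hα, i, n⟩, rfl⟩ h)
      rw [TD.sub_app, TD.sub, TD.sub, TD.sub, termMeaning_of_var (x := ⟨α, hα, i, n⟩), e] at h1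
      rw [TD.sub_eq_map ((termApp K).piG hα f), TD.map_piG, ← TD.sub_eq_map]
      exact .pi_of_fresh hK' (x := ⟨α, hα, i, n⟩) le_rfl hn.1.1
        (by rintro D rfl; exact hn.1.2) h1
  · intro i P P' G hle θ h
    refine mem.2 ((mem.1 h).mono ?_)
    rintro D rfl j hj M hM
    refine ⟨_, rfl, inst_sub (fun M hM => ?_) j hj M hM⟩
    have := hle (show M ∈ extension P by rwa [extension_eq])
    rwa [extension_eq] at this
  · intro i P G x hle θ h
    have h1 : ((termApp K).impP G x) ∈ extension P :=
      hle (show (termApp K).impP G x ∈ extension ((termApp K).impP G x) by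
        rw [extension_eq]; exact .imp _ _)
    rw [extension_eq] at h1
    have h2 := Inst.map h1 (QSub.ofAsg_bdd θ.1.toFun i)
    rw [TD.map_impP] at h2
    refine mem.2 ?_
    rw [TD.sub_eq_map ((termApp K).rigidG x), TD.map_rigidG, TD.sub_eq_map P]
    refine .backchain rfl h2 ?_
    have h3 := mem.1 h
    rwa [TD.sub_eq_map P, TD.sub_eq_map G] at h3

/-- A rigid constant is assumed for extensionality: functions taking rigid atoms are separated by
applying them to one. The laws of ⊑ are closure and inversion properties of `Inst`. -/
theorem termStr_isUniformStr (hr : Nonempty (K Ty.r 0)) : IsUniformStr (termStr K) where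
  ext {i α β} f f' h := by
    refine TD.ext (NF.Lev.funext hr f.2 f'.2 fun d hd => ?_)
    have := congrArg Subtype.val (h (.of d hd))
    exact ((termApp_app_val f (.of d hd)).symm.trans this).trans (termApp_app_val f' (.of d hd))
  inc_injective e q q' h := by
    have := congrArg Subtype.val h
    exact TD.ext (NF.inc_injective e
      (((termApp_inc_val e q).symm.trans this).trans (termApp_inc_val e q')))
  lift_injective h q q' e := by
    have e' := congrArg Subtype.val e
    exact TD.ext (((termApp_lift_val h q).symm.trans e').trans (termApp_lift_val h q'))
  lift_refl d := rfl
  lift_lift h h' d := rfl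
  lift_app h f d := by
    refine TD.ext ?_
    exact (termApp_app_val f d).trans
      (termApp_app_val ((termApp K).lift h f) ((termApp K).lift h d)).symm
  leP_refl x := subset_rfl
  leP_trans x y z h h' := h.trans h'
  le_andP x y := by
    change extension _ ⊆ extension _
    rw [extension_eq, extension_eq]
    exact fun M h => .left _ h
  andP_comm x y := by
    change extension _ ⊆ extension _
    rw [extension_eq, extension_eq]
    exact fun M h => (Inst.and_iff.1 h).elim (.right _) (.left _)
  andP_top x := by
    change extension _ ⊆ extension _ ∧ extension _ ⊆ extension _ ∧ extension _ ⊆ extension _ ∧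
      extension _ ⊆ extension _
    simp only [extension_eq]
    exact ⟨fun M h => (Inst.and_iff.1 h).resolve_right not_inst_top,
      fun M h => (Inst.and_iff.1 h).resolve_left not_inst_top, fun M h => .left _ h,
      fun M h => .right _ h⟩
  app_le_piP hα f d := by
    change extension _ ⊆ extension _
    rw [extension_eq, extension_eq]
    exact fun M h => .pi hα f d h

end SubstitutionAlgebra

end UCTT

theorem mainTheorem6 {B : Type*} {K : UCTT.Ty B → ℕ → Type*}
    (hK : ∀ τ : UCTT.Ty B, UCTT.ConTy τ → ∀ i : ℕ, Infinite (K τ i)) :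
    SupIrred (⊤ : UCTT.OmegaS K) ∧
    ∃ I : ∀ i : ℕ, UCTT.TD K i UCTT.Ty.p → UCTT.TD K i UCTT.Ty.g → UCTT.OmegaS K,
      (∀ (i : ℕ) (P : UCTT.TD K i UCTT.Ty.p) (G : UCTT.TD K i UCTT.Ty.g),
        (I i P G).carrier = UCTT.substVal i P G) ∧
      UCTT.IsUniformAlgebra (UCTT.termStr K) (fun φ => UCTT.termMeaning φ) I :=
  ⟨UCTT.OmegaS.supIrred_top, UCTT.substValuation hK, fun _ _ _ => rfl,
    UCTT.termStr_isUniformStr (hK _ (Or.inr .nil) 0).nonempty, UCTT.termMeaning_isMeaning,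
    UCTT.substValuation_isValuation hK⟩
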